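/- An instance of Min-Sum Dissatisfaction consists of a finite set $K$ of agents, a finite set $V$ of items, a directed acyclic graph $G_i=(V_i,A_i)$ with $V_i\subseteq V$ for each $i\in K$, and an integer $d$. An item $u\in V_i$ is dominated by an item $v\in V_i$ for agent $i$ if $u=v$ or there is a directed path from $v$ to $u$ in $G_i$. An allocation is a map $\pi:K\to 2^V$ with $\pi(i)\cap\pi(j)=\emptyset$ for $i\ne j$. The dissatisfaction $\delta_\pi(i)$ is the number of items in $V_i$ that are not dominated, for agent $i$, by any item of $\pi(i)$. The question is whether there is an allocation $\pi$ with $\sum_{i\in K}\delta_\pi(i)\le d$. A directed matching is a directed acyclic graph in which each vertex is incident with exactly one arc. Theorem. On the instances in which every $G_i$ is a directed matching, Min-Sum Dissatisfaction can be decided in polynomial time, and an allocation minimizing $\sum_{i\in K}\delta_\pi(i)$ can be computed in polynomial time. (Polynomial time: on a Turing machine, in the length of the input, where $V$ and $K$ are given by listing their elements, i.e. contribute $|V|+|K|$ letters, the graphs by membership vectors of the $V_i$ and adjacency matrices of the $A_i$, and $d$ in binary; the numbers of agents and of items are part of the input.) -/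

import Mathlib

namespace Dissatisfaction

/-- A directed graph `(V', A)` whose vertex set `V'` is a set of items, `V' ⊆ {0, …, n - 1}`. -/
structure PrefGraph (n : ℕ) where
  verts : Finset (Fin n)
  arcs : Finset (Fin n × Fin n)
  arcs_mem : ∀ a ∈ arcs, a.1 ∈ verts ∧ a.2 ∈ verts

namespace PrefGraph

variable {n : ℕ}

/-- `(u, v)` is an arc. -/
def Arc (G : PrefGraph n) (u v : Fin n) : Prop := (u, v) ∈ G.arcs

/-- There is no closed walk of positive length (equivalently, no directed cycle). -/
def Acyclic (G : PrefGraph n) : Prop := ∀ v, ¬ Relation.TransGen G.Arc v v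

/-- The number of arcs that have `v` as head or as tail. -/
def degree (G : PrefGraph n) (v : Fin n) : ℕ :=
  (G.arcs.filter fun a => a.1 = v ∨ a.2 = v).card

/-- A directed matching: an acyclic graph all of whose vertices have degree exactly one. -/
def IsDirectedMatching (G : PrefGraph n) : Prop :=
  G.Acyclic ∧ ∀ v ∈ G.verts, G.degree v = 1

/-- `u` is a predecessor of `v`: `u ≠ v` and there is a directed path from `u` to `v`. -/
def IsPred (G : PrefGraph n) (u v : Fin n) : Prop :=
  u ≠ v ∧ Relation.ReflTransGen G.Arc u v

/-- The item `u` is dominated by the item `v` (both being vertices of `G`). -/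
def DominatedBy (G : PrefGraph n) (u v : Fin n) : Prop :=
  u ∈ G.verts ∧ v ∈ G.verts ∧ (u = v ∨ G.IsPred v u)

end PrefGraph

/-- Items `0, …, n - 1`, agents `0, …, k - 1`, and one acyclic preference graph for each agent. -/
structure Instance where
  numItems : ℕ
  numAgents : ℕ
  graph : Fin numAgents → PrefGraph numItems
  acyclic : ∀ i, (graph i).Acyclic

/-- An allocation assigns pairwise disjoint sets of items to the agents. -/
structure Allocation (I : Instance) where
  items : Fin I.numAgents → Finset (Fin I.numItems)
  disjoint : ∀ i j, i ≠ j → Disjoint (items i) (items j)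

open Classical in
/-- The dissatisfaction of agent `i`: the number of vertices of the preference graph of `i`
that are not dominated by any item allocated to `i`. -/
noncomputable def dissatisfaction {I : Instance} (π : Allocation I) (i : Fin I.numAgents) : ℕ :=
  ((I.graph i).verts.filter fun u => ¬ ∃ v ∈ π.items i, (I.graph i).DominatedBy u v).card

/-- The sum of the dissatisfactions of all the agents. -/
noncomputable def totalDissatisfaction {I : Instance} (π : Allocation I) : ℕ :=
  ∑ i, dissatisfaction π i

/-- The question of the decision problem Min-Sum Dissatisfaction on the input `(I, d)`. -/
def MinSumDissatisfaction (I : Instance) (d : ℤ) : Prop :=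
  ∃ π : Allocation I, (totalDissatisfaction π : ℤ) ≤ d

/-- The allocation has minimum total dissatisfaction. -/
def Allocation.IsOptimal {I : Instance} (π : Allocation I) : Prop :=
  ∀ π' : Allocation I, totalDissatisfaction π ≤ totalDissatisfaction π'

/-- The instances all of whose preference graphs are directed matchings. -/
def MatchingInstance : Type :=
  {I : Instance // ∀ i, (I.graph i).IsDirectedMatching}

/-! Encodings as strings. Instances are written over the three-letter alphabet `Option Bool`
(two bits and the separator `none`), graphs by membership vectors and adjacency matrices,
integers in binary with a sign bit, allocations as a 0-1-matrix. -/

/-- The membership vector of the vertex set, followed by the rows of the adjacency matrix. -/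
def PrefGraph.encode {n : ℕ} (G : PrefGraph n) : List Bool :=
  (List.ofFn fun v => decide (v ∈ G.verts)) ++
    (List.ofFn fun u => List.ofFn fun v => decide ((u, v) ∈ G.arcs)).flatten

/-- One letter for each item, a separator, one letter for each agent, a separator, and the
preference graphs of the agents. -/
def Instance.encode (I : Instance) : List (Option Bool) :=
  List.replicate I.numItems (some true) ++ none ::
    (List.replicate I.numAgents (some true) ++ none ::
      (List.ofFn fun i => (I.graph i).encode.map some).flatten)

/-- The sign bit followed by the binary digits of the absolute value. -/
def encodeInt (d : ℤ) : List Bool :=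
  decide (d < 0) :: Computability.encodeNat d.natAbs

def MatchingInstance.encode (I : MatchingInstance) : List (Option Bool) :=
  I.1.encode

/-- The input of the decision problem: the instance, a separator, and the bound `d`. -/
def encodeInput (p : MatchingInstance × ℤ) : List (Option Bool) :=
  p.1.encode ++ none :: (encodeInt p.2).map some

/-- The 0-1-matrix, row by row, whose entry for agent `i` and item `v` says whether `i` gets `v`. -/
def Allocation.encode {I : Instance} (π : Allocation I) : List Bool :=
  (List.ofFn fun i => List.ofFn fun v => decide (v ∈ π.items i)).flatten

/-- The function `f` is computed by a Turing machine in time polynomial in the input length. -/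
def PolyTimeComputable {α β Γ Δ : Type} (ea : α → List Γ) (eb : β → List Δ) (f : α → β) : Prop :=
  Nonempty (Turing.TM2ComputableInPolyTime ea eb f)

/-- The decision problem `P` is decided by a Turing machine in time polynomial in the
input length. -/
def PolyTimeDecidable {α Γ : Type} (ea : α → List Γ) (P : α → Prop) : Prop :=
  ∃ f : α → Bool, (∀ a, f a = true ↔ P a) ∧ PolyTimeComputable ea Computability.encodeBool f

end Dissatisfaction

/-! In a directed matching every vertex lies on exactly one arc, so the dissatisfaction of an agent
is a sum over the arcs (u, v) of its graph: 0 if the agent owns the tail u, 1 if it owns only the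
head v, 2 if it owns neither (`totalDissatisfaction_eq`). Using an arc thus gains 2 or 1. Call an
item good if it is the tail of some arc of some agent.

Upper bound on the gain. For an arbitrary allocation let T be the number of arcs whose tail is owned
by their agent, and let H₁ and H₀ count the arcs of which only the head is owned, this head being
good or not good, respectively. The gain is 2T + H₁ + H₀ = (T + H₁) + (T + H₀). The arcs counted by
T + H₁ are served by distinct good items, so there are at most as many of them as good items. The
number T + H₀ is at most the maximum number of items that can be matched to distinct arcs, where
good items may only take arcs that start at them and the other items take arcs that end at them. An
assignment of this kind that covers all good items and has maximum size attains both bounds at once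
(`opt_isOptimal`).

Finding the maximum. An arc has two ends, so this is a matching of the vertices of a multigraph to
incident edges, some of which can be taken from one end only. Start from an assignment of all good
items. An attempt (`grow`) gives an unused arc to one of its ends and propagates: an item reached
along an arc that is not taken by the item it is reached from takes this arc. No item loses its
assignment, so the attempt is an improvement as soon as it reaches an unassigned item. The set of
reached items can be left only along the arc taken by the root (`grow_spec`). Hence, if no attempt
improves the assignment, all usable arcs in the component of an unassigned item are in use
(`used_of_deficient`). In such components the size is bounded by the number of arcs, in all the
others every item with a usable arc is assigned; this gives maximality (`card_le_assigned`).

Running time. Let N be the length of the input. Each effective propagation or improvement increases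
a number that is at most N, so N rounds suffice (`Progress.iterate_fixed`). The algorithm is written
in a language `Cmd` of loops of length N over arrays of N³ bits. Such programs are translated to
programs on stacks (`takes_comp`) and these to Turing machines (`polyTime`); the time of a fixed
program is a polynomial in N (`isPoly_time`). The programs have the same loops as the abstract
algorithm, and `loop_simulation` carries correctness over loop by loop. For the decision problem the
cost of the optimal assignment is subtracted from d, one unit at a time, in binary (`exec_decProg`).
-/

/-! ### Structured programs on stacks and their translation to Turing machines -/

/-- Structured programs operating on finitely many stacks. -/
inductive StackProg {K : Type} (Γ : K → Type) : Type
  | skip : StackProg Γ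
  | push (k : K) (a : Γ k) : StackProg Γ
  | pop (k : K) : StackProg Γ
  | seq (p q : StackProg Γ) : StackProg Γ
  | cond (k : K) (c : Option (Γ k) → Bool) (p q : StackProg Γ) : StackProg Γ
  | iter (k : K) (c : Option (Γ k) → Bool) (p : StackProg Γ) : StackProg Γ

namespace StackProg

open Turing Function

variable {K : Type} [DecidableEq K] {Γ : K → Type}

/-- `Run p s s' t`: started with the stacks `s`, the program `p` ends with the stacks `s'`
after `t` steps. -/
inductive Run : StackProg Γ → (∀ k, List (Γ k)) → (∀ k, List (Γ k)) → ℕ → Prop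
  | skip (s) : Run skip s s 1
  | push (s k a) : Run (push k a) s (update s k (a :: s k)) 1
  | pop (s k) : Run (pop k) s (update s k (s k).tail) 1
  | seq {p q s s₁ s₂ t₁ t₂} : Run p s s₁ t₁ → Run q s₁ s₂ t₂ → Run (seq p q) s s₂ (t₁ + t₂)
  | cond_true {k c p q s s' t} : c (s k).head? = true → Run p s s' t →
      Run (cond k c p q) s s' (1 + t)
  | cond_false {k c p q s s' t} : c (s k).head? = false → Run q s s' t →
      Run (cond k c p q) s s' (1 + t)
  | iter_true {k c p s s₁ s₂ t₁ t₂} : c (s k).head? = true → Run p s s₁ t₁ →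
      Run (iter k c p) s₁ s₂ t₂ → Run (iter k c p) s s₂ (1 + t₁ + t₂)
  | iter_false {k c p s} : c (s k).head? = false → Run (iter k c p) s s 1

/-- The labels of the Turing machine of a program. -/
def Lab : StackProg Γ → Type
  | skip => Unit
  | push _ _ => Unit
  | pop _ => Unit
  | seq p q => Lab p ⊕ Lab q
  | cond _ _ p q => Option (Lab p ⊕ Lab q)
  | iter _ _ p => Option (Lab p)

/-- There are finitely many labels. -/
@[reducible]
def labFintype : (p : StackProg Γ) → Fintype (Lab p)
  | skip => inferInstanceAs (Fintype Unit)
  | push _ _ => inferInstanceAs (Fintype Unit)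
  | pop _ => inferInstanceAs (Fintype Unit)
  | seq p q => @instFintypeSum _ _ (labFintype p) (labFintype q)
  | cond _ _ p q => @instFintypeOption _ (@instFintypeSum _ _ (labFintype p) (labFintype q))
  | iter _ _ p => @instFintypeOption _ (labFintype p)

/-- The label at which a program starts. -/
def entry : (p : StackProg Γ) → Lab p
  | skip => ()
  | push _ _ => ()
  | pop _ => ()
  | seq p _ => Sum.inl (entry p)
  | cond _ _ _ _ => none
  | iter _ _ _ => none

/-- The statements of the Turing machine of a program whose labels are embedded by `e`;
the program is left by a jump to `x`. -/
def code {Λ : Type} : (p : StackProg Γ) → (Lab p → Λ) → Λ → Lab p → TM2.Stmt Γ Λ Bool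
  | skip, _, x, _ => .goto fun _ => x
  | push k a, _, x, _ => .push k (fun _ => a) (.goto fun _ => x)
  | pop k, _, x, _ => .pop k (fun v _ => v) (.goto fun _ => x)
  | seq p q, e, _, .inl l => code p (fun l => e (.inl l)) (e (.inr (entry q))) l
  | seq _ q, e, x, .inr l => code q (fun l => e (.inr l)) x l
  | cond k c p q, e, _, none => .peek k (fun _ o => c o) (.branch (fun v => v)
      (.goto fun _ => e (some (.inl (entry p)))) (.goto fun _ => e (some (.inr (entry q)))))
  | cond _ _ p _, e, x, some (.inl l) => code p (fun l => e (some (.inl l))) x l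
  | cond _ _ _ q, e, x, some (.inr l) => code q (fun l => e (some (.inr l))) x l
  | iter k c p, e, x, none => .peek k (fun _ o => c o) (.branch (fun v => v)
      (.goto fun _ => e (some (entry p))) (.goto fun _ => x))
  | iter _ _ p, e, _, some l => code p (fun l => e (some l)) (e none) l

/-- The configuration `c'` is reached from `c` in exactly `t` steps. -/
def Steps {Λ : Type} (m : Λ → TM2.Stmt Γ Λ Bool) (t : ℕ) (c c' : TM2.Cfg Γ Λ Bool) : Prop :=
  (flip bind (TM2.step m))^[t] (some c) = some c'

theorem Steps.trans {Λ : Type} {m : Λ → TM2.Stmt Γ Λ Bool} {t₁ t₂ : ℕ}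
    {c₁ c₂ c₃ : TM2.Cfg Γ Λ Bool} (h₁ : Steps m t₁ c₁ c₂) (h₂ : Steps m t₂ c₂ c₃) :
    Steps m (t₁ + t₂) c₁ c₃ := by
  unfold Steps at *
  rw [Nat.add_comm, iterate_add_apply, h₁, h₂]

theorem Steps.single {Λ : Type} {m : Λ → TM2.Stmt Γ Λ Bool} {l : Λ} {v : Bool}
    {s : ∀ k, List (Γ k)} {c : TM2.Cfg Γ Λ Bool} (h : TM2.stepAux (m l) v s = c) :
    Steps m 1 ⟨some l, v, s⟩ c := by
  simp [Steps, flip, h]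

/-- The machine `m` and the embedding `e` are arbitrary because a subprogram runs inside the machine
of a larger program. The register may hold anything on entry, since each branch comes directly after
a peek that overwrites it. -/
theorem Run.steps {p : StackProg Γ} {s s' : ∀ k, List (Γ k)} {t : ℕ} (h : Run p s s' t) :
    ∀ {Λ : Type} (m : Λ → TM2.Stmt Γ Λ Bool) (e : Lab p → Λ) (x : Λ),
      (∀ l, m (e l) = code p e x l) → ∀ v, ∃ v',
        Steps m t ⟨some (e (entry p)), v, s⟩ ⟨some x, v', s'⟩ := by
  induction h with
  | skip s => intro Λ m e x hm v; exact ⟨v, .single (by simp [hm, code])⟩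
  | push s k a => intro Λ m e x hm v; exact ⟨v, .single (by simp [hm, code])⟩
  | pop s k => intro Λ m e x hm v; exact ⟨v, .single (by simp [hm, code])⟩
  | seq _ _ ih₁ ih₂ =>
    intro Λ m e x hm v
    obtain ⟨v₁, h₁⟩ := ih₁ m (fun l => e (.inl l)) (e (.inr (entry _))) (fun l => hm (.inl l)) v
    obtain ⟨v₂, h₂⟩ := ih₂ m (fun l => e (.inr l)) x (fun l => hm (.inr l)) v₁
    exact ⟨v₂, h₁.trans h₂⟩
  | @cond_true k c p q s s' t hc _ ih =>
    intro Λ m e x hm v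
    obtain ⟨v₁, h₁⟩ := ih m (fun l => e (some (.inl l))) x (fun l => hm (some (.inl l))) true
    refine ⟨v₁, Steps.trans (.single ?_) h₁⟩
    exact (congrArg (fun q => TM2.stepAux q v s) (hm none)).trans (by simp [code, hc])
  | @cond_false k c p q s s' t hc _ ih =>
    intro Λ m e x hm v
    obtain ⟨v₁, h₁⟩ := ih m (fun l => e (some (.inr l))) x (fun l => hm (some (.inr l))) false
    refine ⟨v₁, Steps.trans (.single ?_) h₁⟩
    exact (congrArg (fun q => TM2.stepAux q v s) (hm none)).trans (by simp [code, hc])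
  | @iter_true k c p s s₁ s₂ t₁ t₂ hc _ _ ih₁ ih₂ =>
    intro Λ m e x hm v
    obtain ⟨v₁, h₁⟩ := ih₁ m (fun l => e (some l)) (e none) (fun l => hm (some l)) true
    obtain ⟨v₂, h₂⟩ := ih₂ m e x hm v₁
    refine ⟨v₂, Steps.trans (Steps.trans (.single ?_) h₁) h₂⟩
    exact (congrArg (fun q => TM2.stepAux q v s) (hm none)).trans (by simp [code, hc])
  | @iter_false k c p s hc =>
    intro Λ m e x hm v
    exact ⟨false, .single
      ((congrArg (fun q => TM2.stepAux q v s) (hm none)).trans (by simp [code, hc]))⟩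

/-- The Turing machine of a program. -/
def toTM [Fintype K] (p : StackProg Γ) (k₀ k₁ : K) [Fintype (Γ k₀)] : FinTM2 :=
  letI := labFintype p
  { K := K
    k₀ := k₀
    k₁ := k₁
    Γ := Γ
    Λ := Option (Lab p)
    main := some (entry p)
    σ := Bool
    initialState := false
    m := fun
      -- The final configuration has to carry the initial register value.
      | none => .load (fun _ => false) .halt
      | some l => code p some none l }

/-- The stacks all of which are empty, except that the stack `k` holds `l`. -/
def single (k : K) (l : List (Γ k)) : ∀ j, List (Γ j) := update (fun _ => []) k l

theorem dite_eq_single (k₀ : K) (l : List (Γ k₀)) (k : K) :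
    (if h : k = k₀ then (by rw [h]; exact l) else []) = single k₀ l k := by
  by_cases hk : k = k₀
  · subst hk
    simp [single]
  · simp [single, hk]

/-- A program that computes `f` in polynomial time yields a polynomial-time Turing machine. -/
theorem polyTime [Fintype K] (p : StackProg Γ) (k₀ k₁ : K) [Fintype (Γ k₀)] {α β Γ₀ Γ₁ : Type}
    (ea : α → List Γ₀) (eb : β → List Γ₁) (f : α → β) (e₀ : Γ k₀ ≃ Γ₀) (e₁ : Γ k₁ ≃ Γ₁)
    (T : Polynomial ℕ)
    (h : ∀ a, ∃ t ≤ T.eval (ea a).length,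
      Run p (single k₀ ((ea a).map e₀.symm)) (single k₁ ((eb (f a)).map e₁.symm)) t) :
    Nonempty (TM2ComputableInPolyTime ea eb f) := by
  refine ⟨{ tm := toTM p k₀ k₁, inputAlphabet := e₀, outputAlphabet := e₁, time := T + 1,
            outputsFun := fun a => Classical.choice ?_ }⟩
  obtain ⟨t, ht, hr⟩ := h a
  obtain ⟨v, hv⟩ := hr.steps (toTM p k₀ k₁).m some none (fun l => rfl) false
  have h2 : Steps (toTM p k₀ k₁).m 1 ⟨some none, v, single k₁ ((eb (f a)).map e₁.symm)⟩
      ⟨none, false, single k₁ ((eb (f a)).map e₁.symm)⟩ := .single rfl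
  have h3 := hv.trans h2
  have hi : initList (toTM p k₀ k₁) ((ea a).map e₀.invFun) =
      ⟨some (some (entry p)), false, single k₀ ((ea a).map e₀.symm)⟩ := by
    unfold initList
    congr 1
    funext k
    exact dite_eq_single k₀ _ k
  have ho : haltList (toTM p k₀ k₁) ((eb (f a)).map e₁.invFun) =
      ⟨none, false, single k₁ ((eb (f a)).map e₁.symm)⟩ := by
    unfold haltList
    congr 1
    funext k
    exact dite_eq_single k₁ _ k
  refine ⟨{ steps := t + 1, evals_in_steps := ?_, steps_le_m := ?_ }⟩
  · rw [Option.map_some, hi, ho]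
    exact h3
  · simpa using ht

/-- The program `p` leads from `s` to `s'` within `τ` steps. -/
def Takes (p : StackProg Γ) (s s' : ∀ k, List (Γ k)) (τ : ℕ) : Prop := ∃ t ≤ τ, Run p s s' t

theorem Takes.mono {p : StackProg Γ} {s s' : ∀ k, List (Γ k)} {τ τ' : ℕ} (h : Takes p s s' τ)
    (hτ : τ ≤ τ') : Takes p s s' τ' :=
  let ⟨t, ht, hr⟩ := h
  ⟨t, ht.trans hτ, hr⟩

theorem Takes.to {p : StackProg Γ} {s s' s'' : ∀ k, List (Γ k)} {τ τ' : ℕ} (h : Takes p s s' τ)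
    (hs : s'' = s') (hτ : τ ≤ τ') : Takes p s s'' τ' :=
  hs ▸ h.mono hτ

theorem takes_skip (s : ∀ k, List (Γ k)) : Takes skip s s 1 := ⟨1, le_rfl, .skip s⟩

theorem takes_push (s : ∀ k, List (Γ k)) (k : K) (a : Γ k) :
    Takes (push k a) s (update s k (a :: s k)) 1 := ⟨1, le_rfl, .push s k a⟩

theorem takes_pop (s : ∀ k, List (Γ k)) (k : K) :
    Takes (pop k) s (update s k (s k).tail) 1 := ⟨1, le_rfl, .pop s k⟩

theorem Takes.seq {p q : StackProg Γ} {s s₁ s₂ : ∀ k, List (Γ k)} {τ₁ τ₂ : ℕ}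
    (h₁ : Takes p s s₁ τ₁) (h₂ : Takes q s₁ s₂ τ₂) : Takes (.seq p q) s s₂ (τ₁ + τ₂) :=
  let ⟨_, ht₁, hr₁⟩ := h₁
  let ⟨_, ht₂, hr₂⟩ := h₂
  ⟨_, add_le_add ht₁ ht₂, .seq hr₁ hr₂⟩

theorem Takes.cond {k : K} {c : Option (Γ k) → Bool} {p q : StackProg Γ}
    {s s' : ∀ k, List (Γ k)} {τ : ℕ}
    (h : Takes (if c (s k).head? then p else q) s s' τ) :
    Takes (.cond k c p q) s s' (τ + 1) := by
  obtain ⟨t, ht, hr⟩ := h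
  refine ⟨1 + t, by omega, ?_⟩
  by_cases hc : c (s k).head? = true
  · rw [if_pos hc] at hr
    exact .cond_true hc hr
  · rw [if_neg hc] at hr
    exact .cond_false (by simpa using hc) hr

/-- The sequence `f` lists the stack contents at the successive visits to the loop head; all loops
below are verified by writing down this sequence. -/
theorem takes_iter {k : K} {c : Option (Γ k) → Bool} {p : StackProg Γ} {τ : ℕ}
    (m : ℕ) (f : ℕ → ∀ k, List (Γ k)) (hc : ∀ i < m, c (f i k).head? = true)
    (hp : ∀ i < m, Takes p (f i) (f (i + 1)) τ) (he : c (f m k).head? = false) :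
    Takes (iter k c p) (f 0) (f m) (m * (τ + 1) + 1) := by
  induction m generalizing f with
  | zero => exact ⟨1, by simp, .iter_false he⟩
  | succ m ih =>
    obtain ⟨t, ht, hr⟩ := ih (fun i => f (i + 1)) (fun i hi => hc (i + 1) (by omega))
      (fun i hi => hp (i + 1) (by omega)) he
    obtain ⟨t₁, ht₁, hr₁⟩ := hp 0 (by omega)
    refine ⟨1 + t₁ + t, ?_, .iter_true (hc 0 (by omega)) hr₁ hr⟩
    calc 1 + t₁ + t ≤ 1 + τ + (m * (τ + 1) + 1) := by omega
      _ = _ := by ring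

/-- Repeat a program once for each element of the stack `k`, saving the stack on `k'`. -/
def forEach (k k' : K) (a : Γ k) (a' : Γ k') (p : StackProg Γ) : StackProg Γ :=
  .seq (.iter k Option.isSome (.seq (.pop k) (.seq (.push k' a') p)))
    (.iter k' Option.isSome (.seq (.pop k') (.push k a)))

/-- The counter is moved from `k` to `k'` unit by unit and then moved back. That `G` commutes with
changes of these two stacks expresses that the body neither inspects nor alters them, so the total
effect is an iterate of `G`. The invariant `I` holds what the body needs of its own counters, which
allows nesting. -/
theorem takes_forEach {k k' : K} (hk : k ≠ k') {a : Γ k} {a' : Γ k'} {p : StackProg Γ} {τ m : ℕ}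
    (G : (∀ k, List (Γ k)) → ∀ k, List (Γ k)) (I : (∀ k, List (Γ k)) → Prop)
    (hG : ∀ s l, G (update s k l) = update (G s) k l)
    (hG' : ∀ s l, G (update s k' l) = update (G s) k' l)
    (hI : ∀ s, I s → I (G s)) (hI₁ : ∀ s l, I s → I (update s k l))
    (hI₂ : ∀ s l, I s → I (update s k' l)) (hp : ∀ s, I s → Takes p s (G s) τ)
    {s : ∀ k, List (Γ k)} (hs : I s) (h : s k = List.replicate m a) (h' : s k' = []) :
    Takes (forEach k k' a a' p) s (G^[m] s) (m * (τ + 6) + 2) := by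
  have hIi : ∀ i, I (G^[i] s) := by
    intro i
    induction i with
    | zero => exact hs
    | succ i ih => rw [iterate_succ_apply']; exact hI _ ih
  have hk₁ : ∀ i, (G^[i] s) k = s k := by
    intro i
    induction i with
    | zero => rfl
    | succ i ih =>
      rw [iterate_succ_apply', ← ih]
      conv_lhs => rw [← update_eq_self k (G^[i] s), hG]
      simp
  have hk₂ : ∀ i, (G^[i] s) k' = s k' := by
    intro i
    induction i with
    | zero => rfl
    | succ i ih =>
      rw [iterate_succ_apply', ← ih]
      conv_lhs => rw [← update_eq_self k' (G^[i] s), hG']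
      simp
  have first := takes_iter (p := .seq (.pop k) (.seq (.push k' a') p)) (k := k)
    (c := Option.isSome) (τ := τ + 2) m
    (fun i => update (update (G^[i] s) k (List.replicate (m - i) a)) k' (List.replicate i a'))
    (by
      intro i hi
      obtain ⟨j, hj⟩ : ∃ j, m - i = j + 1 := ⟨m - i - 1, by omega⟩
      simp [hk, hj, List.replicate_succ])
    (by
      intro i hi
      obtain ⟨j, hj⟩ : ∃ j, m - i = j + 1 := ⟨m - i - 1, by omega⟩
      have hj' : m - (i + 1) = j := by omega
      refine ((takes_pop _ _).seq ((takes_push _ _ _).seq (hp _ (hI₂ _ _ (hI₁ _ _ (hI₂ _ _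
        (hI₁ _ _ (hIi i)))))))).to ?_ (by omega)
      simp only [hG, hG', iterate_succ_apply', hj, hj', List.replicate_succ, update_self, ne_eq, hk,
        hk.symm, not_false_eq_true, update_of_ne, List.tail_cons, update_comm hk, update_idem])
    (by simp [hk])
  have second := takes_iter (p := .seq (.pop k') (.push k a)) (k := k')
    (c := Option.isSome) (τ := 2) m
    (fun i => update (update (G^[m] s) k (List.replicate i a)) k' (List.replicate (m - i) a'))
    (by
      intro i hi
      obtain ⟨j, hj⟩ : ∃ j, m - i = j + 1 := ⟨m - i - 1, by omega⟩
      simp [hj, List.replicate_succ])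
    (by
      intro i hi
      obtain ⟨j, hj⟩ : ∃ j, m - i = j + 1 := ⟨m - i - 1, by omega⟩
      have hj' : m - (i + 1) = j := by omega
      refine ((takes_pop _ _).seq (takes_push _ _ _)).to ?_ le_rfl
      simp only [hj, hj', List.replicate_succ, update_self, ne_eq, hk,
        not_false_eq_true, update_of_ne, List.tail_cons, update_comm hk, update_idem])
    (by simp)
  have e₀ : update (update (G^[0] s) k (List.replicate (m - 0) a)) k' (List.replicate 0 a') =
      s := by
    rw [Nat.sub_zero, ← h, iterate_zero, id, update_eq_self, List.replicate_zero, ← h',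
      update_eq_self]
  have e₁ : update (update (G^[m] s) k (List.replicate (m - m) a)) k' (List.replicate m a') =
      update (update (G^[m] s) k (List.replicate 0 a)) k' (List.replicate (m - 0) a') := by
    simp
  have e₂ : update (update (G^[m] s) k (List.replicate m a)) k' (List.replicate (m - m) a') =
      G^[m] s := by
    rw [← h, ← hk₁ m, update_eq_self, Nat.sub_self, List.replicate_zero, ← h', ← hk₂ m,
      update_eq_self]
  beta_reduce at first second
  rw [e₀, e₁] at first
  rw [e₂] at second
  exact (first.seq second).mono (by ring_nf; omega)

/-- Move the contents of the stack `k` to the stack `k'`, where `a₁` stands for the elements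
that satisfy `c` and `a₀` for the others. -/
def moveAll (k k' : K) (c : Option (Γ k) → Bool) (a₁ a₀ : Γ k') : StackProg Γ :=
  .iter k Option.isSome
    (.cond k c (.seq (.pop k) (.push k' a₁)) (.seq (.pop k) (.push k' a₀)))

theorem takes_moveAll {k k' : K} (hk : k ≠ k') (c : Option (Γ k) → Bool) (a₁ a₀ : Γ k')
    (s : ∀ k, List (Γ k)) :
    Takes (moveAll k k' c a₁ a₀) s
      (update (update s k []) k'
        (((s k).map fun x => if c (some x) then a₁ else a₀).reverse ++ s k'))
      ((s k).length * 4 + 1) := by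
  have h := takes_iter (k := k) (c := Option.isSome) (τ := 3)
    (p := .cond k c (.seq (.pop k) (.push k' a₁)) (.seq (.pop k) (.push k' a₀))) (s k).length
    (fun i => update (update s k ((s k).drop i)) k'
      ((((s k).take i).map fun x => if c (some x) then a₁ else a₀).reverse ++ s k'))
    (by intro i hi; simp [hk, hi])
    (by
      intro i hi
      refine Takes.cond ?_
      have hd : (s k).drop i = (s k)[i] :: (s k).drop (i + 1) := List.drop_eq_getElem_cons hi
      simp only [update_of_ne hk, update_self, hd, List.head?_cons]
      split
      all_goals
        refine ((takes_pop _ _).seq (takes_push _ _ _)).to ?_ le_rfl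
        simp only [update_self, ne_eq, hk, hk.symm, not_false_eq_true, update_of_ne,
          List.tail_cons, update_comm hk, update_idem, List.take_succ_eq_append_getElem hi,
          List.map_append, List.map_cons, List.map_nil, List.reverse_append, List.reverse_cons,
          List.reverse_nil, List.nil_append, List.cons_append]
        simp [*])
    (by simp [hk])
  simpa [moveAll] using h

/-- Empty all the stacks of a list. -/
def clearAll : List K → StackProg Γ
  | [] => .skip
  | k :: ks => .seq (.iter k Option.isSome (.pop k)) (clearAll ks)

theorem takes_clearAll (ks : List K) (s : ∀ k, List (Γ k)) {L : ℕ}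
    (hL : ∀ k ∈ ks, (s k).length ≤ L) :
    Takes (clearAll ks) s (fun k => if k ∈ ks then [] else s k) (ks.length * (L * 2 + 1) + 1) := by
  induction ks generalizing s with
  | nil => simpa [clearAll] using takes_skip s
  | cons k ks ih =>
    have h := takes_iter (k := k) (c := Option.isSome) (τ := 1) (p := .pop (Γ := Γ) k) (s k).length
      (fun i => update s k ((s k).drop i)) (by intro i hi; simp [hi])
      (by
        intro i hi
        refine (takes_pop _ _).to ?_ le_rfl
        simp)
      (by simp)
    simp only [List.drop_zero, update_eq_self, List.drop_length] at h
    have h2 := h.seq (ih (update s k []) (by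
      intro j hj
      by_cases hjk : j = k
      · subst hjk; simp
      · rw [update_of_ne hjk]; exact hL j (by simp [hj])))
    have hl := hL k (by simp)
    refine h2.to ?_ ?_
    · funext j
      by_cases hjk : j = k
      · subst hjk; simp
      · simp [hjk]
    · rw [List.length_cons, Nat.succ_mul]
      omega

end StackProg


/-! ### Programs with bounded loops on arrays of bits -/

/-- Programs whose loops run over `0, …, N - 1`, where `N` is the length of the input. The memory
consists of three-dimensional arrays of bits, indexed by the loop variables. -/
inductive Cmd (V A : Type) : Type
  | skip : Cmd V A
  | seq (p q : Cmd V A) : Cmd V A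
  | write (a : A) (x y z : V) (b : Bool) : Cmd V A
  | test (a : A) (x y z : V) (p q : Cmd V A) : Cmd V A
  | loop (x : V) (p : Cmd V A) : Cmd V A
  | read (p q r : Cmd V A) : Cmd V A
  | emit (b : Bool) : Cmd V A

namespace Cmd

/-- The arrays, the rest of the input and the output produced so far. -/
structure Mem (A : Type) where
  arr : A → ℕ → ℕ → ℕ → Bool
  inp : List (Option Bool)
  out : List Bool

variable {V A : Type} [DecidableEq V] [DecidableEq A]

/-- Change one entry of an array. -/
def Mem.write (m : Mem A) (a : A) (i j k : ℕ) (b : Bool) : Mem A :=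
  { m with arr := fun a₁ i₁ j₁ k₁ =>
      if a₁ = a ∧ i₁ = i ∧ j₁ = j ∧ k₁ = k then b else m.arr a₁ i₁ j₁ k₁ }

/-- The semantics of programs. -/
def exec (N : ℕ) : Cmd V A → (V → ℕ) → Mem A → Mem A
  | skip, _, m => m
  | seq p q, e, m => exec N q e (exec N p e m)
  | write a x y z b, e, m => m.write a (e x) (e y) (e z) b
  | test a x y z p q, e, m =>
      if m.arr a (e x) (e y) (e z) then exec N p e m else exec N q e m
  | loop x p, e, m => (List.range N).foldl (fun m i => exec N p (Function.update e x i) m) m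
  | read p q r, e, m =>
      match m.inp with
      | some true :: l => exec N r e { m with inp := l }
      | some false :: l => exec N q e { m with inp := l }
      | l => exec N p e { m with inp := l.tail }
  | emit b, _, m => { m with out := m.out ++ [b] }

/-- The loops on the variables of `B` may be entered only outside of the program. -/
def WF : Cmd V A → List V → Bool
  | skip, _ => true
  | seq p q, B => WF p B && WF q B
  | write _ _ _ _ _, _ => true
  | test _ _ _ _ p q, B => WF p B && WF q B
  | loop x p, B => !B.contains x && WF p (x :: B)
  | read p q r, B => WF p B && (WF q B && WF r B)
  | emit _, _ => true

/-- The stacks used by the translation of programs. -/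
inductive Stk (V A : Type) : Type
  | inp | inp2 | out | outr | len1 | len2 | t1 | t2 | t3 | rgt
  | up (x : V) | down (x : V) | arr (a : A)
  deriving DecidableEq, Fintype

/-- The alphabets of the stacks. -/
abbrev Alph : Stk V A → Type
  | .inp => Option Bool
  | .inp2 => Option Bool
  | .out => Bool
  | .outr => Bool
  | .len1 => Bool
  | .len2 => Bool
  | .t1 => Bool
  | .t2 => Bool
  | .t3 => Bool
  | .rgt => Bool
  | .up _ => Bool
  | .down _ => Bool
  | .arr _ => Bool

open StackProg Function

/-- The contents of all the stacks. -/
abbrev Stacks (V A : Type) := ∀ k : Stk V A, List (Alph k)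

/-- Move one bit of an array to the stack `rgt`. -/
def adv (a : A) : StackProg (Alph (V := V) (A := A)) :=
  .cond (.arr a) (fun o : Option Bool => o == some true)
    (.seq (.pop (.arr a)) (.push .rgt true)) (.seq (.pop (.arr a)) (.push .rgt false))

/-- The effect of `adv` on the stacks. -/
def advF (a : A) (s : Stacks V A) : Stacks V A :=
  update (update s (.arr a) (List.tail (s (.arr a)))) .rgt
    (((List.head? (s (.arr a)) : Option Bool).getD false :: (s .rgt : List Bool) : List Bool))

/-- An exhausted stack yields `false`: an array may be stored without its trailing zeros, and empty
stacks represent arrays that are false everywhere. -/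
theorem takes_adv (a : A) (s : Stacks V A) : Takes (adv a) s (advF a s) 3 := by
  refine Takes.cond ?_
  have h : (Stk.rgt : Stk V A) ≠ .arr a := by simp
  split
  next hc =>
    refine ((takes_pop _ _).seq (takes_push _ _ _)).to ?_ le_rfl
    simp only [beq_iff_eq] at hc
    simp [advF, h, hc]
  next hc =>
    refine ((takes_pop _ _).seq (takes_push _ _ _)).to ?_ le_rfl
    have : (List.head? (s (.arr a)) : Option Bool).getD false = false := by
      revert hc
      generalize (List.head? (s (.arr a)) : Option Bool) = o
      rcases o with _ | _ | _ <;> simp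
    simp [advF, h, this]

theorem advF_update (a : A) (s : Stacks V A) (k : Stk V A) (l : List (Alph k))
    (h₁ : k ≠ .rgt) (h₂ : k ≠ .arr a) : advF a (update s k l) = update (advF a s) k l := by
  simp only [advF, update_of_ne h₁.symm, update_of_ne h₂.symm]
  rw [update_comm h₁.symm, update_comm h₂.symm]

theorem iterate_advF_update (a : A) (n : ℕ) (s : Stacks V A) (k : Stk V A) (l : List (Alph k))
    (h₁ : k ≠ .rgt) (h₂ : k ≠ .arr a) :
    (advF a)^[n] (update s k l) = update ((advF a)^[n] s) k l := by
  induction n with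
  | zero => rfl
  | succ n ih => rw [iterate_succ_apply', iterate_succ_apply', ih, advF_update _ _ _ _ h₁ h₂]

theorem iterate_advF_of_ne (a : A) (n : ℕ) (s : Stacks V A) (k : Stk V A)
    (h₁ : k ≠ .rgt) (h₂ : k ≠ .arr a) : (advF a)^[n] s k = s k := by
  conv_lhs => rw [← update_eq_self k s, iterate_advF_update _ _ _ _ _ h₁ h₂]
  simp

theorem iterate_advF_arr (a : A) (n : ℕ) (s : Stacks V A) :
    (advF a)^[n] s (.arr a) = List.drop n (s (.arr a)) := by
  induction n with
  | zero => rfl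
  | succ n ih =>
    have h : (Stk.arr a : Stk V A) ≠ .rgt := by simp
    rw [iterate_succ_apply', advF, update_of_ne h, update_self, ih]
    simp

theorem iterate_advF_rgt (a : A) (n : ℕ) (s : Stacks V A) :
    (advF a)^[n] s .rgt =
      (((List.range n).map fun i => (s (.arr a) : List Bool).getD i false).reverse
      ++ (s .rgt : List Bool) : List Bool) := by
  induction n with
  | zero => rfl
  | succ n ih =>
    rw [iterate_succ_apply', advF, update_self, ih, iterate_advF_arr, List.range_succ]
    simp [Alph, List.head?_drop, List.getD]

/-- Repeat a program once for each unit of a counter. -/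
abbrev eachUp (x : V) (p : StackProg (Alph (V := V) (A := A))) :
    StackProg (Alph (V := V) (A := A)) :=
  forEach (.up x) .t1 true true p

/-- Two copies of N in unary, each with its own auxiliary stack, so that they can be nested to count
to N². -/
abbrev eachLen1 (p : StackProg (Alph (V := V) (A := A))) : StackProg (Alph (V := V) (A := A)) :=
  forEach .len1 .t2 true true p

abbrev eachLen2 (p : StackProg (Alph (V := V) (A := A))) : StackProg (Alph (V := V) (A := A)) :=
  forEach .len2 .t3 true true p

/-- Advance in an array to the position with the coordinates `x, y, z`. -/
def walk (a : A) (x y z : V) : StackProg (Alph (V := V) (A := A)) :=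
  .seq (eachUp x (eachLen1 (eachLen2 (adv a))))
    (.seq (eachUp y (eachLen1 (adv a))) (eachUp z (adv a)))

/-- The stacks represent a memory and an environment. -/
structure Rep (N : ℕ) (e : V → ℕ) (m : Mem A) (s : Stacks V A) : Prop where
  inp : s .inp = m.inp
  inp2 : s .inp2 = []
  out : s .out = []
  outr : s .outr = List.reverse m.out
  len1 : s .len1 = List.replicate N true
  len2 : s .len2 = List.replicate N true
  t1 : s .t1 = []
  t2 : s .t2 = []
  t3 : s .t3 = []
  rgt : s .rgt = []
  lt : ∀ x, e x < N
  up : ∀ x, s (.up x) = List.replicate (e x) true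
  down : ∀ x, s (.down x) = List.replicate (N - e x) true
  length : ∀ a, (s (.arr a)).length ≤ N ^ 3
  arr : ∀ a i j k, i < N → j < N → k < N →
    (s (.arr a) : List Bool).getD (i * (N * N) + j * N + k) false = m.arr a i j k

/-- The time for one pass of `forEach`. -/
def eachTime (N τ : ℕ) : ℕ := N * (τ + 6) + 2

/-- The time of `walk`. -/
def walkTime (N : ℕ) : ℕ :=
  eachTime N (eachTime N (eachTime N 3)) + (eachTime N (eachTime N 3) + eachTime N 3)

/-- Single steps add up: N² of them for each unit of the first coordinate, N for each unit of the
second, one for each unit of the third. -/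
theorem takes_walk {N : ℕ} {e : V → ℕ} {m : Mem A} {s : Stacks V A} (h : Rep N e m s) (a : A)
    (x y z : V) :
    Takes (walk a x y z) s ((advF a)^[e x * (N * N) + e y * N + e z] s) (walkTime N) := by
  have one : ∀ s : Stacks V A, s .len1 = List.replicate N true → s .t2 = [] →
      Takes (eachLen1 (adv a)) s ((advF a)^[N] s) (eachTime N 3) := fun s h₁ h₂ =>
    takes_forEach (by simp) (advF a) (fun _ => True)
      (fun _ _ => advF_update _ _ _ _ (by simp) (by simp))
      (fun _ _ => advF_update _ _ _ _ (by simp) (by simp)) (fun _ _ => trivial)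
      (fun _ _ _ => trivial) (fun _ _ _ => trivial) (fun s _ => takes_adv a s) trivial h₁ h₂
  have two : ∀ s : Stacks V A, s .len2 = List.replicate N true → s .t3 = [] →
      Takes (eachLen2 (adv a)) s ((advF a)^[N] s) (eachTime N 3) := fun s h₁ h₂ =>
    takes_forEach (by simp) (advF a) (fun _ => True)
      (fun _ _ => advF_update _ _ _ _ (by simp) (by simp))
      (fun _ _ => advF_update _ _ _ _ (by simp) (by simp)) (fun _ _ => trivial)
      (fun _ _ _ => trivial) (fun _ _ _ => trivial) (fun s _ => takes_adv a s) trivial h₁ h₂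
  have sq : ∀ s : Stacks V A, s .len1 = List.replicate N true → s .t2 = [] →
      s .len2 = List.replicate N true → s .t3 = [] →
      Takes (eachLen1 (eachLen2 (adv a))) s ((advF a)^[N * N] s) (eachTime N (eachTime N 3)) := by
    intro s h₁ h₂ h₃ h₄
    rw [iterate_mul]
    exact takes_forEach (by simp) ((advF a)^[N])
      (fun s => s .len2 = List.replicate N true ∧ s .t3 = [])
      (fun _ _ => iterate_advF_update _ _ _ _ _ (by simp) (by simp))
      (fun _ _ => iterate_advF_update _ _ _ _ _ (by simp) (by simp))
      (fun s hs => by simpa [iterate_advF_of_ne] using hs)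
      (fun s l hs => by simpa using hs) (fun s l hs => by simpa using hs)
      (fun s hs => two s hs.1 hs.2) ⟨h₃, h₄⟩ h₁ h₂
  have hN : ∀ x τ, e x * (τ + 6) + 2 ≤ eachTime N τ := fun x τ =>
    Nat.add_le_add_right (Nat.mul_le_mul_right _ (h.lt x).le) _
  have first : Takes (eachUp x (eachLen1 (eachLen2 (adv a)))) s ((advF a)^[e x * (N * N)] s)
      (eachTime N (eachTime N (eachTime N 3))) := by
    rw [Nat.mul_comm, iterate_mul]
    exact (takes_forEach (by simp) ((advF a)^[N * N])
      (fun s => (s .len1 = List.replicate N true ∧ s .t2 = []) ∧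
        s .len2 = List.replicate N true ∧ s .t3 = [])
      (fun _ _ => iterate_advF_update _ _ _ _ _ (by simp) (by simp))
      (fun _ _ => iterate_advF_update _ _ _ _ _ (by simp) (by simp))
      (fun s hs => by simpa [iterate_advF_of_ne] using hs)
      (fun s l hs => by simpa using hs) (fun s l hs => by simpa using hs)
      (fun s hs => sq s hs.1.1 hs.1.2 hs.2.1 hs.2.2) ⟨⟨h.len1, h.t2⟩, h.len2, h.t3⟩
      (h.up x) h.t1).mono (hN _ _)
  have second : Takes (eachUp y (eachLen1 (adv a))) ((advF a)^[e x * (N * N)] s)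
      ((advF a)^[e y * N] ((advF a)^[e x * (N * N)] s)) (eachTime N (eachTime N 3)) := by
    rw [Nat.mul_comm (e y), iterate_mul _ N (e y)]
    exact (takes_forEach (by simp) ((advF a)^[N])
      (fun s => s .len1 = List.replicate N true ∧ s .t2 = [])
      (fun _ _ => iterate_advF_update _ _ _ _ _ (by simp) (by simp))
      (fun _ _ => iterate_advF_update _ _ _ _ _ (by simp) (by simp))
      (fun s hs => by simpa [iterate_advF_of_ne] using hs)
      (fun s l hs => by simpa using hs) (fun s l hs => by simpa using hs)
      (fun s hs => one s hs.1 hs.2)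
      ⟨by simpa [iterate_advF_of_ne] using h.len1, by simpa [iterate_advF_of_ne] using h.t2⟩
      (by simpa [iterate_advF_of_ne] using h.up y)
      (by simpa [iterate_advF_of_ne] using h.t1)).mono (hN _ _)
  have third : Takes (eachUp z (adv a)) ((advF a)^[e y * N] ((advF a)^[e x * (N * N)] s))
      ((advF a)^[e z] ((advF a)^[e y * N] ((advF a)^[e x * (N * N)] s))) (eachTime N 3) :=
    (takes_forEach (by simp) (advF a) (fun _ => True)
      (fun _ _ => advF_update _ _ _ _ (by simp) (by simp))
      (fun _ _ => advF_update _ _ _ _ (by simp) (by simp)) (fun _ _ => trivial)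
      (fun _ _ _ => trivial) (fun _ _ _ => trivial) (fun s _ => takes_adv a s) trivial
      (by simpa [iterate_advF_of_ne] using h.up z)
      (by simpa [iterate_advF_of_ne] using h.t1)).mono (hN _ _)
  refine (first.seq (second.seq third)).to ?_ le_rfl
  rw [← iterate_add_apply, ← iterate_add_apply]
  congr 1
  ring

/-- Move the bits on the stack `rgt` back to their array. -/
def rewind (a : A) : StackProg (Alph (V := V) (A := A)) :=
  moveAll .rgt (.arr a) (fun o : Option Bool => o == some true) true false

theorem takes_rewind (a : A) (s : Stacks V A) :
    Takes (rewind a) s (update (update s .rgt []) (.arr a)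
      (List.reverse (s .rgt : List Bool) ++ (s (.arr a) : List Bool) : List Bool))
      ((s .rgt).length * 4 + 1) := by
  refine (takes_moveAll (by simp) _ _ _ s).to ?_ le_rfl
  have : ∀ l : List Bool,
      l.map (fun x => if (some x == some true) = true then true else false) = l := by
    intro l
    conv_rhs => rw [← List.map_id l]
    congr 1
    funext x
    cases x <;> rfl
  congr 2
  exact congrArg List.reverse (this (s .rgt)).symm

theorem index_lt {N i j k : ℕ} (hi : i < N) (hj : j < N) (hk : k < N) :
    i * (N * N) + j * N + k < N ^ 3 := by
  have h₁ : j * N + k < N * N := by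
    calc j * N + k < j * N + N := by omega
      _ = (j + 1) * N := by ring
      _ ≤ N * N := Nat.mul_le_mul_right _ hj
  calc i * (N * N) + j * N + k < i * (N * N) + N * N := by omega
    _ = (i + 1) * (N * N) := by ring
    _ ≤ N * (N * N) := Nat.mul_le_mul_right _ hi
    _ = N ^ 3 := by ring

/-- The index is a number written in base N; two divisions with remainder by N recover the lower
digits, and the leading one is unrestricted. -/
theorem index_inj {N i j k i' j' k' : ℕ} (hj : j < N) (hk : k < N) (hj' : j' < N) (hk' : k' < N)
    (h : i * (N * N) + j * N + k = i' * (N * N) + j' * N + k') : i = i' ∧ j = j' ∧ k = k' := by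
  have e : ∀ i j k, i * (N * N) + j * N + k = (i * N + j) * N + k := fun i j k => by ring
  rw [e, e] at h
  have hN : 0 < N := by omega
  have d : ∀ q r, r < N → (q * N + r) / N = q ∧ (q * N + r) % N = r := fun q r hr =>
    ⟨by rw [Nat.add_comm, Nat.add_mul_div_right _ _ hN, Nat.div_eq_of_lt hr, Nat.zero_add],
     by rw [Nat.add_comm, Nat.add_mul_mod_self_right, Nat.mod_eq_of_lt hr]⟩
  have h₁ := d (i * N + j) k hk
  have h₂ := d (i' * N + j') k' hk'
  rw [h] at h₁
  have hq := h₁.1.symm.trans h₂.1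
  have h₃ := d i j hj
  have h₄ := d i' j' hj'
  rw [hq] at h₃
  exact ⟨h₃.1.symm.trans h₄.1, h₃.2.symm.trans h₄.2, h₁.2.symm.trans h₂.2⟩

theorem Rep.update_arr {N : ℕ} {e : V → ℕ} {m m' : Mem A} {s : Stacks V A} (h : Rep N e m s)
    (a : A) (l : List Bool) (hl : l.length ≤ N ^ 3) (hi : m'.inp = m.inp) (ho : m'.out = m.out)
    (ha : ∀ i j k, i < N → j < N → k < N →
      l.getD (i * (N * N) + j * N + k) false = m'.arr a i j k)
    (hb : ∀ b, b ≠ a → m'.arr b = m.arr b) : Rep N e m' (update s (.arr a) l) where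
  inp := by simpa [hi] using h.inp
  inp2 := by simpa using h.inp2
  out := by simpa using h.out
  outr := by simpa [ho] using h.outr
  len1 := by simpa using h.len1
  len2 := by simpa using h.len2
  t1 := by simpa using h.t1
  t2 := by simpa using h.t2
  t3 := by simpa using h.t3
  rgt := by simpa using h.rgt
  lt := h.lt
  up x := by simpa using h.up x
  down x := by simpa using h.down x
  length b := by
    by_cases hba : b = a
    · subst hba; simpa using hl
    · rw [update_of_ne (by simpa using hba)]; exact h.length b
  arr b i j k hi hj hk := by
    by_cases hba : b = a
    · subst hba; simpa using ha i j k hi hj hk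
    · rw [update_of_ne (by simpa using hba), hb b hba]; exact h.arr b i j k hi hj hk

/-- The n bits passed by a walk lie in reverse order on `rgt`; moving them back restores their order
in front of `l`, the possibly modified rest of the array. Positions beyond the old end have become
explicit zeros. -/
theorem rewind_state (a : A) (n : ℕ) (s : Stacks V A) (hs : s .rgt = []) (l : List Bool)
    (s₁ : Stacks V A) (h₁ : s₁ (.arr a) = l) (h : ∀ k, k ≠ .arr a → s₁ k = (advF a)^[n] s k) :
    Takes (rewind a) s₁ (update s (.arr a)
      (((List.range n).map fun i => (s (.arr a) : List Bool).getD i false) ++ l)) (n * 4 + 1) := by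
  have hr : s₁ .rgt =
      ((List.range n).map fun i => (s (.arr a) : List Bool).getD i false).reverse := by
    rw [h _ (by simp), iterate_advF_rgt, hs, List.append_nil]
  refine (takes_rewind a s₁).to ?_ (by simp [hr])
  funext k
  by_cases hk : k = .arr a
  · subst hk
    simp [hr, h₁]
  · rw [update_of_ne hk, update_of_ne hk]
    by_cases hk' : k = .rgt
    · subst hk'
      simp [hs]
    · rw [update_of_ne hk', h k hk, iterate_advF_of_ne a n s k hk' hk]

/-- The explicit zeros left behind by a walk do not change the array that a stack represents. -/
theorem getD_pad (l l' : List Bool) (n i : ℕ)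
    (h : ∀ j, l'.getD j false = l.getD (n + j) false) :
    (((List.range n).map fun i => l.getD i false) ++ l').getD i false = l.getD i false := by
  by_cases hi : i < n
  · simp only [List.getD, List.getElem?_append, List.length_map, List.length_range, hi, if_true,
      List.getElem?_map, List.getElem?_range hi]
    rfl
  · have hd := h (i - n)
    rw [show n + (i - n) = i by omega] at hd
    rw [← hd]
    simp only [List.getD, List.getElem?_append, List.length_map, List.length_range, hi, if_false]

/-- The translation of programs. -/
def comp : Cmd V A → StackProg (Alph (V := V) (A := A))
  | skip => .skip
  | seq p q => .seq (comp p) (comp q)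
  | write a x y z b =>
      .seq (walk a x y z) (.seq (.pop (.arr a)) (.seq (.push (.arr a) b) (rewind a)))
  | test a x y z p q =>
      .seq (walk a x y z) (.cond (.arr a) (fun o : Option Bool => o == some true)
        (.seq (rewind a) (comp p)) (.seq (rewind a) (comp q)))
  | loop x p =>
      .seq (.iter (.down x) Option.isSome
          (.seq (comp p) (.seq (.pop (.down x)) (.push (.up x) true))))
        (.iter (.up x) Option.isSome (.seq (.pop (.up x)) (.push (.down x) true)))
  | read p q r =>
      .cond .inp (fun o : Option (Option Bool) => o == some (some true))
        (.seq (.pop .inp) (comp r))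
        (.cond .inp (fun o : Option (Option Bool) => o == some (some false))
          (.seq (.pop .inp) (comp q)) (.seq (.pop .inp) (comp p)))
  | emit b => .push .outr b

/-- The time needed by the translation of a program. -/
def time (N : ℕ) : Cmd V A → ℕ
  | skip => 1
  | seq p q => time N p + time N q
  | write _ _ _ _ _ => walkTime N + (N ^ 3 * 4 + 3)
  | test _ _ _ _ p q => walkTime N + (N ^ 3 * 4 + 2 + time N p + time N q)
  | loop _ p => N * (time N p + 6) + 2
  | read p q r => time N p + time N q + time N r + 3
  | emit _ => 1

theorem Rep.incr {N : ℕ} {e : V → ℕ} {m : Mem A} {s : Stacks V A} (h : Rep N e m s) (x : V) :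
    Takes (.seq (.pop (.down x)) (.push (.up x) true)) s
      (update (update s (.down x) (List.replicate (N - (e x + 1)) true)) (.up x)
        (List.replicate (e x + 1) true)) 2 := by
  refine ((takes_pop _ _).seq (takes_push _ _ _)).to ?_ le_rfl
  rw [h.down, update_of_ne (by simp), h.up, List.tail_replicate, List.replicate_succ]
  rfl

theorem Rep.set_counter {N : ℕ} {e : V → ℕ} {m : Mem A} {s : Stacks V A} (h : Rep N e m s) (x : V)
    {i : ℕ} (hi : i < N) :
    Rep N (update e x i) m (update (update s (.down x) (List.replicate (N - i) true)) (.up x)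
        (List.replicate i true)) where
  inp := by simpa using h.inp
  inp2 := by simpa using h.inp2
  out := by simpa using h.out
  outr := by simpa using h.outr
  len1 := by simpa using h.len1
  len2 := by simpa using h.len2
  t1 := by simpa using h.t1
  t2 := by simpa using h.t2
  t3 := by simpa using h.t3
  rgt := by simpa using h.rgt
  lt y := by
    by_cases hy : y = x
    · subst hy; simpa using hi
    · simpa [hy] using h.lt y
  up y := by
    by_cases hy : y = x
    · subst hy; simp
    · simpa [hy] using h.up y
  down y := by
    by_cases hy : y = x
    · subst hy; simp
    · simpa [hy] using h.down y
  length a := by simpa using h.length a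
  arr a i j k hi hj hk := by simpa using h.arr a i j k hi hj hk

/-- Induction on the program. The list `B` contains the variables of the surrounding loops; all
other variables are 0, which is the state of the counters in which a loop has to start. -/
theorem takes_comp {N : ℕ} (c : Cmd V A) : ∀ (B : List V) (e : V → ℕ) (m : Mem A)
    (s : Stacks V A), c.WF B = true → (∀ x ∉ B, e x = 0) → Rep N e m s →
    ∃ s', Takes (comp c) s s' (time N c) ∧ Rep N e (exec N c e m) s' := by
  induction c with
  | skip => intro B e m s _ _ h; exact ⟨s, takes_skip s, h⟩
  | seq p q ihp ihq =>
    intro B e m s hw he h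
    simp only [WF, Bool.and_eq_true] at hw
    obtain ⟨s₁, t₁, r₁⟩ := ihp B e m s hw.1 he h
    obtain ⟨s₂, t₂, r₂⟩ := ihq B e _ s₁ hw.2 he r₁
    exact ⟨s₂, t₁.seq t₂, r₂⟩
  | write a x y z b =>
    intro B e m s _ _ h
    have hlt := index_lt (h.lt x) (h.lt y) (h.lt z)
    set n := e x * (N * N) + e y * N + e z with hn
    -- If the stored array ends before position n, the pop has no effect and the gap is filled by
    -- the zeros collected during the walk.
    refine ⟨_, ((takes_walk h a x y z).seq ((takes_pop _ _).seq ((takes_push _ _ _).seq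
      (rewind_state a n s h.rgt (b :: (List.drop (n + 1) (s (.arr a)))) _ ?_ ?_)))).mono ?_, ?_⟩
    · simp [← hn, iterate_advF_arr]
    · intro k hk
      rw [update_of_ne hk, update_of_ne hk]
    · simp only [time]
      omega
    · have hl := h.length a
      refine h.update_arr a _ ?_ rfl rfl ?_ ?_
      · simp only [List.length_append, List.length_map, List.length_range, List.length_cons,
          List.length_drop]
        omega
      · intro i j k hi hj hk
        simp only [exec, Mem.write, true_and]
        by_cases hh : i = e x ∧ j = e y ∧ k = e z
        · rw [if_pos hh]
          obtain ⟨rfl, rfl, rfl⟩ := hh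
          rw [← hn]
          simp [List.getD]
        · rw [if_neg hh, ← h.arr a i j k hi hj hk]
          have hne : i * (N * N) + j * N + k ≠ n := fun h' =>
            hh (index_inj hj hk (h.lt y) (h.lt z) h')
          generalize i * (N * N) + j * N + k = r at hne
          have := getD_pad (s (.arr a)) (List.drop n (s (.arr a))) n r
            (fun j => by simp [List.getD])
          rw [← this]
          simp only [List.getD, List.getElem?_append, List.length_map, List.length_range]
          split
          · rfl
          · obtain ⟨d, hd⟩ : ∃ d, r - n = d + 1 := ⟨r - n - 1, by omega⟩
            simp [hd, Nat.add_assoc, Nat.add_comm 1 d]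
      · intro b' hb'
        simp [exec, Mem.write, hb']
  | test a x y z p q ihp ihq =>
    intro B e m s hw he h
    simp only [WF, Bool.and_eq_true] at hw
    have hlt := index_lt (h.lt x) (h.lt y) (h.lt z)
    have hwalk := takes_walk h a x y z
    have harr := h.arr a _ _ _ (h.lt x) (h.lt y) (h.lt z)
    set n := e x * (N * N) + e y * N + e z with hn
    have hrew := rewind_state a n s h.rgt (List.drop n (s (.arr a))) _
      (iterate_advF_arr a n s) (fun _ _ => rfl)
    have hr : Rep N e m (update s (.arr a)
        (((List.range n).map fun i => (s (.arr a) : List Bool).getD i false) ++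
          List.drop n (s (.arr a)))) := by
      have hl := h.length a
      refine h.update_arr a _ ?_ rfl rfl ?_ (fun _ _ => rfl)
      · simp only [List.length_append, List.length_map, List.length_range, List.length_drop]
        omega
      · intro i j k hi hj hk
        rw [getD_pad _ _ _ _ (fun j => by simp [List.getD]), h.arr a i j k hi hj hk]
    have hc : (List.head? ((advF a)^[n] s (.arr a)) == some true) = m.arr a (e x) (e y) (e z) := by
      rw [iterate_advF_arr, ← harr, List.head?_drop, List.getD]
      rcases (s (.arr a))[n]? with _ | _ | _ <;> rfl
    obtain ⟨sp, tp, rp⟩ := ihp B e m _ hw.1 he hr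
    obtain ⟨sq, tq, rq⟩ := ihq B e m _ hw.2 he hr
    by_cases hb : m.arr a (e x) (e y) (e z) = true
    · refine ⟨sp, (hwalk.seq (Takes.cond (τ := N ^ 3 * 4 + 1 + time N p) ?_)).mono ?_, ?_⟩
      · rw [hc, if_pos hb]
        exact (hrew.seq tp).mono (by omega)
      · simp only [time]; omega
      · simpa [exec, hb] using rp
    · refine ⟨sq, (hwalk.seq (Takes.cond (τ := N ^ 3 * 4 + 1 + time N q) ?_)).mono ?_, ?_⟩
      · rw [hc, if_neg hb]
        exact (hrew.seq tq).mono (by omega)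
      · simp only [time]; omega
      · simpa [exec, hb] using rq
  | loop x p ih =>
    intro B e m s hw he h
    simp only [WF, Bool.and_eq_true, Bool.not_eq_true', List.contains_eq_mem,
      decide_eq_false_iff_not] at hw
    have hex := he x hw.1
    -- After the last round the counter is N, which violates `Rep.lt`. The state at the loop head is
    -- therefore described as a state with the old environment in which the two counter stacks are
    -- overwritten.
    have main : ∀ n ≤ N, ∃ f : ℕ → Stacks V A, f 0 = s ∧
        (∀ i < n, Takes (.seq (comp p) (.seq (.pop (.down x)) (.push (.up x) true)))
          (f i) (f (i + 1)) (time N p + 2)) ∧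
        (∀ i < n, (f i (.down x)).head?.isSome) ∧
        ∃ s', Rep N e ((List.range n).foldl (fun m i => exec N p (update e x i) m) m) s' ∧
          f n = update (update s' (.down x) (List.replicate (N - n) true)) (.up x)
            (List.replicate n true) := by
      intro n
      induction n with
      | zero =>
        intro _
        refine ⟨fun _ => s, rfl, by simp, by simp, s, h, ?_⟩
        have h₁ := h.down x
        have h₂ := h.up x
        rw [hex] at h₁ h₂
        rw [← h₁, update_eq_self, ← h₂, update_eq_self]
      | succ n ihn =>
        intro hn
        obtain ⟨f, hf0, hf, hfs, s', hr, hfn⟩ := ihn (by omega)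
        obtain ⟨s₁, t₁, r₁⟩ := ih (x :: B) (update e x n) _ (f n) hw.2 (by
          intro y hy
          simp only [List.mem_cons, not_or] at hy
          rw [update_of_ne hy.1, he y hy.2]) (hfn ▸ hr.set_counter x (by omega))
        -- Resetting the counter to 0, the value of `x` under `e`, gives a state that represents the
        -- new memory in the old environment.
        have r₂ := r₁.set_counter x (i := 0) (by omega)
        rw [update_idem, ← hex, update_eq_self] at r₂
        refine ⟨fun i => if i ≤ n then f i else
          update (update s₁ (.down x) (List.replicate (N - (n + 1)) true)) (.up x)
            (List.replicate (n + 1) true), by simp [hf0], ?_, ?_,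
          update (update s₁ (.down x) (List.replicate (N - e x) true)) (.up x)
            (List.replicate (e x) true), ?_, ?_⟩
        · intro i hi
          beta_reduce
          rcases Nat.lt_succ_iff_lt_or_eq.mp hi with hi' | rfl
          · rw [if_pos hi'.le, if_pos (by omega)]
            exact hf i hi'
          · rw [if_pos le_rfl, if_neg (by omega)]
            refine (t₁.seq (r₁.incr x)).to ?_ le_rfl
            simp
        · intro i hi
          beta_reduce
          rw [if_pos (by omega)]
          rcases Nat.lt_succ_iff_lt_or_eq.mp hi with hi' | rfl
          · exact hfs i hi'
          · obtain ⟨d, hd⟩ : ∃ d, N - i = d + 1 := ⟨N - i - 1, by omega⟩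
            simp [hfn, hd, List.replicate_succ]
        · rw [List.range_succ, List.foldl_append]
          exact r₂
        · beta_reduce
          rw [if_neg (by omega)]
          funext k
          by_cases h₁ : k = .up x
          · subst h₁; simp
          · by_cases h₂ : k = .down x
            · subst h₂; simp
            · simp only [update_of_ne h₁, update_of_ne h₂]
    obtain ⟨f, hf0, hf, hfs, s', hr, hfn⟩ := main N le_rfl
    have first := takes_iter (k := .down x) (c := Option.isSome) N f hfs hf (by simp [hfn])
    -- The counter is full now; emptying it makes the variable 0 again.
    have second := takes_iter (k := .up x) (c := Option.isSome) (τ := 2)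
      (p := .seq (.pop (.up x)) (.push (.down x) true)) N
      (fun i => update (update s' (.down x) (List.replicate i true)) (.up x)
        (List.replicate (N - i) true))
      (by
        intro i hi
        obtain ⟨d, hd⟩ : ∃ d, N - i = d + 1 := ⟨N - i - 1, by omega⟩
        simp [hd, List.replicate_succ])
      (by
        intro i hi
        refine ((takes_pop _ _).seq (takes_push _ _ _)).to ?_ le_rfl
        have hne : (Stk.up x : Stk V A) ≠ .down x := by simp
        simp only [update_self, update_of_ne hne.symm, List.tail_replicate, update_idem,
          update_comm hne, List.replicate_succ, Nat.sub_sub])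
      (by simp)
    rw [hf0, hfn, Nat.sub_self] at first
    simp only [Nat.sub_self, Nat.sub_zero] at second
    refine ⟨_, (first.seq second).mono ?_, ?_⟩
    · simp only [time]
      ring_nf
      omega
    · have r₂ := hr.set_counter x (i := 0) (by have := h.lt x; omega)
      rw [← hex, update_eq_self, hex] at r₂
      exact r₂
  | read p q r ihp ihq ihr =>
    intro B e m s hw he h
    simp only [WF, Bool.and_eq_true] at hw
    have hpop : Rep N e { m with inp := m.inp.tail } (update s .inp (s .inp).tail) :=
      { h with
        inp := by simp [h.inp]
        inp2 := by simpa using h.inp2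
        out := by simpa using h.out
        outr := by simpa using h.outr
        len1 := by simpa using h.len1
        len2 := by simpa using h.len2
        t1 := by simpa using h.t1
        t2 := by simpa using h.t2
        t3 := by simpa using h.t3
        rgt := by simpa using h.rgt
        up := fun x => by simpa using h.up x
        down := fun x => by simpa using h.down x
        length := fun a => by simpa using h.length a
        arr := fun a i j k hi hj hk => by simpa using h.arr a i j k hi hj hk }
    obtain ⟨sp, tp, rp⟩ := ihp B e _ _ hw.1 he hpop
    obtain ⟨sq, tq, rq⟩ := ihq B e _ _ hw.2.1 he hpop
    obtain ⟨sr, tr, rr⟩ := ihr B e _ _ hw.2.2 he hpop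
    rcases hm : m.inp with _ | ⟨_ | _ | _, l⟩
    · refine ⟨sp, (show Takes _ _ _ _ from Takes.cond (τ := time N p + 2) ?_).mono ?_, ?_⟩
      · rw [h.inp, hm, if_neg (by simp)]
        refine Takes.cond (τ := time N p + 1) ?_
        rw [h.inp, hm, if_neg (by simp)]
        exact ((takes_pop _ _).seq tp).mono (by omega)
      · simp only [time]; omega
      · simpa [exec, hm] using rp
    · refine ⟨sp, (show Takes _ _ _ _ from Takes.cond (τ := time N p + 2) ?_).mono ?_, ?_⟩
      · rw [h.inp, hm, if_neg (by simp)]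
        refine Takes.cond (τ := time N p + 1) ?_
        rw [h.inp, hm, if_neg (by simp)]
        exact ((takes_pop _ _).seq tp).mono (by omega)
      · simp only [time]; omega
      · simpa [exec, hm] using rp
    · refine ⟨sq, (show Takes _ _ _ _ from Takes.cond (τ := time N q + 2) ?_).mono ?_, ?_⟩
      · rw [h.inp, hm, if_neg (by simp)]
        refine Takes.cond (τ := time N q + 1) ?_
        rw [h.inp, hm, if_pos (by simp)]
        exact ((takes_pop _ _).seq tq).mono (by omega)
      · simp only [time]; omega
      · simpa [exec, hm] using rq
    · refine ⟨sr, (show Takes _ _ _ _ from Takes.cond (τ := time N r + 1) ?_).mono ?_, ?_⟩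
      · rw [h.inp, hm, if_pos (by simp)]
        exact ((takes_pop _ _).seq tr).mono (by omega)
      · simp only [time]; omega
      · simpa [exec, hm] using rr
  | emit b =>
    intro B e m s _ _ h
    refine ⟨_, takes_push _ _ _, ?_⟩
    exact { h with
      inp := by simpa [exec] using h.inp
      inp2 := by simpa using h.inp2
      out := by simpa using h.out
      outr := by simp [exec, h.outr]
      len1 := by simpa using h.len1
      len2 := by simpa using h.len2
      t1 := by simpa using h.t1
      t2 := by simpa using h.t2
      t3 := by simpa using h.t3
      rgt := by simpa using h.rgt
      up := fun x => by simpa using h.up x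
      down := fun x => by simpa using h.down x
      length := fun a => by simpa using h.length a
      arr := fun a i j k hi hj hk => by simpa [exec] using h.arr a i j k hi hj hk }

end Cmd


/-! ### Initialization from the input, cleaning up, and the polynomial time bound. -/

namespace Cmd

open StackProg Function

variable {V A : Type} [DecidableEq V] [DecidableEq A]

/-- The letters of the input alphabet. -/
abbrev letters : List (Option Bool) := [none, some true, some false]

/-- Move one letter from the stack `inp` to the stack `inp2`. -/
def fetch : List (Option Bool) → StackProg (Alph (V := V) (A := A))
  | [] => .skip
  | a :: l => .cond .inp (fun o : Option (Option Bool) => o == some a)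
      (.seq (.pop .inp) (.push .inp2 a)) (fetch l)

/-- Move one letter from the stack `inp2` to the stack `inp`. -/
def unfetch : List (Option Bool) → StackProg (Alph (V := V) (A := A))
  | [] => .skip
  | a :: l => .cond .inp2 (fun o : Option (Option Bool) => o == some a)
      (.seq (.pop .inp2) (.push .inp a)) (unfetch l)

/-- A push writes a constant, so moving a letter takes one test for each candidate letter. -/
theorem takes_fetch (l : List (Option Bool)) {a : Option Bool} (ha : a ∈ l) {w : List (Option Bool)}
    {s : Stacks V A} (hs : s .inp = a :: w) :
    Takes (fetch l) s (update (update s .inp w) .inp2 (a :: (s .inp2 : List (Option Bool))))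
      (l.length + 2) := by
  induction l with
  | nil => simp at ha
  | cons b l ih =>
    refine (Takes.cond (τ := l.length + 2) ?_).mono (by simp)
    by_cases hb : a = b
    · subst hb
      rw [hs, if_pos (by simp)]
      refine ((takes_pop _ _).seq (takes_push _ _ _)).to ?_ (by omega)
      simp [hs]
    · rw [hs, if_neg (by simpa using hb)]
      exact ih (by simpa [hb] using ha)

theorem takes_unfetch (l : List (Option Bool)) {a : Option Bool} (ha : a ∈ l)
    {w : List (Option Bool)} {s : Stacks V A} (hs : s .inp2 = a :: w) :
    Takes (unfetch l) s (update (update s .inp2 w) .inp (a :: (s .inp : List (Option Bool))))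
      (l.length + 2) := by
  induction l with
  | nil => simp at ha
  | cons b l ih =>
    refine (Takes.cond (τ := l.length + 2) ?_).mono (by simp)
    by_cases hb : a = b
    · subst hb
      rw [hs, if_pos (by simp)]
      refine ((takes_pop _ _).seq (takes_push _ _ _)).to ?_ (by omega)
      simp [hs]
    · rw [hs, if_neg (by simpa using hb)]
      exact ih (by simpa [hb] using ha)

/-- Push a bit on the stacks `down x`, where `x` runs over a list. -/
def pushDown : List V → StackProg (Alph (V := V) (A := A))
  | [] => .skip
  | x :: xs => .seq (.push (.down x) true) (pushDown xs)

theorem takes_pushDown (xs : List V) (hxs : xs.Nodup) (s : Stacks V A) : ∃ s' : Stacks V A,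
    Takes (pushDown xs) s s' (xs.length + 1) ∧
      (∀ x ∈ xs, s' (.down x) = (true :: (s (.down x) : List Bool) : List Bool)) ∧
      ∀ k, (∀ x ∈ xs, k ≠ .down x) → s' k = s k := by
  induction xs generalizing s with
  | nil => exact ⟨s, takes_skip s, by simp, by simp⟩
  | cons x xs ih =>
    rw [List.nodup_cons] at hxs
    obtain ⟨s', t, h₁, h₂⟩ := ih hxs.2 (update s (.down x) (true :: (s (.down x) : List Bool)))
    refine ⟨s', ((takes_push _ _ _).seq t).mono (by simp; omega), ?_, ?_⟩
    · intro y hy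
      by_cases hyx : y = x
      · subst hyx
        rw [h₂ _ (by intro z hz h; cases h; exact hxs.1 hz)]
        simp
      · rw [h₁ y (by simpa [hyx] using hy)]
        simp [hyx]
    · intro k hk
      rw [h₂ k (fun y hy => hk y (by simp [hy])), update_of_ne (hk x (by simp))]

/-- The stacks after the first `i` letters of the input `w` have been read by the
initialization. -/
def initStacks (w : List (Option Bool)) (i : ℕ) : Stacks V A
  | .inp => w.drop i
  | .inp2 => (w.take i).reverse
  | .len1 => List.replicate i true
  | .len2 => List.replicate i true
  | .down _ => List.replicate i true
  | .out => []
  | .outr => []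
  | .t1 => []
  | .t2 => []
  | .t3 => []
  | .rgt => []
  | .up _ => []
  | .arr _ => []

/-- Fill the counters from the length of the input. -/
noncomputable def initProg [Fintype V] : StackProg (Alph (V := V) (A := A)) :=
  .seq (.iter .inp Option.isSome (.seq (fetch letters) (.seq (.push .len1 true)
      (.seq (.push .len2 true) (pushDown Finset.univ.toList)))))
    (.iter .inp2 Option.isSome (unfetch letters))

/-- The time of the initialization. -/
def initTime (V : Type) [Fintype V] (N : ℕ) : ℕ := N * (Fintype.card V + 15) + 2

/-- The memory at the beginning. -/
def initMem (A : Type) (w : List (Option Bool)) : Mem A where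
  arr := fun _ _ _ _ => false
  inp := w
  out := []

theorem mem_letters (a : Option Bool) : a ∈ letters := by
  rcases a with _ | _ | _ <;> simp

/-- While the input is moved to `inp2`, each letter adds a unit to the two copies of N and to all
the counters `down x`; then the input is moved back. The input must be nonempty, since the variables
are 0 and have to be below N. -/
theorem takes_initProg [Fintype V] (w : List (Option Bool)) (hw : 0 < w.length) : ∃ s : Stacks V A,
    Takes initProg (single .inp w) s (initTime V w.length) ∧
      Rep w.length (fun _ => 0) (initMem A w) s := by
  have first := takes_iter (k := (.inp : Stk V A)) (c := Option.isSome)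
    (τ := Fintype.card V + 8) (p := .seq (fetch letters) (.seq (.push .len1 true)
      (.seq (.push .len2 true) (pushDown Finset.univ.toList)))) w.length (initStacks w)
    (by
      intro i hi
      simp [initStacks, hi])
    (by
      intro i hi
      have hd : (initStacks w i : Stacks V A) .inp = w[i] :: w.drop (i + 1) :=
        List.drop_eq_getElem_cons hi
      have ht := takes_fetch letters (mem_letters w[i]) hd
      obtain ⟨s', t', h₁, h₂⟩ := takes_pushDown (A := A) (Finset.univ.toList : List V)
        (Finset.nodup_toList _) _
      refine (ht.seq ((takes_push _ _ _).seq ((takes_push _ _ _).seq t'))).to ?_ ?_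
      · funext k
        by_cases hk : ∃ x, k = .down x
        · obtain ⟨x, rfl⟩ := hk
          rw [h₁ x (by simp)]
          simp [initStacks, List.replicate_succ]
        · push Not at hk
          rw [h₂ k (fun x _ => hk x)]
          cases k with
          | down x => exact absurd rfl (hk x)
          | inp2 =>
            have : (w.take (i + 1)).reverse = w[i] :: (w.take i).reverse := by
              rw [List.take_succ_eq_append_getElem hi, List.reverse_append]
              rfl
            simp [initStacks, this]
          | _ => simp [initStacks, List.replicate_succ]
      · simp
        omega)
    (by simp [initStacks])
  have second := takes_iter (k := (.inp2 : Stk V A)) (c := Option.isSome)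
    (τ := 5) (p := unfetch letters) w.length
    (fun i => update (update (initStacks w w.length) .inp2 ((w.take (w.length - i)).reverse))
      .inp (w.drop (w.length - i)))
    (by
      intro i hi
      have : w.take (w.length - i) ≠ [] := by
        rw [ne_eq, List.take_eq_nil_iff, not_or]
        exact ⟨by omega, List.length_pos_iff.mp hw⟩
      rw [update_of_ne (by simp), update_self, List.isSome_head?]
      exact mt List.reverse_eq_nil_iff.mp this)
    (by
      intro i hi
      obtain ⟨j, hj⟩ : ∃ j, w.length - i = j + 1 := ⟨w.length - i - 1, by omega⟩
      have hj' : w.length - (i + 1) = j := by omega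
      have hjl : j < w.length := by omega
      have htake : (w.take (j + 1)).reverse = w[j] :: (w.take j).reverse := by
        rw [List.take_succ_eq_append_getElem hjl, List.reverse_append]
        rfl
      refine (takes_unfetch (w := (w.take j).reverse) letters (mem_letters w[j]) ?_).to ?_ le_rfl
      · simp [hj, htake]
      · funext k
        by_cases h₁ : k = .inp
        · subst h₁
          simp [hj, hj']
        · by_cases h₂ : k = .inp2
          · subst h₂
            simp [hj']
          · simp [h₁, h₂])
    (by simp)
  have e₀ : (initStacks w 0 : Stacks V A) = single .inp w := by
    funext k
    cases k <;> simp [initStacks, single]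
  have e₁ : update (update (initStacks w w.length : Stacks V A) .inp2
      ((w.take (w.length - 0)).reverse)) .inp (w.drop (w.length - 0)) = initStacks w w.length := by
    funext k
    cases k <;> simp [initStacks]
  beta_reduce at second
  rw [e₁] at second
  rw [e₀] at first
  refine ⟨_, (first.seq second).mono ?_, ?_⟩
  · simp only [initTime]
    ring_nf
    omega
  · constructor <;> simp [initStacks, initMem, hw]

/-- Bounds the unread input that has to be erased at the end. -/
theorem length_inp_exec_le (N : ℕ) (c : Cmd V A) : ∀ e m,
    (exec N c e m).inp.length ≤ m.inp.length := by
  induction c with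
  | skip => intro e m; exact le_rfl
  | seq p q ihp ihq => intro e m; exact (ihq _ _).trans (ihp _ _)
  | write a x y z b => intro e m; exact le_rfl
  | test a x y z p q ihp ihq =>
    intro e m
    simp only [exec]
    split
    · exact ihp _ _
    · exact ihq _ _
  | loop x p ih =>
    intro e m
    simp only [exec]
    generalize List.range N = l
    induction l generalizing m with
    | nil => exact le_rfl
    | cons i l ihl => exact (ihl _).trans (ih _ _)
  | read p q r ihp ihq ihr =>
    intro e m
    simp only [exec]
    split
    · next l h => exact (ihr _ _).trans (by simp [h])
    · next l h => exact (ihq _ _).trans (by simp [h])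
    · exact (ihp _ _).trans (by simp)
  | emit b => intro e m; exact le_rfl


/-- The complete program: initialization, translation, and cleaning up. -/
noncomputable def full [Fintype V] [Fintype A] (c : Cmd V A) : StackProg (Alph (V := V) (A := A)) :=
  .seq initProg (.seq (comp c) (.seq
    (moveAll .outr .out (fun o : Option Bool => o == some true) true false)
    (clearAll (Finset.univ.erase Stk.out).toList)))

/-- The time of the complete program, where `Q` bounds the length of the output. -/
def fullTime [Fintype V] [Fintype A] (Q N : ℕ) (c : Cmd V A) : ℕ :=
  initTime V N + (time N c + (Q * 4 + 1 +
    (Fintype.card (Stk V A) * ((N ^ 3 + N) * 2 + 1) + 1)))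

/-- The output convention demands that all stacks but one are empty. The letters emitted are on
`outr` in reverse order, and moving them to `out` turns them round. -/
theorem takes_full [Fintype V] [Fintype A] (c : Cmd V A) (w : List (Option Bool))
    (hw : 0 < w.length) (hc : c.WF [] = true)
    {o : List Bool} (ho : (exec w.length c (fun _ => 0) (initMem A w)).out = o) {Q : ℕ}
    (hQ : o.length ≤ Q) :
    Takes (full c) (single .inp w) (single .out o) (fullTime Q w.length c) := by
  obtain ⟨s₀, t₀, r₀⟩ := takes_initProg (V := V) (A := A) w hw
  obtain ⟨s₁, t₁, r₁⟩ := takes_comp c [] (fun _ => 0) _ s₀ hc (fun _ _ => rfl) r₀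
  have t₂ := takes_moveAll (k := (.outr : Stk V A)) (k' := .out) (by simp)
    (fun o : Option Bool => o == some true) true false s₁
  have hl : (s₁ .outr).length = o.length := by rw [r₁.outr, List.length_reverse, ho]
  refine (t₀.seq (t₁.seq (t₂.seq (takes_clearAll _ _ (L := w.length ^ 3 + w.length) ?_)))).to ?_ ?_
  · intro k hk
    cases k with
    | out => simp at hk
    | inp =>
      simp only [ne_eq, reduceCtorEq, not_false_eq_true, update_of_ne, r₁.inp]
      have := length_inp_exec_le w.length c (fun _ => 0) (initMem A w)
      simp only [initMem] at this ⊢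
      omega
    | arr a => simpa using (r₁.length a).trans (by omega)
    | up x => simp [r₁.up]
    | down x => simp [r₁.down]
    | inp2 => simp [r₁.inp2]
    | outr => simp
    | len1 => simp [r₁.len1]
    | len2 => simp [r₁.len2]
    | t1 => simp [r₁.t1]
    | t2 => simp [r₁.t2]
    | t3 => simp [r₁.t3]
    | rgt => simp [r₁.rgt]
  · funext k
    by_cases hk : k = .out
    · subst hk
      have : ∀ l : List Bool,
          l.map (fun x => if (some x == some true) = true then true else false) = l := by
        intro l
        conv_rhs => rw [← List.map_id l]
        congr 1
        funext x
        cases x <;> rfl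
      simp only [single, update_self, Finset.mem_toList, Finset.mem_erase, ne_eq, not_true_eq_false,
        false_and, if_false, r₁.out, List.append_nil, this, r₁.outr, List.reverse_reverse, ho]
    · simp [single, hk]
  · have hcard : (Finset.univ.erase (Stk.out : Stk V A)).toList.length ≤
        Fintype.card (Stk V A) := by
      rw [Finset.length_toList]
      exact Finset.card_le_univ _
    have := Nat.mul_le_mul_right ((w.length ^ 3 + w.length) * 2 + 1) hcard
    simp only [fullTime]
    omega

/-- The function is given by a polynomial. -/
def IsPoly (f : ℕ → ℕ) : Prop := ∃ T : Polynomial ℕ, ∀ n, f n = T.eval n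

theorem IsPoly.const (c : ℕ) : IsPoly fun _ => c := ⟨Polynomial.C c, by simp⟩

theorem IsPoly.id : IsPoly fun n => n := ⟨Polynomial.X, by simp⟩

theorem IsPoly.add {f g : ℕ → ℕ} (hf : IsPoly f) (hg : IsPoly g) : IsPoly fun n => f n + g n :=
  let ⟨F, hF⟩ := hf
  let ⟨G, hG⟩ := hg
  ⟨F + G, by simp [hF, hG]⟩

theorem IsPoly.mul {f g : ℕ → ℕ} (hf : IsPoly f) (hg : IsPoly g) : IsPoly fun n => f n * g n :=
  let ⟨F, hF⟩ := hf
  let ⟨G, hG⟩ := hg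
  ⟨F * G, by simp [hF, hG]⟩

theorem IsPoly.pow {f : ℕ → ℕ} (hf : IsPoly f) (k : ℕ) : IsPoly fun n => f n ^ k :=
  let ⟨F, hF⟩ := hf
  ⟨F ^ k, by simp [hF]⟩

theorem isPoly_eachTime {f : ℕ → ℕ} (hf : IsPoly f) : IsPoly fun N => eachTime N (f N) :=
  (IsPoly.id.mul (hf.add (.const 6))).add (.const 2)

theorem isPoly_walkTime : IsPoly walkTime :=
  have h₁ := isPoly_eachTime (.const 3)
  have h₂ := isPoly_eachTime h₁
  (isPoly_eachTime h₂).add (h₂.add h₁)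

/-- The nesting depth of a fixed program does not depend on N, so the induction composes only a
fixed number of sums and products with N. -/
theorem isPoly_time {V A : Type} (c : Cmd V A) : IsPoly fun N => time N c := by
  have hw := isPoly_walkTime
  have h3 : IsPoly fun N => N ^ 3 * 4 := (IsPoly.id.pow 3).mul (.const 4)
  induction c with
  | skip => exact .const 1
  | seq p q ihp ihq => exact ihp.add ihq
  | write a x y z b => exact hw.add (h3.add (.const 3))
  | test a x y z p q ihp ihq => exact hw.add (((h3.add (.const 2)).add ihp).add ihq)
  | loop x p ih => exact (IsPoly.id.mul (ih.add (.const 6))).add (.const 2)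
  | read p q r ihp ihq ihr => exact ((ihp.add ihq).add ihr).add (.const 3)
  | emit b => exact .const 1

/-- A function that is computed by a program with bounded loops is computable in polynomial
time. -/
theorem polyTimeComputable [Fintype V] [Fintype A] {α β : Type}
    {ea : α → List (Option Bool)} {eb : β → List Bool} {f : α → β} (c : Cmd V A)
    (hc : c.WF [] = true) (ha : ∀ a, 0 < (ea a).length)
    {Q : ℕ → ℕ} (hQ : IsPoly Q) (hb : ∀ a, (eb (f a)).length ≤ Q (ea a).length)
    (h : ∀ a, (exec (ea a).length c (fun _ => 0) (initMem A (ea a))).out = eb (f a)) :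
    Dissatisfaction.PolyTimeComputable ea eb f := by
  have hT : IsPoly fun N => fullTime (Q N) N c := by
    have hV : IsPoly (initTime V) :=
      (IsPoly.id.mul (.const (Fintype.card V + 15))).add (.const 2)
    exact hV.add ((isPoly_time c).add (((hQ.mul (.const 4)).add (.const 1)).add (((IsPoly.const
      (Fintype.card (Stk V A))).mul (((((IsPoly.id.pow 3).add .id).mul (.const 2)).add
      (.const 1)))).add (.const 1))))
  obtain ⟨T, hT⟩ := hT
  let : Fintype (Alph (.inp : Stk V A)) := inferInstanceAs (Fintype (Option Bool))
  refine polyTime (full c) .inp .out ea eb f (Equiv.refl _) (Equiv.refl _) T fun a => ?_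
  have ht := takes_full c (ea a) (ha a) hc (h a) (hb a)
  rw [show fullTime (Q (ea a).length) (ea a).length c = _ from hT _] at ht
  simpa [Takes] using ht

end Cmd


/-! ### Repeated application of functions -/

/-- Apply `f 0`, …, `f (N - 1)` in this order. -/
def foldRange {α : Type} (N : ℕ) (f : ℕ → α → α) (a : α) : α :=
  (List.range N).foldl (fun a i => f i a) a

theorem foldRange_succ {α : Type} (N : ℕ) (f : ℕ → α → α) (a : α) :
    foldRange (N + 1) f a = f N (foldRange N f a) := by
  simp [foldRange, List.range_succ]

theorem foldRange_const {α : Type} (N : ℕ) (f : α → α) (a : α) :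
    foldRange N (fun _ => f) a = f^[N] a := by
  induction N with
  | zero => rfl
  | succ N ih => rw [foldRange_succ, ih, Function.iterate_succ_apply']

theorem foldRange_induction {α : Type} {N : ℕ} {f : ℕ → α → α} {a : α} (I : ℕ → α → Prop)
    (h₀ : I 0 a) (h : ∀ i < N, ∀ a, I i a → I (i + 1) (f i a)) : I N (foldRange N f a) := by
  induction N with
  | zero => exact h₀
  | succ N ih =>
    rw [foldRange_succ]
    exact h N (by omega) _ (ih fun i hi => h i (by omega))

theorem foldRange_invariant {α : Type} {N : ℕ} {f : ℕ → α → α} {a : α} (I : α → Prop)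
    (h₀ : I a) (h : ∀ i < N, ∀ a, I a → I (f i a)) : I (foldRange N f a) :=
  foldRange_induction (fun _ => I) h₀ h

/-- On the elements that satisfy `I`, the function either does nothing or increases `φ`. -/
def Progress {α : Type} (I : α → Prop) (φ : α → ℕ) (f : α → α) : Prop :=
  ∀ a, I a → I (f a) ∧ (f a = a ∨ φ a < φ (f a))

theorem Progress.foldRange {α : Type} {I : α → Prop} {φ : α → ℕ} {f : ℕ → α → α} {N : ℕ}
    (h : ∀ i < N, Progress I φ (f i)) : Progress I φ (foldRange N f) := by
  intro a ha
  refine foldRange_invariant (fun b => I b ∧ (b = a ∨ φ a < φ b)) ⟨ha, .inl rfl⟩ ?_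
  rintro i hi b ⟨hb, hab⟩
  have := h i hi b hb
  refine ⟨this.1, ?_⟩
  rcases hab with rfl | hab
  · exact this.2
  · rcases this.2 with h' | h'
    · rw [h']; exact .inr hab
    · exact .inr (hab.trans h')

/-- A step that changes anything increases `φ` strictly, and no step decreases it. A round that ends
where it began has therefore changed nothing at any step. -/
theorem Progress.fixed_of_foldRange {α : Type} {I : α → Prop} {φ : α → ℕ} {f : ℕ → α → α} {N : ℕ}
    (h : ∀ i < N, Progress I φ (f i)) {a : α} (ha : I a) (hf : _root_.foldRange N f a = a) :
    ∀ i < N, f i a = a := by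
  induction N with
  | zero => simp
  | succ N ih =>
    have h' : ∀ i < N, Progress I φ (f i) := fun i hi => h i (by omega)
    have h₁ := Progress.foldRange h' a ha
    have h₂ := h N (by omega) _ h₁.1
    rw [foldRange_succ] at hf
    have h₃ : _root_.foldRange N f a = a := by
      rcases h₁.2 with h₃ | h₃
      · exact h₃
      · rcases h₂.2 with h₄ | h₄
        · exact h₄ ▸ hf
        · rw [hf] at h₄
          omega
    intro i hi
    rcases Nat.lt_succ_iff_lt_or_eq.mp hi with hi | rfl
    · exact ih h' h₃ i hi
    · rwa [h₃] at hf

/-- Before the iteration becomes stationary, `φ` grows by at least one each time, so it exceeds n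
after n + 1 applications; the bound N leaves room for N effective applications only. -/
theorem Progress.iterate_fixed {α : Type} {I : α → Prop} {φ : α → ℕ} {f : α → α}
    (h : Progress I φ f) {N : ℕ} (hφ : ∀ a, I a → φ a ≤ N) {a : α} (ha : I a) :
    I (f^[N] a) ∧ f (f^[N] a) = f^[N] a := by
  have key : ∀ n, I (f^[n] a) ∧ (f (f^[n] a) = f^[n] a ∨ n < φ (f (f^[n] a))) := by
    intro n
    induction n with
    | zero => exact ⟨ha, (h a ha).2.imp_right fun h => by simpa using (by omega : 0 < φ (f a))⟩
    | succ n ih =>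
      rw [Function.iterate_succ_apply']
      have h₁ := h _ ih.1
      have h₂ := h _ h₁.1
      refine ⟨h₁.1, ?_⟩
      rcases ih.2 with h₃ | h₃
      · left; rw [h₃, h₃]
      · exact h₂.2.imp_right fun h => by omega
  refine ⟨(key N).1, (key N).2.resolve_right fun hlt => ?_⟩
  have := hφ _ (h _ (key N).1).1
  omega

/-! ### Assigning items to the arcs of directed matchings -/

namespace ArcAssignment

open Function Classical

/-- `E i u v` says that `(u, v)` is an arc of the graph of agent `i`. The item `u` is the tail of
some arc. -/
def Good (E : ℕ → ℕ → ℕ → Bool) (u : ℕ) : Prop := ∃ i v, E i u v = true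

/-- The two items form an arc of agent `i`, in one of the two directions. -/
def Mate (E : ℕ → ℕ → ℕ → Bool) (i v w : ℕ) : Prop := E i v w = true ∨ E i w v = true

/-- It is reasonable to give the item `v` to the agent `i`: it is the tail of an arc of `i`, or it
is the head of an arc of `i` and no tail at all. -/
def Usable (E : ℕ → ℕ → ℕ → Bool) (i v : ℕ) : Prop :=
  (∃ w, E i v w = true) ∨ (∃ u, E i u v = true) ∧ ¬ Good E v

/-- Each of the graphs is a directed matching on items below `N`. -/
structure IsMatching (N : ℕ) (E : ℕ → ℕ → ℕ → Bool) : Prop where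
  lt : ∀ {i u v}, E i u v = true → i < N ∧ u < N ∧ v < N
  unique : ∀ {i v w w'}, Mate E i v w → Mate E i v w' → w = w'
  asymm : ∀ {i u v}, E i u v = true → ¬ E i v u = true

/-- The dissatisfaction caused by one arc. -/
def arcCost (x : ℕ → Option ℕ) (i u v : ℕ) : ℕ :=
  if x u = some i then 0 else if x v = some i then 1 else 2

/-- The total dissatisfaction. -/
def cost (N : ℕ) (E : ℕ → ℕ → ℕ → Bool) (x : ℕ → Option ℕ) : ℕ :=
  ∑ i ∈ Finset.range N, ∑ u ∈ Finset.range N, ∑ v ∈ Finset.range N,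
    if E i u v = true then arcCost x i u v else 0

/-- The assignment uses usable arcs only, and each of them at most once. -/
structure Valid (E : ℕ → ℕ → ℕ → Bool) (x : ℕ → Option ℕ) : Prop where
  usable : ∀ {v i}, x v = some i → Usable E i v
  disjoint : ∀ {v w i}, x v = some i → Mate E i v w → x w ≠ some i

/-- The item `v` may be given to agent `i` without conflict. -/
def Free (E : ℕ → ℕ → ℕ → Bool) (x : ℕ → Option ℕ) (i v : ℕ) : Prop :=
  Usable E i v ∧ ∀ w, Mate E i v w → x w ≠ some i

/-- An item `w` that is not settled is given to agent `j`, if it is the other end of an arc of `j`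
at a settled item that does not use this arc. -/
noncomputable def spread (E : ℕ → ℕ → ℕ → Bool) (v w j : ℕ)
    (p : (ℕ → Option ℕ) × (ℕ → Prop)) : (ℕ → Option ℕ) × (ℕ → Prop) :=
  if p.2 v ∧ ¬ p.2 w ∧ Mate E j v w ∧ p.1 v ≠ some j ∧ Usable E j w then
    (update p.1 w (some j), update p.2 w True) else p

/-- Apply `spread` to all triples. -/
noncomputable def sweep (N : ℕ) (E : ℕ → ℕ → ℕ → Bool) :
    (ℕ → Option ℕ) × (ℕ → Prop) → (ℕ → Option ℕ) × (ℕ → Prop) :=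
  foldRange N fun v => foldRange N fun w => foldRange N fun j => spread E v w j

/-- Give the item `v₀` to agent `i₀` and settle all the items that can be reached from there. -/
noncomputable def grow (N : ℕ) (E : ℕ → ℕ → ℕ → Bool) (v₀ i₀ : ℕ) (x : ℕ → Option ℕ) :
    (ℕ → Option ℕ) × (ℕ → Prop) :=
  foldRange N (fun _ => sweep N E) (update x v₀ (some i₀), fun v => v = v₀)

/-- Replace `x` by the result of `grow` if this increases the number of assigned items. -/
noncomputable def improve (N : ℕ) (E : ℕ → ℕ → ℕ → Bool) (v₀ i₀ : ℕ) (x : ℕ → Option ℕ) :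
    ℕ → Option ℕ :=
  if Free E x i₀ v₀ ∧ ∃ v < N, (grow N E v₀ i₀ x).2 v ∧ x v = none then (grow N E v₀ i₀ x).1 else x

/-- Try `improve` for all starting points. -/
noncomputable def pass (N : ℕ) (E : ℕ → ℕ → ℕ → Bool) : (ℕ → Option ℕ) → ℕ → Option ℕ :=
  foldRange N fun v => foldRange N fun i => improve N E v i

/-- Give the tail `u` of an arc of agent `i` to this agent if it has not been assigned before. -/
noncomputable def pick (E : ℕ → ℕ → ℕ → Bool) (i u : ℕ) (x : ℕ → Option ℕ) : ℕ → Option ℕ :=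
  if (∃ v, E i u v = true) ∧ x u = none then update x u (some i) else x

/-- The initial assignment. -/
noncomputable def start (N : ℕ) (E : ℕ → ℕ → ℕ → Bool) : ℕ → Option ℕ :=
  foldRange N (fun i => foldRange N fun u => pick E i u) fun _ => none

/-- The optimal assignment. -/
noncomputable def opt (N : ℕ) (E : ℕ → ℕ → ℕ → Bool) : ℕ → Option ℕ :=
  foldRange N (fun _ => pass N E) (start N E)

/-! ### Propagation and improvement of assignments. -/

variable {N : ℕ} {E : ℕ → ℕ → ℕ → Bool}

theorem Mate.symm {i v w : ℕ} (h : Mate E i v w) : Mate E i w v := Or.symm h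

theorem Mate.ne (hE : IsMatching N E) {i v w : ℕ} (h : Mate E i v w) : v ≠ w := by
  rintro rfl
  rcases h with h | h <;> exact hE.asymm h h

theorem Usable.lt (hE : IsMatching N E) {i v : ℕ} (h : Usable E i v) : i < N ∧ v < N := by
  rcases h with ⟨w, h⟩ | ⟨⟨w, h⟩, -⟩
  · exact ⟨(hE.lt h).1, (hE.lt h).2.1⟩
  · exact ⟨(hE.lt h).1, (hE.lt h).2.2⟩

theorem Usable.exists_mate {i v : ℕ} (h : Usable E i v) : ∃ w, Mate E i v w := by
  rcases h with ⟨w, h⟩ | ⟨⟨w, h⟩, -⟩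
  · exact ⟨w, .inl h⟩
  · exact ⟨w, .inr h⟩

theorem Valid.update (hE : IsMatching N E) {x : ℕ → Option ℕ} (hx : Valid E x) {j w : ℕ}
    (hf : Free E x j w) : Valid E (update x w (some j)) where
  usable {v i} h := by
    by_cases hv : v = w
    · subst hv
      rw [update_self, Option.some.injEq] at h
      exact h ▸ hf.1
    · rw [update_of_ne hv] at h
      exact hx.usable h
  disjoint {v u i} h hm := by
    have hne := hm.ne hE
    by_cases hv : v = w
    · subst hv
      rw [update_self, Option.some.injEq] at h
      subst h
      rw [update_of_ne hne.symm]
      exact hf.2 u hm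
    · rw [update_of_ne hv] at h
      by_cases hu : u = w
      · subst hu
        rw [update_self]
        intro h'
        rw [Option.some.injEq] at h'
        subst h'
        exact hf.2 v hm.symm h
      · rw [update_of_ne hu]
        exact hx.disjoint h hm

/-- The invariant of `grow`. -/
structure GrowInv (N : ℕ) (E : ℕ → ℕ → ℕ → Bool) (x : ℕ → Option ℕ) (v₀ i₀ : ℕ)
    (p : (ℕ → Option ℕ) × (ℕ → Prop)) : Prop where
  valid : Valid E p.1
  root : p.2 v₀
  root_eq : p.1 v₀ = some i₀
  old : ∀ v, ¬ p.2 v → p.1 v = x v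
  lt : ∀ v, p.2 v → v < N
  parent : ∀ v, p.2 v → v ≠ v₀ → ∃ u j, p.2 u ∧ p.1 v = some j ∧ Mate E j v u

/-- The number of settled items. -/
noncomputable def settled (N : ℕ) (p : (ℕ → Option ℕ) × (ℕ → Prop)) : ℕ :=
  ((Finset.range N).filter p.2).card

/-- The arc given to `w` has `v` as its only other end, and `v` does not use it, so no conflict
arises; `v` becomes the parent of `w`. -/
theorem progress_spread (hE : IsMatching N E) (x : ℕ → Option ℕ) (v₀ i₀ v w j : ℕ) :
    Progress (GrowInv N E x v₀ i₀) (settled N) (spread E v w j) := by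
  intro p hp
  unfold spread
  split
  next h =>
    obtain ⟨hv, hw, hm, hj, hu⟩ := h
    have hw₀ : v₀ ≠ w := fun h => hw (h ▸ hp.root)
    have hwN := (hu.lt hE).2
    refine ⟨⟨?_, ?_, ?_, ?_, ?_, ?_⟩, .inr ?_⟩
    · refine hp.valid.update hE ⟨hu, fun u hmu => ?_⟩
      rwa [hE.unique hmu hm.symm]
    · simpa [update_of_ne hw₀] using hp.root
    · simpa [update_of_ne hw₀] using hp.root_eq
    · intro u hu'
      dsimp only at hu' ⊢
      by_cases huw : u = w
      · subst huw; simp at hu'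
      · rw [update_of_ne huw] at hu'
        simpa [update_of_ne huw] using hp.old u hu'
    · intro u hu'
      dsimp only at hu' ⊢
      by_cases huw : u = w
      · subst huw; exact hwN
      · rw [update_of_ne huw] at hu'
        exact hp.lt u hu'
    · intro u hu' hne
      dsimp only at hu' ⊢
      by_cases huw : u = w
      · subst huw
        exact ⟨v, j, by rw [update_of_ne (hm.ne hE)]; exact hv, by simp, hm.symm⟩
      · rw [update_of_ne huw] at hu'
        obtain ⟨a, k, ha, hk, hm'⟩ := hp.parent u hu' hne
        refine ⟨a, k, ?_, by rw [update_of_ne huw]; exact hk, hm'⟩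
        by_cases haw : a = w
        · subst haw; simp
        · rw [update_of_ne haw]; exact ha
    · refine Finset.card_lt_card (Finset.ssubset_iff_of_subset ?_ |>.mpr ⟨w, ?_, ?_⟩)
      · intro u hu'
        simp only [Finset.mem_filter] at hu' ⊢
        refine ⟨hu'.1, ?_⟩
        by_cases huw : u = w
        · subst huw; simp
        · rw [update_of_ne huw]; exact hu'.2
      · simp [hwN]
      · simp [hw]
  next => exact ⟨hp, .inl rfl⟩

theorem progress_sweep (hE : IsMatching N E) (x : ℕ → Option ℕ) (v₀ i₀ : ℕ) :
    Progress (GrowInv N E x v₀ i₀) (settled N) (sweep N E) :=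
  Progress.foldRange fun v _ => Progress.foldRange fun w _ => Progress.foldRange fun j _ =>
    progress_spread hE x v₀ i₀ v w j

theorem settled_le (p : (ℕ → Option ℕ) × (ℕ → Prop)) : settled N p ≤ N :=
  (Finset.card_filter_le _ _).trans (by simp)

/-- After N sweeps nothing can spread any more, so an arc leading from a settled item to a usable
unsettled end must be taken by the settled item. An item other than the root has taken the arc to
its parent, which is settled. Only the arc of the root remains. -/
theorem grow_spec (hE : IsMatching N E) {x : ℕ → Option ℕ} (hx : Valid E x) {v₀ i₀ : ℕ}
    (hf : Free E x i₀ v₀) :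
    GrowInv N E x v₀ i₀ (grow N E v₀ i₀ x) ∧
      ∀ v w j, (grow N E v₀ i₀ x).2 v → ¬ (grow N E v₀ i₀ x).2 w → Mate E j v w → Usable E j w →
        v = v₀ ∧ j = i₀ := by
  have h₀ : GrowInv N E x v₀ i₀ (update x v₀ (some i₀), fun v => v = v₀) :=
    ⟨hx.update hE hf, rfl, by simp, fun v hv => by simpa using update_of_ne hv _ _,
      fun v hv => hv ▸ (hf.1.lt hE).2, fun v hv hne => absurd hv hne⟩
  have h := (progress_sweep hE x v₀ i₀).iterate_fixed (fun p _ => settled_le p) h₀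
  rw [← foldRange_const] at h
  change GrowInv N E x v₀ i₀ (grow N E v₀ i₀ x) ∧ sweep N E (grow N E v₀ i₀ x) = _ at h
  refine ⟨h.1, fun v w j hv hw hm hu => ?_⟩
  set p := grow N E v₀ i₀ x
  have hjw := hu.lt hE
  -- Invariance under a sweep passes through the three nested loops to the single step for `v`, `w`,
  -- `j`.
  have hfix := Progress.fixed_of_foldRange (fun j _ => progress_spread hE x v₀ i₀ v w j) h.1
    (Progress.fixed_of_foldRange (fun w _ => Progress.foldRange fun j _ =>
      progress_spread hE x v₀ i₀ v w j) h.1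
    (Progress.fixed_of_foldRange (fun v _ => Progress.foldRange fun w _ => Progress.foldRange
      fun j _ => progress_spread hE x v₀ i₀ v w j) h.1 h.2 v (h.1.lt v hv)) w hjw.2) j hjw.1
  have hj : p.1 v = some j := by
    by_contra hj
    rw [spread, if_pos ⟨hv, hw, hm, hj, hu⟩] at hfix
    have : p.2 w := by
      rw [← hfix]
      simp
    exact hw this
  by_cases hv₀ : v = v₀
  · subst hv₀
    rw [h.1.root_eq, Option.some.injEq] at hj
    exact ⟨rfl, hj.symm⟩
  · obtain ⟨u, k, hu₁, hk, hmk⟩ := h.1.parent v hv hv₀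
    rw [hj, Option.some.injEq] at hk
    subst hk
    exact absurd (hE.unique hmk hm ▸ hu₁) hw

/-- The number of assigned items. -/
noncomputable def assigned (N : ℕ) (x : ℕ → Option ℕ) : Finset ℕ :=
  (Finset.range N).filter fun v => (x v).isSome

/-- The invariant of the optimization: the assignment is valid and assigns all the tails. -/
def OptInv (E : ℕ → ℕ → ℕ → Bool) (x : ℕ → Option ℕ) : Prop :=
  Valid E x ∧ ∀ u, Good E u → (x u).isSome

theorem grow_isSome (hE : IsMatching N E) {x : ℕ → Option ℕ} (hx : Valid E x) {v₀ i₀ : ℕ}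
    (hf : Free E x i₀ v₀) {v : ℕ} (hv : (grow N E v₀ i₀ x).2 v ∨ (x v).isSome) :
    ((grow N E v₀ i₀ x).1 v).isSome := by
  have h := (grow_spec hE hx hf).1
  by_cases hs : (grow N E v₀ i₀ x).2 v
  · by_cases hv₀ : v = v₀
    · rw [hv₀, h.root_eq]; rfl
    · obtain ⟨u, j, -, hj, -⟩ := h.parent v hs hv₀
      rw [hj]; rfl
  · rw [h.old v hs]
    exact hv.resolve_left hs

theorem progress_improve (hE : IsMatching N E) (v₀ i₀ : ℕ) :
    Progress (OptInv E) (fun x => (assigned N x).card) (improve N E v₀ i₀) := by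
  intro x hx
  unfold improve
  split
  next h =>
    obtain ⟨hf, v, hvN, hv, hxv⟩ := h
    refine ⟨⟨(grow_spec hE hx.1 hf).1.valid, fun u hu => grow_isSome hE hx.1 hf (.inr (hx.2 u hu))⟩,
      .inr ?_⟩
    refine Finset.card_lt_card (Finset.ssubset_iff_of_subset ?_ |>.mpr ⟨v, ?_, ?_⟩)
    · intro u hu
      simp only [assigned, Finset.mem_filter] at hu ⊢
      exact ⟨hu.1, grow_isSome hE hx.1 hf (.inr hu.2)⟩
    · simp only [assigned, Finset.mem_filter, Finset.mem_range]
      exact ⟨hvN, grow_isSome hE hx.1 hf (.inl hv)⟩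
    · simp [assigned, hxv]
  next => exact ⟨hx, .inl rfl⟩

/-- Items receive only arcs of which they are the tail, and an arc has one tail; so no arc is used
twice. -/
theorem start_inv (hE : IsMatching N E) : OptInv E (start N E) := by
  have h : (∀ v i, start N E v = some i → ∃ w, E i v w = true) ∧
      ∀ i < N, ∀ u < N, (∃ v, E i u v = true) → (start N E u).isSome := by
    refine foldRange_induction (fun n (x : ℕ → Option ℕ) =>
      (∀ v i, x v = some i → ∃ w, E i v w = true) ∧
      ∀ i < n, ∀ u < N, (∃ v, E i u v = true) → (x u).isSome) (by simp) ?_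
    rintro n - x ⟨h₁, h₂⟩
    have := foldRange_induction (N := N) (f := fun u => pick E n u) (a := x)
      (fun k (x : ℕ → Option ℕ) => (∀ v i, x v = some i → ∃ w, E i v w = true) ∧
        (∀ i < n, ∀ u < N, (∃ v, E i u v = true) → (x u).isSome) ∧
        ∀ u < k, (∃ v, E n u v = true) → (x u).isSome) ⟨h₁, h₂, by simp⟩ (by
      rintro k - x ⟨h₁, h₂, h₃⟩
      unfold pick
      split
      next hk =>
        refine ⟨?_, ?_, ?_⟩
        · intro v i hv
          by_cases hvk : v = k
          · subst hvk
            rw [update_self, Option.some.injEq] at hv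
            exact hv ▸ hk.1
          · rw [update_of_ne hvk] at hv
            exact h₁ v i hv
        · intro i hi u hu hv
          by_cases huk : u = k
          · subst huk; simp
          · rw [update_of_ne huk]; exact h₂ i hi u hu hv
        · intro u hu hv
          by_cases huk : u = k
          · subst huk; simp
          · rw [update_of_ne huk]; exact h₃ u (by omega) hv
      next hk =>
        refine ⟨h₁, h₂, fun u hu hv => ?_⟩
        rcases Nat.lt_succ_iff_lt_or_eq.mp hu with hu | rfl
        · exact h₃ u hu hv
        · rw [not_and] at hk
          exact Option.isSome_iff_ne_none.mpr (hk hv))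
    refine ⟨this.1, fun i hi u hu hv => ?_⟩
    rcases Nat.lt_succ_iff_lt_or_eq.mp hi with hi | rfl
    · exact this.2.1 i hi u hu hv
    · exact this.2.2 u hu hv
  refine ⟨⟨fun hv => .inl (h.1 _ _ hv), ?_⟩, ?_⟩
  · intro v w i hv hm hw
    obtain ⟨a, ha⟩ := h.1 v i hv
    obtain ⟨b, hb⟩ := h.1 w i hw
    have h₁ := hE.unique hm (.inl ha)
    have h₂ := hE.unique hm.symm (.inl hb)
    subst h₁ h₂
    exact hE.asymm ha hb
  · rintro u ⟨i, v, hv⟩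
    exact h.2 i (hE.lt hv).1 u (hE.lt hv).2.1 ⟨v, hv⟩

theorem opt_spec (hE : IsMatching N E) :
    OptInv E (opt N E) ∧ ∀ v < N, ∀ i < N, improve N E v i (opt N E) = opt N E := by
  have hp : Progress (OptInv E) (fun x => (assigned N x).card) (pass N E) :=
    Progress.foldRange fun v _ => Progress.foldRange fun i _ => progress_improve hE v i
  have h := hp.iterate_fixed (N := N)
    (fun x _ => (Finset.card_filter_le _ _).trans (by simp)) (start_inv hE)
  rw [← foldRange_const] at h
  change OptInv E (opt N E) ∧ pass N E (opt N E) = _ at h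
  refine ⟨h.1, fun v hv i hi => ?_⟩
  exact Progress.fixed_of_foldRange (fun i _ => progress_improve hE v i) h.1
    (Progress.fixed_of_foldRange (fun v _ => Progress.foldRange fun i _ =>
      progress_improve hE v i) h.1 h.2 v hv) i hi

/-! ### Stable assignments and optimality. -/

/-- The two items are the ends of an arc that both of them may use. -/
def Adj (E : ℕ → ℕ → ℕ → Bool) (v w : ℕ) : Prop := ∃ j, Mate E j v w ∧ Usable E j v ∧ Usable E j w

/-- The items that are connected to an item that has not been assigned although it has a usable
arc. -/
def Deficient (E : ℕ → ℕ → ℕ → Bool) (x : ℕ → Option ℕ) (v : ℕ) : Prop :=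
  ∃ z, (∃ i, Usable E i z) ∧ x z = none ∧ Relation.ReflTransGen (Adj E) v z

theorem mem_of_closed {S : ℕ → Prop} (hS : ∀ v w, S v → Adj E v w → S w) {v z : ℕ} (hv : S v)
    (h : Relation.ReflTransGen (Adj E) v z) : S z := by
  induction h with
  | refl => exact hv
  | tail _ h ih => exact hS _ _ ih h

/-- In a stable assignment, all the arcs that are usable by deficient items are used. -/
theorem used_of_deficient (hE : IsMatching N E) {x : ℕ → Option ℕ} (hx : Valid E x)
    (hs : ∀ v < N, ∀ i < N, improve N E v i x = x) {v i : ℕ} (hv : Deficient E x v)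
    (hu : Usable E i v) : x v = some i ∨ ∃ w, Mate E i v w ∧ x w = some i := by
  by_contra! hcon
  obtain ⟨z, ⟨k, hk⟩, hz, hvz⟩ := hv
  have hzN := (hk.lt hE).2
  -- An attempt that reached the unassigned item `z` would be carried out and assign `z`, contrary
  -- to stability.
  have reach : ∀ v i, Free E x i v → ¬ (grow N E v i x).2 z := by
    intro v i hf hzv
    have hvi := hf.1.lt hE
    have himp : improve N E v i x = (grow N E v i x).1 := if_pos ⟨hf, z, hzN, hzv, hz⟩
    have hsome := grow_isSome hE hx hf (.inl hzv)
    rw [← himp, hs v hvi.2 i hvi.1, hz] at hsome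
    simp at hsome
  have hf : Free E x i v := ⟨hu, hcon.2⟩
  obtain ⟨w, hw⟩ := hu.exists_mate
  obtain ⟨inv₁, cl₁⟩ := grow_spec hE hx hf
  have hz₁ := reach v i hf
  -- If the other end `w` of the unused arc is settled or cannot use it, there is no exit at all:
  -- the settled set is closed under adjacency and contains `z`.
  by_cases hexit : (grow N E v i x).2 w ∨ ¬ Usable E i w
  · refine hz₁ (mem_of_closed (S := (grow N E v i x).2) ?_ inv₁.root hvz)
    rintro a b ha ⟨j, hm, -, hb⟩
    by_contra hnb
    obtain ⟨rfl, rfl⟩ := cl₁ a b j ha hnb hm hb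
    have := hE.unique hm hw
    subst this
    exact hexit.elim hnb (fun h => h hb)
  · push Not at hexit
    have hf₂ : Free E x i w := ⟨hexit.2, fun u hm => by
      rw [hE.unique hm hw.symm]; exact hcon.1⟩
    obtain ⟨inv₂, cl₂⟩ := grow_spec hE hx hf₂
    have hz₂ := reach w i hf₂
    -- Otherwise a second attempt starts at `w` with the same arc. Each of the two settled sets can
    -- be left only along this arc, which leads into the other set, so their union is closed and
    -- contains `z`.
    have hmem := mem_of_closed (S := fun a => (grow N E v i x).2 a ∨ (grow N E w i x).2 a) ?_
      (.inl inv₁.root) hvz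
    · exact hmem.elim hz₁ hz₂
    · rintro a b hab ⟨j, hm, -, hb⟩
      by_contra! hnb
      rcases hab with ha | ha
      · obtain ⟨rfl, rfl⟩ := cl₁ a b j ha hnb.1 hm hb
        rw [hE.unique hm hw] at hnb
        exact hnb.2 inv₂.root
      · obtain ⟨rfl, rfl⟩ := cl₂ a b j ha hnb.2 hm hb
        rw [hE.unique hm hw.symm] at hnb
        exact hnb.1 inv₁.root

/-- The arcs that satisfy a condition. -/
noncomputable def arcs (N : ℕ) (E : ℕ → ℕ → ℕ → Bool) (c : ℕ → ℕ → ℕ → Prop) :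
    Finset (ℕ × ℕ × ℕ) :=
  (Finset.range N ×ˢ Finset.range N ×ˢ Finset.range N).filter fun e =>
    E e.1 e.2.1 e.2.2 = true ∧ c e.1 e.2.1 e.2.2

theorem mem_arcs (hE : IsMatching N E) {c : ℕ → ℕ → ℕ → Prop} {e : ℕ × ℕ × ℕ} :
    e ∈ arcs N E c ↔ E e.1 e.2.1 e.2.2 = true ∧ c e.1 e.2.1 e.2.2 := by
  simp only [arcs, Finset.mem_filter, Finset.mem_product, Finset.mem_range, and_iff_right_iff_imp]
  exact fun h => hE.lt h.1

theorem arc_ext (hE : IsMatching N E) {e e' : ℕ × ℕ × ℕ} (h : E e.1 e.2.1 e.2.2 = true)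
    (h' : E e'.1 e'.2.1 e'.2.2 = true) (hi : e.1 = e'.1) {v : ℕ} (hv : v = e.2.1 ∨ v = e.2.2)
    (hv' : v = e'.2.1 ∨ v = e'.2.2) : e = e' := by
  obtain ⟨i, a, b⟩ := e
  obtain ⟨i', a', b'⟩ := e'
  dsimp only at *
  subst hi
  rcases hv with rfl | rfl <;> rcases hv' with rfl | rfl
  · rw [hE.unique (.inl h) (.inl h')]
  · have := hE.unique (.inl h) (.inr h')
    subst this
    exact absurd h' (hE.asymm h)
  · have := hE.unique (.inr h) (.inl h')
    subst this
    exact absurd h' (hE.asymm h)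
  · rw [hE.unique (.inr h) (.inr h')]

/-- Checked for each arc: its cost is 2, less 2 if the tail is used and less 1 if only the head is
used. -/
theorem cost_add (x : ℕ → Option ℕ) :
    cost N E x + (2 * (arcs N E fun i u _ => x u = some i).card +
      (arcs N E fun i u v => x u ≠ some i ∧ x v = some i).card) =
      2 * (arcs N E fun _ _ _ => True).card := by
  simp only [cost, arcs, Finset.card_filter, Finset.mul_sum, Finset.sum_product,
    ← Finset.sum_add_distrib]
  refine Finset.sum_congr rfl fun i _ => Finset.sum_congr rfl fun u _ =>
    Finset.sum_congr rfl fun v _ => ?_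
  by_cases h : E i u v = true
  · by_cases h₁ : x u = some i
    · simp [h, h₁, arcCost]
    · by_cases h₂ : x v = some i <;> simp [h, h₁, h₂, arcCost]
  · simp [h]

/-- The item that makes use of an arc. -/
noncomputable def owner (y : ℕ → Option ℕ) (e : ℕ × ℕ × ℕ) : ℕ :=
  if y e.2.1 = some e.1 then e.2.1 else e.2.2

theorem owner_mem (y : ℕ → Option ℕ) (e : ℕ × ℕ × ℕ) :
    owner y e = e.2.1 ∨ owner y e = e.2.2 := by
  unfold owner
  split <;> simp

/-- The owner determines the agent that it is assigned to, and within the matching of this agent it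
lies on one arc only. -/
theorem owner_injOn (hE : IsMatching N E) (y : ℕ → Option ℕ) {s : Set (ℕ × ℕ × ℕ)}
    (hs : ∀ e ∈ s, E e.1 e.2.1 e.2.2 = true ∧ y (owner y e) = some e.1) :
    Set.InjOn (owner y) s := by
  intro e he e₁ he₁ h
  have h₁ := hs e he
  have h₂ := hs e₁ he₁
  rw [h, h₂.2, Option.some.injEq] at h₁
  exact arc_ext hE h₁.1 h₂.1 h₁.2.symm (owner_mem y e) (h ▸ owner_mem y e₁)

/-- In an arbitrary assignment, the number of the arcs used by their tails and the number of the
arcs used by heads that are no tails sum up to at most the number of items assigned by a stable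
assignment. -/
theorem card_le_assigned (hE : IsMatching N E) {x : ℕ → Option ℕ} (hx : Valid E x)
    (hs : ∀ v < N, ∀ i < N, improve N E v i x = x) (y : ℕ → Option ℕ) :
    (arcs N E fun i u v => y u = some i ∨ y v = some i ∧ ¬ Good E v).card ≤
      (assigned N x).card := by
  set B := arcs N E fun i u v => y u = some i ∨ y v = some i ∧ ¬ Good E v with hB
  have hBo : ∀ e ∈ B, E e.1 e.2.1 e.2.2 = true ∧ y (owner y e) = some e.1 ∧
      Usable E e.1 (owner y e) := by
    intro e he
    rw [hB, mem_arcs hE] at he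
    refine ⟨he.1, ?_⟩
    unfold owner
    split
    next h => exact ⟨h, .inl ⟨_, he.1⟩⟩
    next h =>
      have := he.2.resolve_left h
      exact ⟨this.1, .inr ⟨⟨_, he.1⟩, this.2⟩⟩
  have hinj : Set.InjOn (owner y) (B : Set (ℕ × ℕ × ℕ)) :=
    owner_injOn hE y fun e he => ⟨(hBo e he).1, (hBo e he).2.1⟩
  -- Stability makes `x` use the arc as well, perhaps from its other end; that end is adjacent to
  -- the first one and hence deficient too.
  have hused : ∀ e ∈ B, Deficient E x (owner y e) →
      x (owner x e) = some e.1 ∧ Deficient E x (owner x e) := by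
    intro e he hd
    obtain ⟨h₁, h₂, h₃⟩ := hBo e he
    have hm : Mate E e.1 (owner y e) (if owner y e = e.2.1 then e.2.2 else e.2.1) := by
      split
      next h => rw [h]; exact .inl h₁
      next h => rw [(owner_mem y e).resolve_left h]; exact .inr h₁
    have key : x (owner x e) = some e.1 := by
      unfold owner
      split
      next h => exact h
      next h =>
        rcases used_of_deficient hE hx hs hd h₃ with h₄ | ⟨w, hw, h₄⟩
        · rcases owner_mem y e with h₅ | h₅
          · exact absurd (h₅ ▸ h₄) h
          · exact h₅ ▸ h₄
        · have := hE.unique hw hm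
          subst this
          split at h₄
          · exact h₄
          · exact absurd h₄ h
    refine ⟨key, ?_⟩
    by_cases ho : owner x e = owner y e
    · rw [ho]; exact hd
    · obtain ⟨z, hz₁, hz₂, hz₃⟩ := hd
      refine ⟨z, hz₁, hz₂, .head ⟨e.1, ?_, hx.usable key, h₃⟩ hz₃⟩
      rcases owner_mem x e with h₄ | h₄ <;> rcases owner_mem y e with h₅ | h₅ <;>
        rw [h₄, h₅] at ho ⊢
      · exact absurd rfl ho
      · exact .inl h₁
      · exact .inr h₁
      · exact absurd rfl ho
  set D := B.filter fun e => Deficient E x (owner y e) with hD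
  -- Arcs in deficient components are counted by the items to which `x` assigns them.
  have hD₁ : D.card ≤ ((assigned N x).filter (Deficient E x)).card := by
    refine Finset.card_le_card_of_injOn (owner x) ?_ ?_
    · intro e he
      rw [hD, Finset.mem_coe, Finset.mem_filter] at he
      have h := hused e he.1 he.2
      simp only [assigned, Finset.coe_filter, Finset.mem_filter, Finset.mem_range,
        Set.mem_ofPred_eq]
      exact ⟨⟨((hx.usable h.1).lt hE).2, by rw [h.1]; rfl⟩, h.2⟩
    · refine owner_injOn hE x fun e he => ?_
      rw [hD, Finset.mem_coe, Finset.mem_filter] at he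
      exact ⟨(hBo e he.1).1, (hused e he.1 he.2).1⟩
  -- Elsewhere they are counted by their owners under `y`: these have a usable arc, so `x` assigns
  -- them, for otherwise they would be deficient themselves.
  have hD₂ : (B.filter fun e => ¬ Deficient E x (owner y e)).card ≤
      ((assigned N x).filter fun v => ¬ Deficient E x v).card := by
    refine Finset.card_le_card_of_injOn (owner y) ?_ (hinj.mono (Finset.filter_subset _ _))
    intro e he
    rw [Finset.mem_coe, Finset.mem_filter] at he
    obtain ⟨h₁, h₂, h₃⟩ := hBo e he.1
    simp only [assigned, Finset.coe_filter, Finset.mem_filter, Finset.mem_range, Set.mem_ofPred_eq]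
    refine ⟨⟨(h₃.lt hE).2, ?_⟩, he.2⟩
    rw [Option.isSome_iff_ne_none]
    exact fun h => he.2 ⟨_, ⟨_, h₃⟩, h, .refl⟩
  have h₁ : D.card + (B.filter fun e => ¬ Deficient E x (owner y e)).card = B.card :=
    Finset.card_filter_add_card_filter_not _
  have h₂ : ((assigned N x).filter (Deficient E x)).card +
      ((assigned N x).filter fun v => ¬ Deficient E x v).card = (assigned N x).card :=
    Finset.card_filter_add_card_filter_not _
  omega

/-- The gain of any assignment `y` splits into a part bounded by the number of good items and a part
bounded by the number of items assigned by `x`. The gain of `x` is at least the sum of the two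
bounds. -/
theorem opt_isOptimal (hE : IsMatching N E) (y : ℕ → Option ℕ) :
    cost N E (opt N E) ≤ cost N E y := by
  obtain ⟨⟨hx, hgood⟩, hs⟩ := opt_spec hE
  set x := opt N E
  set g := (Finset.range N).filter (Good E) with hg
  -- A good item can be used only as a tail, so the good items, all of which are assigned, yield
  -- distinct arcs used by their tails.
  have hx₁ : g.card ≤ (arcs N E fun i u _ => x u = some i).card := by
    have : ∀ u, Good E u → ∃ i v, x u = some i ∧ E i u v = true := by
      intro u hu
      obtain ⟨i, hi⟩ := Option.isSome_iff_exists.mp (hgood u hu)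
      rcases hx.usable hi with ⟨v, hv⟩ | ⟨-, h⟩
      · exact ⟨i, v, hi, hv⟩
      · exact absurd hu h
    choose! i v hi hv using this
    refine Finset.card_le_card_of_injOn (fun u => (i u, u, v u)) ?_ ?_
    · intro u hu
      rw [hg, Finset.mem_coe, Finset.mem_filter] at hu
      rw [Finset.mem_coe, mem_arcs hE]
      exact ⟨hv u hu.2, hi u hu.2⟩
    · intro u _ u' _ h
      simp only [Prod.mk.injEq] at h
      exact h.2.1
  -- A valid assignment uses no arc from both ends; each assigned item accounts for an arc of its
  -- own.
  have hx₂ : (assigned N x).card ≤ (arcs N E fun i u _ => x u = some i).card +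
      (arcs N E fun i u v => x u ≠ some i ∧ x v = some i).card := by
    have : ∀ v ∈ assigned N x, ∃ e : ℕ × ℕ × ℕ, E e.1 e.2.1 e.2.2 = true ∧ x v = some e.1 ∧
        (v = e.2.1 ∨ v = e.2.2 ∧ x e.2.1 ≠ some e.1) := by
      intro v hv
      simp only [assigned, Finset.mem_filter] at hv
      obtain ⟨i, hi⟩ := Option.isSome_iff_exists.mp hv.2
      rcases hx.usable hi with ⟨w, hw⟩ | ⟨⟨u, hu⟩, h⟩
      · exact ⟨(i, v, w), hw, hi, .inl rfl⟩
      · exact ⟨(i, u, v), hu, hi, .inr ⟨rfl, hx.disjoint hi (.inr hu)⟩⟩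
    choose! e h₁ h₂ h₃ using this
    rw [← Finset.card_union_of_disjoint (Finset.disjoint_left.mpr fun e he he' => by
      rw [mem_arcs hE] at he he'
      exact he'.2.1 he.2)]
    refine Finset.card_le_card_of_injOn e ?_ ?_
    · intro v hv
      have hv' := h₂ v hv
      rw [Finset.mem_coe, Finset.mem_union, mem_arcs hE, mem_arcs hE]
      rcases h₃ v hv with h | h
      · exact .inl ⟨h₁ v hv, h ▸ hv'⟩
      · exact .inr ⟨h₁ v hv, h.2, by rw [← h.1]; exact hv'⟩
    · intro v hv w hw h
      have a₁ := h₃ v hv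
      have a₂ := h₃ w hw
      have b₁ := h₂ v hv
      have b₂ := h₂ w hw
      rw [← h] at a₂ b₂
      rcases a₁ with a₁ | ⟨a₁, c₁⟩ <;> rcases a₂ with a₂ | ⟨a₂, c₂⟩
      · rw [a₁, a₂]
      · exact absurd (a₁ ▸ b₁) c₂
      · exact absurd (a₂ ▸ b₂) c₁
      · rw [a₁, a₂]
  have hy₁ := card_le_assigned hE hx hs y
  have hsplit : ∀ (c₁ c₂ : ℕ → ℕ → ℕ → Prop), (∀ i u v, E i u v = true → c₁ i u v → ¬ c₂ i u v) →
      (arcs N E fun i u v => c₁ i u v ∨ c₂ i u v).card =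
        (arcs N E c₁).card + (arcs N E c₂).card := by
    intro c₁ c₂ h
    rw [← Finset.card_union_of_disjoint (Finset.disjoint_left.mpr fun e he he' => by
      rw [mem_arcs hE] at he he'
      exact h _ _ _ he.1 he.2 he'.2)]
    congr 1
    ext e
    simp only [Finset.mem_union, mem_arcs hE]
    tauto
  have e₁ : (arcs N E fun i u v => y u = some i ∨ y v = some i ∧ ¬ Good E v) =
      arcs N E fun i u v => y u = some i ∨ (y u ≠ some i ∧ y v = some i) ∧ ¬ Good E v := by
    ext e
    simp only [mem_arcs hE]
    tauto
  have e₂ : (arcs N E fun i u v => y u ≠ some i ∧ y v = some i) =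
      arcs N E fun i u v => (y u ≠ some i ∧ y v = some i) ∧ ¬ Good E v ∨
        (y u ≠ some i ∧ y v = some i) ∧ Good E v := by
    ext e
    simp only [mem_arcs hE]
    tauto
  -- The owners of these arcs are good, either as tails of the arcs themselves or by the condition
  -- on the head.
  have hy₂ : (arcs N E fun i u v => y u = some i ∨ (y u ≠ some i ∧ y v = some i) ∧ Good E v).card ≤
      g.card := by
    refine Finset.card_le_card_of_injOn (owner y) ?_ (owner_injOn hE y ?_)
    · intro e he
      rw [Finset.mem_coe, mem_arcs hE] at he
      have hlt := hE.lt he.1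
      rw [hg, Finset.mem_coe, Finset.mem_filter, Finset.mem_range]
      unfold owner
      split
      next h => exact ⟨hlt.2.1, _, _, he.1⟩
      next h => exact ⟨hlt.2.2, (he.2.resolve_left h).2⟩
    · intro e he
      rw [Finset.mem_coe, mem_arcs hE] at he
      refine ⟨he.1, ?_⟩
      unfold owner
      split
      next h => exact h
      next h => exact (he.2.resolve_left h).1.2
  -- With T, H₁, H₀ for the three classes of arcs used by `y`: `hy₁` bounds T + H₀, `hy₂` bounds T +
  -- H₁, and `hy₃` involves 2T + H₀ + H₁.
  rw [e₁, hsplit _ _ (by tauto)] at hy₁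
  rw [hsplit _ _ (by tauto)] at hy₂
  have hy₃ := cost_add (N := N) (E := E) y
  rw [e₂, hsplit _ _ (by tauto)] at hy₃
  have hx₃ := cost_add (N := N) (E := E) x
  omega

end ArcAssignment


/-! ### Conditions, quantifiers, simulation of loops and frame rules. -/

namespace Cmd

open Function

variable {V A : Type} [DecidableEq V] [DecidableEq A]

/-- Boolean combinations of tests. -/
inductive Cond (V A : Type) : Type
  | atom (a : A) (x y z : V) : Cond V A
  | not (c : Cond V A) : Cond V A
  | and (c d : Cond V A) : Cond V A
  | or (c d : Cond V A) : Cond V A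

/-- The truth value of a condition. -/
def Cond.eval (e : V → ℕ) (m : Mem A) : Cond V A → Bool
  | atom a x y z => m.arr a (e x) (e y) (e z)
  | not c => !c.eval e m
  | and c d => c.eval e m && d.eval e m
  | or c d => c.eval e m || d.eval e m

/-- The condition does not depend on the array `b`. -/
def Cond.avoids (b : A) : Cond V A → Bool
  | atom a _ _ _ => a != b
  | not c => c.avoids b
  | and c d => c.avoids b && d.avoids b
  | or c d => c.avoids b && d.avoids b

theorem Cond.eval_congr {V A : Type} [DecidableEq A] {b : A} {e : V → ℕ} {m m' : Mem A}
    (h : ∀ a, a ≠ b → m'.arr a = m.arr a)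
    (c : Cond V A) (hc : c.avoids b = true) : c.eval e m' = c.eval e m := by
  induction c with
  | atom a x y z => simp only [avoids, bne_iff_ne] at hc; simp [eval, h a hc]
  | not c ih => simp only [avoids] at hc; simp [eval, ih hc]
  | and c d ihc ihd => simp only [avoids, Bool.and_eq_true] at hc; simp [eval, ihc hc.1, ihd hc.2]
  | or c d ihc ihd => simp only [avoids, Bool.and_eq_true] at hc; simp [eval, ihc hc.1, ihd hc.2]

/-- Case distinction by a condition. -/
def branch : Cond V A → Cmd V A → Cmd V A → Cmd V A
  | .atom a x y z, p, q => .test a x y z p q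
  | .not c, p, q => branch c q p
  | .and c d, p, q => branch c (branch d p q) q
  | .or c d, p, q => branch c p (branch d p q)

theorem exec_branch (N : ℕ) (e : V → ℕ) (m : Mem A) (c : Cond V A) : ∀ p q : Cmd V A,
    exec N (branch c p q) e m = if c.eval e m = true then exec N p e m else exec N q e m := by
  induction c with
  | atom a x y z => intro p q; rfl
  | not c ih =>
    intro p q
    rw [branch, ih, Cond.eval]
    cases c.eval e m <;> rfl
  | and c d ihc ihd =>
    intro p q
    rw [branch, ihc, ihd, Cond.eval]
    cases c.eval e m <;> simp
  | or c d ihc ihd =>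
    intro p q
    rw [branch, ihc, ihd, Cond.eval]
    cases c.eval e m <;> simp

theorem exec_seq (N : ℕ) (p q : Cmd V A) (e : V → ℕ) (m : Mem A) :
    exec N (seq p q) e m = exec N q e (exec N p e m) := rfl

/-- Reduces a loop of the program to the corresponding fold of the abstract algorithm: a relation
between memories and abstract states has to be preserved by the bodies only. -/
theorem loop_simulation {α : Type} {N : ℕ} {x : V} {p : Cmd V A} {e : V → ℕ}
    (R : Mem A → α → Prop) (f : ℕ → α → α)
    (h : ∀ i < N, ∀ m a, R m a → R (exec N p (update e x i) m) (f i a)) {m : Mem A} {a : α}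
    (hm : R m a) : R (exec N (loop x p) e m) (foldRange N f a) := by
  suffices ∀ n ≤ N, R (foldRange n (fun i m => exec N p (update e x i) m) m)
    (foldRange n f a) from this N le_rfl
  intro n
  induction n with
  | zero => intro _; exact hm
  | succ n ih =>
    intro hn
    rw [foldRange_succ, foldRange_succ]
    exact h n (by omega) _ _ (ih (by omega))

theorem loop_induction {N : ℕ} {x : V} {p : Cmd V A} {e : V → ℕ} (I : ℕ → Mem A → Prop)
    {m : Mem A} (h₀ : I 0 m) (h : ∀ i < N, ∀ m, I i m → I (i + 1) (exec N p (update e x i) m)) :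
    I N (exec N (loop x p) e m) :=
  foldRange_induction I h₀ h

/-- The program does not write to the array `a`. -/
def keeps (a : A) : Cmd V A → Bool
  | skip => true
  | seq p q => p.keeps a && q.keeps a
  | write b _ _ _ _ => b != a
  | test _ _ _ _ p q => p.keeps a && q.keeps a
  | loop _ p => p.keeps a
  | read p q r => p.keeps a && (q.keeps a && r.keeps a)
  | emit _ => true

/-- The program reads no input. -/
def deaf : Cmd V A → Bool
  | skip => true
  | seq p q => p.deaf && q.deaf
  | write _ _ _ _ _ => true
  | test _ _ _ _ p q => p.deaf && q.deaf
  | loop _ p => p.deaf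
  | read _ _ _ => false
  | emit _ => true

/-- The program produces no output. -/
def mute : Cmd V A → Bool
  | skip => true
  | seq p q => p.mute && q.mute
  | write _ _ _ _ _ => true
  | test _ _ _ _ p q => p.mute && q.mute
  | loop _ p => p.mute
  | read p q r => p.mute && (q.mute && r.mute)
  | emit _ => false

/-- The syntactic check is evaluated by `decide`, so that the frame conditions for concrete programs
need no further argument. -/
theorem exec_arr (N : ℕ) {a : A} (c : Cmd V A) (hc : c.keeps a = true) : ∀ e m,
    (exec N c e m).arr a = m.arr a := by
  induction c with
  | skip => intro e m; rfl
  | seq p q ihp ihq =>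
    simp only [keeps, Bool.and_eq_true] at hc
    intro e m
    rw [exec, ihq hc.2, ihp hc.1]
  | write b x y z v =>
    simp only [keeps, bne_iff_ne] at hc
    intro e m
    simp [exec, Mem.write, hc.symm]
  | test b x y z p q ihp ihq =>
    simp only [keeps, Bool.and_eq_true] at hc
    intro e m
    rw [exec]
    split
    · exact ihp hc.1 _ _
    · exact ihq hc.2 _ _
  | loop x p ih =>
    intro e m
    exact loop_induction (fun _ m' => m'.arr a = m.arr a) rfl fun i _ m' h => by
      rw [ih hc, h]
  | read p q r ihp ihq ihr =>
    simp only [keeps, Bool.and_eq_true] at hc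
    intro e m
    simp only [exec]
    split
    · exact ihr hc.2.2 _ _
    · exact ihq hc.2.1 _ _
    · exact ihp hc.1 _ _
  | emit b => intro e m; rfl

theorem exec_inp (N : ℕ) (c : Cmd V A) (hc : c.deaf = true) : ∀ e m,
    (exec N c e m).inp = m.inp := by
  induction c with
  | skip => intro e m; rfl
  | seq p q ihp ihq =>
    simp only [deaf, Bool.and_eq_true] at hc
    intro e m
    rw [exec, ihq hc.2, ihp hc.1]
  | write b x y z v => intro e m; rfl
  | test b x y z p q ihp ihq =>
    simp only [deaf, Bool.and_eq_true] at hc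
    intro e m
    rw [exec]
    split
    · exact ihp hc.1 _ _
    · exact ihq hc.2 _ _
  | loop x p ih =>
    intro e m
    exact loop_induction (fun _ m' => m'.inp = m.inp) rfl fun i _ m' h => by rw [ih hc, h]
  | read p q r ihp ihq ihr => simp [deaf] at hc
  | emit b => intro e m; rfl

theorem exec_out (N : ℕ) (c : Cmd V A) (hc : c.mute = true) : ∀ e m,
    (exec N c e m).out = m.out := by
  induction c with
  | skip => intro e m; rfl
  | seq p q ihp ihq =>
    simp only [mute, Bool.and_eq_true] at hc
    intro e m
    rw [exec, ihq hc.2, ihp hc.1]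
  | write b x y z v => intro e m; rfl
  | test b x y z p q ihp ihq =>
    simp only [mute, Bool.and_eq_true] at hc
    intro e m
    rw [exec]
    split
    · exact ihp hc.1 _ _
    · exact ihq hc.2 _ _
  | loop x p ih =>
    intro e m
    exact loop_induction (fun _ m' => m'.out = m.out) rfl fun i _ m' h => by rw [ih hc, h]
  | read p q r ihp ihq ihr =>
    simp only [mute, Bool.and_eq_true] at hc
    intro e m
    simp only [exec]
    split
    · exact ihr hc.2.2 _ _
    · exact ihq hc.2.1 _ _
    · exact ihp hc.1 _ _
  | emit b => simp [mute] at hc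

theorem write_same (m : Mem A) (a : A) (i j k : ℕ) (b : Bool) :
    (m.write a i j k b).arr a i j k = b := by
  simp [Mem.write]

theorem write_apply (m : Mem A) (a a' : A) (i j k i' j' k' : ℕ) (b : Bool) :
    (m.write a i j k b).arr a' i' j' k' =
      if a' = a ∧ i' = i ∧ j' = j ∧ k' = k then b else m.arr a' i' j' k' := rfl

/-- Fill the array `b` with the values of a condition. -/
def tab (x y o : V) (b : A) (c : Cond V A) : Cmd V A :=
  .loop x (.loop y (branch c (.write b x y o true) (.write b x y o false)))

/-- The condition does not read the array being filled, so it can be evaluated in the memory before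
the loops. -/
theorem exec_tab {N : ℕ} {x y o : V} {b : A} {c : Cond V A} {e : V → ℕ} {m : Mem A}
    (hxy : x ≠ y) (hxo : x ≠ o) (hyo : y ≠ o) (ho : e o = 0) (hc : c.avoids b = true) {i j : ℕ}
    (hi : i < N) (hj : j < N) :
    (exec N (tab x y o b c) e m).arr b i j 0 = c.eval (update (update e x i) y j) m := by
  have h := loop_induction (N := N) (x := x) (e := e) (m := m)
    (p := .loop y (branch c (.write b x y o true) (.write b x y o false)))
    (fun n m' => (∀ a, a ≠ b → m'.arr a = m.arr a) ∧ ∀ i < n, ∀ j < N,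
      m'.arr b i j 0 = c.eval (update (update e x i) y j) m)
    ⟨fun _ _ => rfl, by simp⟩ (by
      rintro n - m₁ ⟨h₁, h₂⟩
      have h := loop_induction (N := N) (x := y) (e := update e x n) (m := m₁)
        (p := branch c (.write b x y o true) (.write b x y o false))
        (fun k m' => (∀ a, a ≠ b → m'.arr a = m.arr a) ∧ (∀ i < n, ∀ j < N,
          m'.arr b i j 0 = c.eval (update (update e x i) y j) m) ∧ ∀ j < k,
          m'.arr b n j 0 = c.eval (update (update e x n) y j) m)
        ⟨h₁, h₂, by simp⟩ (by
          rintro k - m₂ ⟨h₁, h₂, h₃⟩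
          have hex : exec N (branch c (.write b x y o true) (.write b x y o false))
              (update (update e x n) y k) m₂ =
              m₂.write b n k 0 (c.eval (update (update e x n) y k) m) := by
            rw [exec_branch, Cond.eval_congr h₁ c hc]
            cases c.eval (update (update e x n) y k) m <;>
              simp [exec, update_of_ne hxy, update_of_ne hxo.symm, update_of_ne hyo.symm, ho]
          rw [hex]
          refine ⟨fun a ha => ?_, fun i hi j hj => ?_, fun j hj => ?_⟩
          · rw [← h₁ a ha]
            simp [Mem.write, ha]
          · rw [write_apply, if_neg (by omega), h₂ i hi j hj]
          · rw [write_apply]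
            by_cases hjk : j = k
            · subst hjk; simp
            · rw [if_neg (by tauto), h₃ j (by omega)])
      refine ⟨h.1, fun i hi j hj => ?_⟩
      rcases Nat.lt_succ_iff_lt_or_eq.mp hi with hi | rfl
      · exact h.2.1 i hi j hj
      · exact h.2.2 j hj)
  exact h.2 i hi j hj

/-- Existential quantification over the variable `z`. -/
def ex (x y z o : V) (b : A) (c : Cond V A) : Cmd V A :=
  .loop x (.loop y (.seq (.write b x y o false) (.loop z (branch c (.write b x y o true) .skip))))

theorem exec_ex {N : ℕ} {x y z o : V} {b : A} {c : Cond V A} {e : V → ℕ} {m : Mem A}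
    (hxy : x ≠ y) (hxz : x ≠ z) (hyz : y ≠ z) (hxo : x ≠ o) (hyo : y ≠ o) (hzo : z ≠ o)
    (ho : e o = 0) (hc : c.avoids b = true) {i j : ℕ} (hi : i < N) (hj : j < N) :
    (exec N (ex x y z o b c) e m).arr b i j 0 = true ↔
      ∃ k < N, c.eval (update (update (update e x i) y j) z k) m = true := by
  have h := loop_induction (N := N) (x := x) (e := e) (m := m)
    (p := .loop y (.seq (.write b x y o false) (.loop z (branch c (.write b x y o true) .skip))))
    (fun n m' => (∀ a, a ≠ b → m'.arr a = m.arr a) ∧ ∀ i < n, ∀ j < N, (m'.arr b i j 0 = true ↔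
      ∃ k < N, c.eval (update (update (update e x i) y j) z k) m = true))
    ⟨fun _ _ => rfl, by simp⟩ (by
      rintro n - m₁ ⟨h₁, h₂⟩
      have h := loop_induction (N := N) (x := y) (e := update e x n) (m := m₁)
        (p := .seq (.write b x y o false) (.loop z (branch c (.write b x y o true) .skip)))
        (fun k m' => (∀ a, a ≠ b → m'.arr a = m.arr a) ∧ (∀ i < n, ∀ j < N,
          (m'.arr b i j 0 = true ↔
            ∃ k < N, c.eval (update (update (update e x i) y j) z k) m = true)) ∧ ∀ j < k,
          (m'.arr b n j 0 = true ↔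
            ∃ k < N, c.eval (update (update (update e x n) y j) z k) m = true))
        ⟨h₁, h₂, by simp⟩ (by
          rintro k - m₂ ⟨h₁, h₂, h₃⟩
          have hw : exec N (.write b x y o false) (update (update e x n) y k) m₂ =
              m₂.write b n k 0 false := by
            simp [exec, update_of_ne hxy, update_of_ne hxo.symm, update_of_ne hyo.symm, ho]
          rw [exec, hw]
          have h := loop_induction (N := N) (x := z) (e := update (update e x n) y k)
            (m := m₂.write b n k 0 false) (p := branch c (.write b x y o true) .skip)
            (fun l m' => (∀ a, a ≠ b → m'.arr a = m.arr a) ∧ (∀ i < n, ∀ j < N,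
              (m'.arr b i j 0 = true ↔
                ∃ k < N, c.eval (update (update (update e x i) y j) z k) m = true)) ∧ (∀ j < k,
              (m'.arr b n j 0 = true ↔
                ∃ k < N, c.eval (update (update (update e x n) y j) z k) m = true)) ∧
              (m'.arr b n k 0 = true ↔
                ∃ r < l, c.eval (update (update (update e x n) y k) z r) m = true))
            (by
              refine ⟨fun a ha => ?_, fun i hi j hj => ?_, fun j hj => ?_, by simp [write_same]⟩
              · rw [← h₁ a ha]
                simp [Mem.write, ha]
              · rw [write_apply, if_neg (by omega), h₂ i hi j hj]
              · rw [write_apply, if_neg (by omega), h₃ j hj])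
            (by
              rintro l - m₃ ⟨h₁, h₂, h₃, h₄⟩
              rw [exec_branch, Cond.eval_congr h₁ c hc]
              by_cases hce : c.eval (update (update (update e x n) y k) z l) m = true
              · have hw : exec N (.write b x y o true) (update (update (update e x n) y k) z l) m₃ =
                    m₃.write b n k 0 true := by
                  simp [exec, update_of_ne hxy, update_of_ne hxo.symm, update_of_ne hyo.symm,
                    update_of_ne hxz, update_of_ne hyz, update_of_ne hzo.symm, ho]
                rw [if_pos hce, hw]
                refine ⟨fun a ha => ?_, fun i hi j hj => ?_, fun j hj => ?_, ?_⟩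
                · rw [← h₁ a ha]
                  simp [Mem.write, ha]
                · rw [write_apply, if_neg (by omega), h₂ i hi j hj]
                · rw [write_apply, if_neg (by omega), h₃ j hj]
                · rw [write_same]
                  exact ⟨fun _ => ⟨l, by omega, hce⟩, fun _ => rfl⟩
              · rw [if_neg hce]
                refine ⟨h₁, h₂, h₃, h₄.trans ⟨?_, ?_⟩⟩
                · rintro ⟨r, hr, hr'⟩
                  exact ⟨r, by omega, hr'⟩
                · rintro ⟨r, hr, hr'⟩
                  rcases Nat.lt_succ_iff_lt_or_eq.mp hr with hr | rfl
                  · exact ⟨r, hr, hr'⟩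
                  · exact absurd hr' hce)
          refine ⟨h.1, h.2.1, fun j hj => ?_⟩
          rcases Nat.lt_succ_iff_lt_or_eq.mp hj with hj | rfl
          · exact h.2.2.1 j hj
          · exact h.2.2.2)
      refine ⟨h.1, fun i hi j hj => ?_⟩
      rcases Nat.lt_succ_iff_lt_or_eq.mp hi with hi | rfl
      · exact h.2.1 i hi j hj
      · exact h.2.2 j hj)
  exact h.2 i hi j hj

end Cmd


/-! ### The program -/

namespace MinSum

/-- The variables of the program; `o` is always `0`. -/
inductive Var : Type
  | o | r | v₀ | i₀ | q | a | b | j | i | v | w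
  deriving DecidableEq

/-- The arrays of the program. -/
inductive Arr : Type
  | item | agent | done | arc | tail | head | good | use | cur | asg | new | set | conf | better
  | digit | borrow | neg
  deriving DecidableEq

instance : Fintype Var := Fintype.ofList [.o, .r, .v₀, .i₀, .q, .a, .b, .j, .i, .v, .w]
  fun x => by cases x <;> decide

instance : Fintype Arr :=
  Fintype.ofList [.item, .agent, .done, .arc, .tail, .head, .good, .use, .cur, .asg, .new, .set,
    .conf, .better, .digit, .borrow, .neg] fun x => by cases x <;> decide

open Function Classical Cmd ArcAssignment

/-- Programs with these variables and arrays. -/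
abbrev Prog := Cmd Var Arr

/-- `b (i, v)` is the truth value of `c`. -/
abbrev tabulate (b : Arr) (c : Cond Var Arr) : Prog := tab .i .v .o b c

/-- `b (i, v)` is the truth value of `∃ w, c`. -/
abbrev someW (b : Arr) (c : Cond Var Arr) : Prog := ex .i .v .w .o b c

/-- Compute the tails, the heads and the usable arcs. -/
def prepare : Prog :=
  .seq (someW .tail (.atom .arc .i .v .w))
    (.seq (someW .head (.atom .arc .i .w .v))
      (.seq (someW .good (.atom .tail .w .v .o))
        (tabulate .use (.or (.atom .tail .i .v .o)
          (.and (.atom .head .i .v .o) (.not (.atom .good .o .v .o)))))))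

/-- Each tail is given to the first agent with an arc starting there. -/
def startProg : Prog :=
  .loop .i (.loop .v (branch (.and (.atom .tail .i .v .o) (.not (.atom .asg .o .v .o)))
    (.seq (.write .cur .i .v .o true) (.write .asg .o .v .o true)) .skip))

/-- Give the item `x` to the agent `y`. -/
def give (x y : Var) : Prog :=
  .seq (.loop .i (.write .new .i x .o false))
    (.seq (.write .new y x .o true) (.write .set .o x .o true))

/-- The elementary step of the propagation. -/
def spreadProg : Prog :=
  branch (.and (.atom .set .o .a .o) (.and (.not (.atom .set .o .b .o))
      (.and (.or (.atom .arc .j .a .b) (.atom .arc .j .b .a))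
        (.and (.not (.atom .new .j .a .o)) (.atom .use .j .b .o)))))
    (give .b .j) .skip

/-- The propagation. -/
def growProg : Prog :=
  .seq (tabulate .new (.atom .cur .i .v .o))
    -- An unsatisfiable condition: this empties the set.
    (.seq (tabulate .set (.and (.atom .cur .i .v .o) (.not (.atom .cur .i .v .o))))
      (.seq (give .v₀ .i₀)
        (.loop .q (.loop .a (.loop .b (.loop .j spreadProg))))))

/-- One attempt to improve the current assignment. -/
def improveProg : Prog :=
  .seq (someW .conf (.and (.or (.atom .arc .i .v .w) (.atom .arc .i .w .v)) (.atom .cur .i .w .o)))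
    (branch (.and (.atom .use .i₀ .v₀ .o) (.not (.atom .conf .i₀ .v₀ .o)))
      (.seq growProg
        (.seq (someW .asg (.atom .cur .w .v .o))
          (.seq (someW .better (.and (.atom .set .o .w .o) (.not (.atom .asg .o .w .o))))
            (branch (.atom .better .o .o .o) (tabulate .cur (.atom .new .i .v .o)) .skip))))
      .skip)

/-- The optimization. -/
def optProg : Prog := .seq prepare (.seq startProg (.loop .r (.loop .v₀ (.loop .i₀ improveProg))))

/-! ### Correctness of the program for the optimization. -/

variable {N : ℕ} {E : ℕ → ℕ → ℕ → Bool}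

/-- The array `b` represents the assignment `x`. -/
def Shows (N : ℕ) (m : Mem Arr) (b : Arr) (x : ℕ → Option ℕ) : Prop :=
  ∀ i < N, ∀ v < N, (m.arr b i v 0 = true ↔ x v = some i)

/-- The array `b` represents a set. -/
def ShowsSet (N : ℕ) (m : Mem Arr) (b : Arr) (s : ℕ → Prop) : Prop :=
  ∀ v < N, (m.arr b 0 v 0 = true ↔ s v)

/-- The array `arc` contains the arcs. -/
def HasArcs (N : ℕ) (E : ℕ → ℕ → ℕ → Bool) (m : Mem Arr) : Prop :=
  ∀ i < N, ∀ u < N, ∀ v < N, m.arr .arc i u v = E i u v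

/-- The array `use` tells which arcs are usable. -/
def HasUse (N : ℕ) (E : ℕ → ℕ → ℕ → Bool) (m : Mem Arr) : Prop :=
  ∀ i < N, ∀ v < N, (m.arr .use i v 0 = true ↔ Usable E i v)

theorem Shows.congr {m m' : Mem Arr} {b : Arr} {x : ℕ → Option ℕ} (h : Shows N m b x)
    (hm : m'.arr b = m.arr b) : Shows N m' b x := by
  intro i hi v hv
  rw [hm]
  exact h i hi v hv

theorem HasArcs.exec {m : Mem Arr} (h : HasArcs N E m) (c : Prog) (hc : c.keeps .arc = true)
    (e : Var → ℕ) : HasArcs N E (exec N c e m) := by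
  intro i hi u hu v hv
  rw [exec_arr N c hc]
  exact h i hi u hu v hv

theorem HasUse.exec {m : Mem Arr} (h : HasUse N E m) (c : Prog) (hc : c.keeps .use = true)
    (e : Var → ℕ) : HasUse N E (exec N c e m) := by
  intro i hi v hv
  rw [exec_arr N c hc]
  exact h i hi v hv

theorem exec_tabulate {b : Arr} {c : Cond Var Arr} {e : Var → ℕ} {m : Mem Arr} (ho : e .o = 0)
    (hc : c.avoids b = true) {i v : ℕ} (hi : i < N) (hv : v < N) :
    (exec N (tabulate b c) e m).arr b i v 0 = c.eval (update (update e .i i) .v v) m :=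
  exec_tab (by decide) (by decide) (by decide) ho hc hi hv

theorem exec_someW {b : Arr} {c : Cond Var Arr} {e : Var → ℕ} {m : Mem Arr} (ho : e .o = 0)
    (hc : c.avoids b = true) {i v : ℕ} (hi : i < N) (hv : v < N) :
    (exec N (someW b c) e m).arr b i v 0 = true ↔
      ∃ k < N, c.eval (update (update (update e .i i) .v v) .w k) m = true :=
  exec_ex (by decide) (by decide) (by decide) (by decide) (by decide) (by decide) ho hc hi hv

theorem exec_prepare (hE : IsMatching N E) {e : Var → ℕ} {m : Mem Arr} (ho : e .o = 0)
    (hm : HasArcs N E m) :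
    HasUse N E (exec N prepare e m) ∧
      ∀ i < N, ∀ v < N, ((exec N prepare e m).arr .tail i v 0 = true ↔ ∃ w, E i v w = true) := by
  simp only [prepare, exec_seq]
  set m₁ := exec N (someW .tail (.atom .arc .i .v .w)) e m with hm₁
  set m₂ := exec N (someW .head (.atom .arc .i .w .v)) e m₁ with hm₂
  set m₃ := exec N (someW .good (.atom .tail .w .v .o)) e m₂ with hm₃
  have t₁ : ∀ i < N, ∀ v < N, (m₁.arr .tail i v 0 = true ↔ ∃ w, E i v w = true) := by
    intro i hi v hv
    rw [hm₁, exec_someW ho (by decide) hi hv]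
    constructor
    · rintro ⟨w, hw, h⟩
      exact ⟨w, by simpa [Cond.eval, hm i hi v hv w hw] using h⟩
    · rintro ⟨w, h⟩
      have hw := (hE.lt h).2.2
      exact ⟨w, hw, by simpa [Cond.eval, hm i hi v hv w hw] using h⟩
  have hm₁' : HasArcs N E m₁ := hm.exec _ (by decide) _
  have t₂ : ∀ i < N, ∀ v < N, (m₂.arr .head i v 0 = true ↔ ∃ u, E i u v = true) := by
    intro i hi v hv
    rw [hm₂, exec_someW ho (by decide) hi hv]
    constructor
    · rintro ⟨w, hw, h⟩
      exact ⟨w, by simpa [Cond.eval, hm₁' i hi w hw v hv] using h⟩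
    · rintro ⟨w, h⟩
      have hw := (hE.lt h).2.1
      exact ⟨w, hw, by simpa [Cond.eval, hm₁' i hi w hw v hv] using h⟩
  have k₂ : m₂.arr .tail = m₁.arr .tail := exec_arr N _ (by decide) _ _
  have t₃ : ∀ i < N, ∀ v < N, (m₃.arr .good i v 0 = true ↔ Good E v) := by
    intro i hi v hv
    rw [hm₃, exec_someW ho (by decide) hi hv]
    constructor
    · rintro ⟨w, hw, h⟩
      exact ⟨w, (t₁ w hw v hv).mp (by simpa [Cond.eval, k₂, ho] using h)⟩
    · rintro ⟨w, h⟩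
      obtain ⟨u, hu⟩ := h
      have hw := (hE.lt hu).1
      exact ⟨w, hw, by simpa [Cond.eval, k₂, ho] using (t₁ w hw v hv).mpr ⟨u, hu⟩⟩
  have k₃ : m₃.arr .tail = m₂.arr .tail := exec_arr N _ (by decide) _ _
  have k₄ : m₃.arr .head = m₂.arr .head := exec_arr N _ (by decide) _ _
  constructor
  · intro i hi v hv
    rw [exec_tabulate ho (by decide) hi hv, Usable, ← t₁ i hi v hv, ← t₂ i hi v hv,
      ← t₃ 0 (by omega) v hv]
    simp [Cond.eval, ho, k₂, k₃, k₄]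
  · intro i hi v hv
    rw [exec_arr N (tabulate .use _) (by decide), k₃, k₂]
    exact t₁ i hi v hv

theorem exec_startProg {e : Var → ℕ} {m : Mem Arr} (ho : e .o = 0)
    (hm : ∀ i < N, ∀ v < N, (m.arr .tail i v 0 = true ↔ ∃ w, E i v w = true))
    (hcur : ∀ i v, m.arr .cur i v 0 = false) (hasg : ∀ v, m.arr .asg 0 v 0 = false) :
    Shows N (exec N startProg e m) .cur (start N E) := by
  have h := loop_simulation (N := N) (x := Var.i) (e := e)
    (p := .loop .v (branch (.and (.atom .tail .i .v .o) (.not (.atom .asg .o .v .o)))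
      (.seq (.write .cur .i .v .o true) (.write .asg .o .v .o true)) .skip))
    (fun (m : Mem Arr) (x : ℕ → Option ℕ) =>
      (∀ i < N, ∀ v < N, (m.arr .tail i v 0 = true ↔ ∃ w, E i v w = true)) ∧
      Shows N m .cur x ∧ ShowsSet N m .asg fun v => x v ≠ none)
    (fun i => foldRange N fun u => pick E i u)
    (by
      intro i hi m x hmx
      refine loop_simulation (fun (m : Mem Arr) (x : ℕ → Option ℕ) => (∀ i < N, ∀ v < N,
        (m.arr .tail i v 0 = true ↔ ∃ w, E i v w = true)) ∧
        Shows N m .cur x ∧ ShowsSet N m .asg fun v => x v ≠ none) (fun u => pick E i u) ?_ hmx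
      rintro u hu m x ⟨h₁, h₂, h₃⟩
      rw [exec_branch]
      have hc : (Cond.and (.atom .tail .i .v .o) (.not (.atom .asg .o .v .o))).eval
          (update (update e .i i) .v u) m = true ↔ (∃ w, E i u w = true) ∧ x u = none := by
        have := h₃ u hu
        simp only [Cond.eval, Bool.and_eq_true, Bool.not_eq_true', ← h₁ i hi u hu]
        simp [ho, ← Bool.not_eq_true, this]
      unfold pick
      by_cases hp : (∃ w, E i u w = true) ∧ x u = none
      · rw [if_pos (hc.mpr hp), if_pos hp]
        refine ⟨?_, ?_, ?_⟩
        · intro i' hi' v hv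
          rw [← h₁ i' hi' v hv]
          simp [exec, write_apply]
        · intro i' hi' v hv
          have := h₂ i' hi' v hv
          by_cases hvu : v = u
          · subst hvu
            by_cases hii : i' = i
            · simp [exec, write_apply, ho, hii]
            · have hne : i ≠ i' := fun h => hii h.symm
              simpa [exec, write_apply, ho, hii, hne, hp.2] using this
          · simpa [exec, write_apply, ho, hvu] using this
        · intro v hv
          have := h₃ v hv
          by_cases hvu : v = u
          · subst hvu
            simp [exec, write_apply, ho]
          · simpa [exec, write_apply, ho, hvu] using this
      · rw [if_neg (mt hc.mp hp), if_neg hp]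
        exact ⟨h₁, h₂, h₃⟩)
    (m := m) (a := fun _ => none)
    ⟨hm, fun i _ v _ => by simp [hcur], fun v _ => by simp [hasg]⟩
  exact h.2.1

/-- The column of the item is cleared before the new entry is made, so that the array remains the
graph of a partial function. The variable `i` runs through this column and cannot name the item. -/
theorem exec_give {e : Var → ℕ} {m : Mem Arr} {x y : Var} (hx : x ≠ .i)
    (ho : e .o = 0) {z : ℕ → Option ℕ} {s : ℕ → Prop} (h₁ : Shows N m .new z)
    (h₂ : ShowsSet N m .set s) :
    Shows N (exec N (give x y) e m) .new (update z (e x) (some (e y))) ∧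
      ShowsSet N (exec N (give x y) e m) .set (update s (e x) True) := by
  have hl := loop_induction (N := N) (x := .i) (e := e) (m := m) (p := .write .new .i x .o false)
    (fun n m' => (∀ a, a ≠ .new → m'.arr a = m.arr a) ∧
      (∀ i v, v ≠ e x → m'.arr .new i v 0 = m.arr .new i v 0) ∧
      ∀ i < n, m'.arr .new i (e x) 0 = false) ⟨fun _ _ => rfl, fun _ _ _ => rfl, by simp⟩ (by
    rintro n - m' ⟨h₁, h₂, h₃⟩
    refine ⟨fun a ha => ?_, fun i v hv => ?_, fun i hi => ?_⟩
    · rw [← h₁ a ha]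
      simp [exec, Mem.write, ha]
    · rw [← h₂ i v hv]
      simp [exec, write_apply, update_of_ne hx, hv]
    · by_cases hin : i = n
      · simp [exec, write_apply, update_of_ne hx, ho, hin]
      · rw [← h₃ i (by omega)]
        simp [exec, write_apply, update_of_ne hx, ho, hin])
  obtain ⟨l₁, l₂, l₃⟩ := hl
  simp only [give, exec] at l₁ l₂ l₃ ⊢
  constructor
  · intro i hi v hv
    by_cases hvx : v = e x
    · subst hvx
      by_cases hiy : i = e y
      · simp [write_apply, ho, hiy]
      · have hne : e y ≠ i := fun h => hiy h.symm
        simpa [write_apply, ho, hiy, hne] using l₃ i hi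
    · have := h₁ i hi v hv
      rw [← l₂ i v hvx] at this
      simpa [write_apply, ho, hvx] using this
  · intro v hv
    by_cases hvx : v = e x
    · subst hvx
      simp [write_apply, ho]
    · have := h₂ v hv
      rw [← l₁ .set (by decide)] at this
      simpa [write_apply, ho, hvx] using this

/-- The memory represents a state of the propagation. -/
def ShowsGrow (N : ℕ) (E : ℕ → ℕ → ℕ → Bool) (m : Mem Arr)
    (p : (ℕ → Option ℕ) × (ℕ → Prop)) : Prop :=
  HasArcs N E m ∧ HasUse N E m ∧ Shows N m .new p.1 ∧ ShowsSet N m .set p.2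

theorem exec_spreadProg {e : Var → ℕ} {m : Mem Arr} (ho : e .o = 0) (ha : e .a < N) (hb : e .b < N)
    (hj : e .j < N) {p : (ℕ → Option ℕ) × (ℕ → Prop)} (h : ShowsGrow N E m p) :
    ShowsGrow N E (exec N spreadProg e m) (spread E (e .a) (e .b) (e .j) p) := by
  refine ⟨h.1.exec _ (by decide) _, h.2.1.exec _ (by decide) _, ?_⟩
  obtain ⟨h₁, h₂, h₃, h₄⟩ := h
  rw [spreadProg, exec_branch]
  have hc : (Cond.and (.atom .set .o .a .o) (.and (.not (.atom .set .o .b .o))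
      (.and (.or (.atom .arc .j .a .b) (.atom .arc .j .b .a))
        (.and (.not (.atom .new .j .a .o)) (.atom .use .j .b .o))))).eval e m = true ↔
      p.2 (e .a) ∧ ¬ p.2 (e .b) ∧ Mate E (e .j) (e .a) (e .b) ∧ p.1 (e .a) ≠ some (e .j) ∧
        Usable E (e .j) (e .b) := by
    rw [← h₄ _ ha, ← h₄ _ hb, ← h₂ _ hj _ hb, ne_eq, ← h₃ _ hj _ ha, Mate, ← h₁ _ hj _ ha _ hb,
      ← h₁ _ hj _ hb _ ha]
    simp [Cond.eval, ho]
  unfold spread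
  by_cases hp : p.2 (e .a) ∧ ¬ p.2 (e .b) ∧ Mate E (e .j) (e .a) (e .b) ∧
      p.1 (e .a) ≠ some (e .j) ∧ Usable E (e .j) (e .b)
  · rw [if_pos (hc.mpr hp), if_pos hp]
    exact exec_give (by decide) ho h₃ h₄
  · rw [if_neg (mt hc.mp hp), if_neg hp]
    exact ⟨h₃, h₄⟩

theorem exec_growProg {e : Var → ℕ} {m : Mem Arr} (ho : e .o = 0) {x : ℕ → Option ℕ}
    (h₁ : HasArcs N E m) (h₂ : HasUse N E m) (h₃ : Shows N m .cur x) :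
    ShowsGrow N E (exec N growProg e m) (grow N E (e .v₀) (e .i₀) x) := by
  simp only [growProg, exec_seq]
  set m₁ := exec N (tabulate .new (.atom .cur .i .v .o)) e m with hm₁
  set m₂ := exec N (tabulate .set (.and (.atom .cur .i .v .o) (.not (.atom .cur .i .v .o)))) e m₁
    with hm₂
  have t₁ : Shows N m₁ .new x := by
    intro i hi v hv
    rw [hm₁, exec_tabulate ho (by decide) hi hv, ← h₃ i hi v hv]
    simp [Cond.eval, ho]
  have t₂ : Shows N m₂ .new x := t₁.congr (exec_arr N _ (by decide) _ _)
  have t₃ : ShowsSet N m₂ .set fun _ => False := by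
    intro v hv
    rw [hm₂, exec_tabulate ho (by decide) (by omega) hv]
    simp [Cond.eval]
  have t₄ := exec_give (x := .v₀) (y := .i₀) (by decide) ho t₂ t₃
  have t₅ : ShowsGrow N E (exec N (give .v₀ .i₀) e m₂)
      (update x (e .v₀) (some (e .i₀)), fun v => v = e .v₀) := by
    refine ⟨((h₁.exec _ (by decide) _).exec _ (by decide) _).exec _ (by decide) _,
      ((h₂.exec _ (by decide) _).exec _ (by decide) _).exec _ (by decide) _, t₄.1, ?_⟩
    intro v hv
    rw [t₄.2 v hv]
    by_cases hvv : v = e .v₀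
    · simp [hvv]
    · simp [hvv]
  refine loop_simulation (ShowsGrow N E) (fun _ => sweep N E) ?_ t₅
  intro n _ m p h
  refine loop_simulation (ShowsGrow N E) _ ?_ h
  intro a ha m p h
  refine loop_simulation (ShowsGrow N E) _ ?_ h
  intro b hb m p h
  refine loop_simulation (ShowsGrow N E) _ ?_ h
  intro j hj m p h
  have := exec_spreadProg (e := update (update (update (update e .q n) .a a) .b b) .j j) (m := m)
    (by simpa using ho) (by simpa using ha) (by simpa using hb) (by simpa using hj) h
  simpa using this

/-- The memory represents a state of the optimization. -/
def ShowsOpt (N : ℕ) (E : ℕ → ℕ → ℕ → Bool) (m : Mem Arr) (x : ℕ → Option ℕ) : Prop :=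
  HasArcs N E m ∧ HasUse N E m ∧ Shows N m .cur x

/-- The hypothesis `hlt` ensures that an assigned item is recognized by a row below N of the array;
otherwise it might look unassigned. -/
theorem exec_improveProg (hE : IsMatching N E) {e : Var → ℕ} {m : Mem Arr} (ho : e .o = 0)
    (hv : e .v₀ < N) (hi : e .i₀ < N) {x : ℕ → Option ℕ} (hlt : ∀ v i, x v = some i → i < N)
    (h : ShowsOpt N E m x) :
    ShowsOpt N E (exec N improveProg e m) (improve N E (e .v₀) (e .i₀) x) := by
  refine ⟨h.1.exec _ (by decide) _, h.2.1.exec _ (by decide) _, ?_⟩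
  obtain ⟨h₁, h₂, h₃⟩ := h
  simp only [improveProg, exec_seq, exec_branch]
  set m₁ := exec N (someW .conf (.and (.or (.atom .arc .i .v .w) (.atom .arc .i .w .v))
    (.atom .cur .i .w .o))) e m with hm₁
  have a₁ : HasArcs N E m₁ := h₁.exec _ (by decide) _
  have a₂ : HasUse N E m₁ := h₂.exec _ (by decide) _
  have a₃ : Shows N m₁ .cur x := h₃.congr (exec_arr N _ (by decide) _ _)
  have a₄ : m₁.arr .conf (e .i₀) (e .v₀) 0 = true ↔
      ∃ w, Mate E (e .i₀) (e .v₀) w ∧ x w = some (e .i₀) := by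
    rw [hm₁, exec_someW ho (by decide) hi hv]
    constructor
    · rintro ⟨w, hw, h⟩
      refine ⟨w, ?_⟩
      rw [Mate, ← h₁ _ hi _ hv _ hw, ← h₁ _ hi _ hw _ hv, ← h₃ _ hi _ hw]
      simpa [Cond.eval, ho] using h
    · rintro ⟨w, hm, h⟩
      have hw : w < N := by
        rcases hm with hm | hm
        · exact (hE.lt hm).2.2
        · exact (hE.lt hm).2.1
      refine ⟨w, hw, ?_⟩
      rw [Mate, ← h₁ _ hi _ hv _ hw, ← h₁ _ hi _ hw _ hv] at hm
      rw [← h₃ _ hi _ hw] at h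
      simp [Cond.eval, ho, hm, h]
  have a₅ : (Cond.and (.atom .use .i₀ .v₀ .o) (.not (.atom .conf .i₀ .v₀ .o))).eval e m₁ = true ↔
      Free E x (e .i₀) (e .v₀) := by
    simp only [Cond.eval, ho, Bool.and_eq_true, a₂ _ hi _ hv, Bool.not_eq_true', Free,
      ← Bool.not_eq_true, a₄]
    push Not
    rfl
  by_cases hf : Free E x (e .i₀) (e .v₀)
  swap
  · rw [if_neg (mt a₅.mp hf), improve, if_neg (fun h => hf h.1)]
    exact a₃
  rw [if_pos (a₅.mpr hf)]
  set m₂ := exec N growProg e m₁ with hm₂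
  obtain ⟨-, -, b₁, b₂⟩ := exec_growProg ho a₁ a₂ a₃
  rw [← hm₂] at b₁ b₂
  have b₃ : Shows N m₂ .cur x := a₃.congr (exec_arr N _ (by decide) _ _)
  set m₃ := exec N (someW .asg (.atom .cur .w .v .o)) e m₂ with hm₃
  have c₁ : ∀ v < N, (m₃.arr .asg 0 v 0 = true ↔ x v ≠ none) := by
    intro v hv'
    rw [hm₃, exec_someW ho (by decide) (by omega) hv']
    constructor
    · rintro ⟨w, hw, h⟩
      have : x v = some w := (b₃ w hw v hv').mp (by simpa [Cond.eval, ho] using h)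
      rw [this]
      exact Option.some_ne_none _
    · intro h
      obtain ⟨w, hw⟩ := Option.ne_none_iff_exists'.mp h
      have hwN := hlt v w hw
      exact ⟨w, hwN, by simpa [Cond.eval, ho] using (b₃ w hwN v hv').mpr hw⟩
  have c₂ : m₃.arr .set = m₂.arr .set := exec_arr N _ (by decide) _ _
  set m₄ := exec N (someW .better (.and (.atom .set .o .w .o) (.not (.atom .asg .o .w .o)))) e m₃
    with hm₄
  have d₁ : (Cond.atom .better .o .o .o).eval e m₄ = true ↔
      ∃ v < N, (grow N E (e .v₀) (e .i₀) x).2 v ∧ x v = none := by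
    rw [Cond.eval, ho, hm₄, exec_someW ho (by decide) (by omega) (by omega)]
    refine exists_congr fun v => and_congr_right fun hv' => ?_
    have h₁ := c₁ v hv'
    have h₂ := b₂ v hv'
    rw [← c₂] at h₂
    simp only [Cond.eval, Bool.and_eq_true, Bool.not_eq_true']
    simp [ho, ← Bool.not_eq_true, h₁, h₂]
  by_cases hb : ∃ v < N, (grow N E (e .v₀) (e .i₀) x).2 v ∧ x v = none
  · rw [if_pos (d₁.mpr hb), improve, if_pos ⟨hf, hb⟩]
    intro i hi v hv
    have k₁ : m₄.arr .new = m₃.arr .new := exec_arr N _ (by decide) _ _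
    have k₂ : m₃.arr .new = m₂.arr .new := exec_arr N _ (by decide) _ _
    rw [exec_tabulate ho (by decide) hi hv, ← b₁ i hi v hv]
    simp [Cond.eval, ho, k₁, k₂]
  · rw [if_neg (mt d₁.mp hb), improve, if_neg (fun h => hb h.2)]
    have k₁ : m₄.arr .cur = m₃.arr .cur := exec_arr N _ (by decide) _ _
    have k₂ : m₃.arr .cur = m₂.arr .cur := exec_arr N _ (by decide) _ _
    exact b₃.congr (k₁.trans k₂)

theorem exec_optProg (hE : IsMatching N E) {e : Var → ℕ} {m : Mem Arr} (ho : e .o = 0)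
    (hm : HasArcs N E m) (hcur : ∀ i v, m.arr .cur i v 0 = false)
    (hasg : ∀ v, m.arr .asg 0 v 0 = false) :
    Shows N (exec N optProg e m) .cur (opt N E) := by
  simp only [optProg, exec_seq]
  obtain ⟨h₁, h₂⟩ := exec_prepare hE ho hm
  have h₃ := exec_startProg ho h₂
    (fun i v => by rw [exec_arr N prepare (by decide)]; exact hcur i v)
    (fun v => by rw [exec_arr N prepare (by decide)]; exact hasg v)
  have h₄ := (hm.exec prepare (by decide) e).exec startProg (by decide) e
  have h₅ := h₁.exec startProg (by decide) e
  have key : ∀ x, OptInv E x → ∀ v i, x v = some i → i < N := fun x hx v i h =>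
    ((hx.1.usable h).lt hE).1
  -- The abstract invariant is carried along with the simulation because it bounds the agents that
  -- occur in the assignment.
  refine And.right (And.right (And.left (loop_simulation
    (fun m x => ShowsOpt N E m x ∧ OptInv E x) (fun _ => pass N E) ?_
    ⟨⟨h₄, h₅, h₃⟩, start_inv hE⟩)))
  intro n _ m x h
  refine loop_simulation (fun m x => ShowsOpt N E m x ∧ OptInv E x) _ ?_ h
  intro v hv m x h
  refine loop_simulation (fun m x => ShowsOpt N E m x ∧ OptInv E x) _ ?_ h
  intro i hi m x h
  refine ⟨?_, (progress_improve hE v i x h.2).1⟩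
  have := exec_improveProg hE (e := update (update (update e .r n) .v₀ v) .i₀ i) (m := m)
    (by simpa using ho) (by simpa using hv) (by simpa using hi) (key x h.2) h.1
  simpa using this

end MinSum


/-! ### Parsing the encoded instance. -/

namespace MinSum

open Function Classical Cmd ArcAssignment

variable {N : ℕ} {E : ℕ → ℕ → ℕ → Bool}

/-- Run `p` for those values of `x` for which the array `g` contains `true`. -/
def forAll (g : Arr) (x : Var) (p : Prog) : Prog := .loop x (.test g .o x .o p .skip)

/-- The array `g` represents the numbers below `n`. -/
def Counts (N : ℕ) (m : Mem Arr) (g : Arr) (n : ℕ) : Prop :=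
  ∀ v < N, m.arr g 0 v 0 = decide (v < n)

theorem Counts.congr {m m' : Mem Arr} {g : Arr} {n : ℕ} (h : Counts N m g n)
    (hm : m'.arr g = m.arr g) : Counts N m' g n := by
  intro v hv
  rw [hm]
  exact h v hv

/-- The loop has N rounds, of which those from n on do nothing; hence `min t n` in the invariant. -/
theorem forAll_induction {g : Arr} {x : Var} {p : Prog} {e : Var → ℕ} {m : Mem Arr} {n : ℕ}
    (hx : x ≠ .o) (ho : e .o = 0) (hn : n ≤ N) (hp : p.keeps g = true) (hg : Counts N m g n)
    (I : ℕ → Mem Arr → Prop) (h₀ : I 0 m)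
    (h : ∀ i < n, ∀ m', (∀ b, p.keeps b = true → m'.arr b = m.arr b) → I i m' →
      I (i + 1) (exec N p (update e x i) m')) :
    I n (exec N (forAll g x p) e m) := by
  have key := loop_induction (N := N) (x := x) (e := e) (m := m) (p := .test g .o x .o p .skip)
    (fun t m' => (∀ b, p.keeps b = true → m'.arr b = m.arr b) ∧ I (min t n) m')
    ⟨fun _ _ => rfl, by simpa using h₀⟩ (by
      rintro t ht m' ⟨h₁, h₂⟩
      have hgt : m'.arr g ((update e x t) .o) ((update e x t) x) ((update e x t) .o) =
          decide (t < n) := by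
        rw [update_of_ne hx.symm, update_self, ho, h₁ g hp, hg t ht]
      rw [exec, hgt]
      by_cases htn : t < n
      · rw [if_pos (by simpa using htn)]
        refine ⟨fun b hb => (exec_arr N p hb _ _).trans (h₁ b hb), ?_⟩
        rw [min_eq_left (by omega)] at h₂ ⊢
        exact h t htn m' h₁ h₂
      · rw [if_neg (by simpa using htn)]
        refine ⟨h₁, ?_⟩
        rw [min_eq_right (by omega)] at h₂ ⊢
        exact h₂)
  have := key.2
  rwa [min_eq_right hn] at this

/-- Read a number in unary. -/
def unary (g : Arr) : Prog :=
  .loop .v (.test .done .o .o .o .skip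
    (.read (.write .done .o .o .o true) .skip (.write g .o .v .o true)))

/-- Read an instance. -/
def parse : Prog :=
  .seq (unary .item) (.seq (.write .done .o .o .o false) (.seq (unary .agent)
    (forAll .agent .i (.seq (forAll .item .v (.read .skip .skip .skip))
      (forAll .item .a (forAll .item .b (.read .skip .skip (.write .arc .i .a .b true))))))))

/-- Round n consumes the separator and sets `done`, which disables the remaining rounds. Strictness
of n < N guarantees that this round takes place. -/
theorem exec_unary {g : Arr} (hg : g ≠ .done) {e : Var → ℕ} {m : Mem Arr} (ho : e .o = 0) {n : ℕ}
    (hn : n < N) {w : List (Option Bool)} (hd : m.arr .done 0 0 0 = false)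
    (hinp : m.inp = List.replicate n (some true) ++ none :: w)
    (hm : ∀ v, m.arr g 0 v 0 = false) :
    (exec N (unary g) e m).inp = w ∧ Counts N (exec N (unary g) e m) g n := by
  have key := loop_induction (N := N) (x := .v) (e := e) (m := m)
    (p := .test .done .o .o .o .skip
      (.read (.write .done .o .o .o true) .skip (.write g .o .v .o true)))
    (fun t m' => (∀ v, m'.arr g 0 v 0 = decide (v < min t n)) ∧
      m'.arr .done 0 0 0 = decide (n < t) ∧
      m'.inp = if t ≤ n then List.replicate (n - t) (some true) ++ none :: w else w)
    ⟨by simpa using hm, by simpa using hd, by simpa using hinp⟩ (by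
      rintro t - m' ⟨h₁, h₂, h₃⟩
      have hdt : m'.arr .done ((update e .v t) .o) ((update e .v t) .o) ((update e .v t) .o) =
          decide (n < t) := by
        simp [ho, h₂]
      rw [exec, hdt]
      rcases lt_trichotomy n t with hnt | rfl | hnt
      · rw [if_pos (by simpa using hnt)]
        rw [min_eq_right (by omega)] at h₁
        rw [if_neg (by omega)] at h₃
        refine ⟨fun v => ?_, ?_, ?_⟩
        · rw [min_eq_right (by omega)]
          exact h₁ v
        · rw [exec, h₂]
          simp [hnt, Nat.lt_succ_of_lt hnt]
        · rw [if_neg (by omega)]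
          exact h₃
      · rw [if_neg (by simp)]
        simp only [le_refl, if_true, Nat.sub_self, List.replicate_zero, List.nil_append] at h₃
        simp only [exec, h₃, List.tail_cons]
        refine ⟨fun v => ?_, ?_, ?_⟩
        · rw [write_apply, if_neg (by tauto), min_eq_right (by omega)]
          simpa using h₁ v
        · simp [write_apply, ho]
        · simp [Mem.write]
      · rw [if_neg (by simp; omega)]
        have hr : n - t = (n - (t + 1)) + 1 := by omega
        rw [if_pos (by omega), hr, List.replicate_succ] at h₃
        simp only [exec, h₃, List.cons_append]
        refine ⟨fun v => ?_, ?_, ?_⟩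
        · rw [min_eq_left (by omega)] at h₁ ⊢
          by_cases hv : v = t
          · simp [write_apply, ho, hv]
          · have : v < t + 1 ↔ v < t := by omega
            simp [write_apply, ho, hv, h₁ v, this]
        · have : ¬ n < t + 1 := by omega
          rw [write_apply, if_neg (fun h => hg h.1.symm), h₂]
          simp [this, hnt.le]
        · rw [if_pos (by omega)]
          simp [Mem.write])
  obtain ⟨h₁, h₂, h₃⟩ := key
  rw [if_neg (by omega)] at h₃
  rw [min_eq_right (by omega)] at h₁
  exact ⟨h₃, fun v _ => h₁ v⟩

theorem range'_sub {t n : ℕ} (h : t < n) :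
    List.range' t (n - t) = t :: List.range' (t + 1) (n - (t + 1)) := by
  rw [show n - t = (n - (t + 1)) + 1 by omega, List.range'_succ]

/-- The encoding of the graph of one agent, as read by the program. -/
def graphCode (n : ℕ) (s : ℕ → Bool) (E : ℕ → ℕ → Bool) : List (Option Bool) :=
  (List.range n).map (fun v => some (s v)) ++
    (List.range n).flatMap fun u => (List.range n).map fun v => some (E u v)

/-- The membership vector may be ignored: in a directed matching the vertices are the ends of the
arcs. -/
theorem exec_skipBits {e : Var → ℕ} {m : Mem Arr} (ho : e .o = 0) {n : ℕ} (hn : n ≤ N)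
    (hm : Counts N m .item n) {s : ℕ → Bool} {w : List (Option Bool)}
    (hw : m.inp = (List.range n).map (fun v => some (s v)) ++ w) :
    (exec N (forAll .item .v (.read .skip .skip .skip)) e m).inp = w := by
  have key := forAll_induction (by decide) ho hn (p := .read .skip .skip .skip) (by decide) hm
    (fun t m' => m'.inp = (List.range' t (n - t)).map (fun v => some (s v)) ++ w)
    (x := .v) (by simpa [List.range_eq_range'] using hw) (by
      intro t ht m' _ h
      rw [range'_sub ht, List.map_cons, List.cons_append] at h
      simp only [exec, h]
      cases s t <;> rfl)
  simpa using key

/-- At any time the array holds the arcs that precede the current position in the lexicographic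
order of agent, tail and head. -/
theorem exec_parseRow {e : Var → ℕ} {m : Mem Arr} (ho : e .o = 0) {n : ℕ} (hn : n ≤ N)
    (hm : Counts N m .item n) (hE : ∀ i u v, E i u v = true → v < n)
    {w : List (Option Bool)}
    (hw : m.inp = (List.range n).map (fun v => some (E (e .i) (e .a) v)) ++ w)
    (harc : ∀ i u v, m.arr .arc i u v =
      (E i u v && decide (i < e .i ∨ i = e .i ∧ u < e .a))) :
    (exec N (forAll .item .b (.read .skip .skip (.write .arc .i .a .b true))) e m).inp = w ∧
    ∀ i u v, (exec N (forAll .item .b (.read .skip .skip (.write .arc .i .a .b true))) e m).arr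
      .arc i u v = (E i u v && decide (i < e .i ∨ i = e .i ∧ u < e .a + 1)) := by
  have key := forAll_induction (by decide) ho hn
    (p := .read .skip .skip (.write .arc .i .a .b true)) (by decide) hm (x := .b)
    (fun t m' => m'.inp = (List.range' t (n - t)).map (fun v => some (E (e .i) (e .a) v)) ++ w ∧
      ∀ i u v, m'.arr .arc i u v =
        (E i u v && decide (i < e .i ∨ i = e .i ∧ (u < e .a ∨ u = e .a ∧ v < t))))
    ⟨by simpa [List.range_eq_range'] using hw, by simpa using harc⟩ (by
      rintro t ht m' - ⟨h, h'⟩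
      rw [range'_sub ht, List.map_cons, List.cons_append] at h
      cases hEt : E (e .i) (e .a) t
      · rw [hEt] at h
        simp only [exec, h]
        refine ⟨trivial, fun i u v => ?_⟩
        rw [h']
        by_cases hiuv : i = e .i ∧ u = e .a ∧ v = t
        · obtain ⟨rfl, rfl, rfl⟩ := hiuv
          simp [hEt]
        · congr 2
          refine propext ?_
          omega
      · rw [hEt] at h
        simp only [exec, h]
        refine ⟨by simp [Mem.write], fun i u v => ?_⟩
        by_cases hiuv : i = e .i ∧ u = e .a ∧ v = t
        · obtain ⟨rfl, rfl, rfl⟩ := hiuv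
          simp [hEt, write_apply]
        · rw [write_apply, if_neg (by simpa using hiuv)]
          simp only [h']
          congr 2
          refine propext ?_
          omega)
  refine ⟨by simpa using key.1, fun i u v => ?_⟩
  rw [key.2]
  by_cases hv : v < n
  · congr 2
    refine propext ?_
    omega
  · have : E i u v = false := by
      rw [← Bool.not_eq_true]
      exact fun h => hv (hE i u v h)
    simp [this]

theorem exec_parseGraph {e : Var → ℕ} {m : Mem Arr} (ho : e .o = 0) {n : ℕ} (hn : n ≤ N)
    (hm : Counts N m .item n) (hE : ∀ i u v, E i u v = true → u < n ∧ v < n) {s : ℕ → Bool}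
    {w : List (Option Bool)} (hw : m.inp = graphCode n s (E (e .i)) ++ w)
    (harc : ∀ i u v, m.arr .arc i u v = (E i u v && decide (i < e .i))) :
    (exec N (.seq (forAll .item .v (.read .skip .skip .skip))
      (forAll .item .a (forAll .item .b (.read .skip .skip (.write .arc .i .a .b true))))) e m).inp
        = w ∧
    ∀ i u v, (exec N (.seq (forAll .item .v (.read .skip .skip .skip))
      (forAll .item .a (forAll .item .b (.read .skip .skip (.write .arc .i .a .b true))))) e m).arr
      .arc i u v = (E i u v && decide (i < e .i + 1)) := by
  rw [exec_seq]
  rw [graphCode, List.append_assoc] at hw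
  have h₁ := exec_skipBits ho hn hm hw
  set m₁ := exec N (forAll .item .v (.read .skip .skip .skip)) e m with hm₁
  have k₁ : m₁.arr .item = m.arr .item := exec_arr N _ (by decide) _ _
  have k₂ : m₁.arr .arc = m.arr .arc := exec_arr N _ (by decide) _ _
  have key := forAll_induction (by decide) ho hn
    (p := forAll .item .b (.read .skip .skip (.write .arc .i .a .b true))) (by decide)
    (hm.congr k₁) (x := .a)
    (fun t m' => m'.inp = ((List.range' t (n - t)).flatMap
        fun u => (List.range n).map fun v => some (E (e .i) u v)) ++ w ∧
      ∀ i u v, m'.arr .arc i u v = (E i u v && decide (i < e .i ∨ i = e .i ∧ u < t)))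
    ⟨by simpa [List.range_eq_range'] using h₁, by simpa [k₂] using harc⟩ (by
      rintro t ht m' hk ⟨h, h'⟩
      rw [range'_sub ht, List.flatMap_cons, List.append_assoc] at h
      have := exec_parseRow (N := N) (E := E) (e := update e .a t) (m := m') (by simpa using ho) hn
        ((hm.congr k₁).congr (hk .item (by decide))) (fun i u v h => (hE i u v h).2)
        (by simpa using h) (by simpa using h')
      simpa using this)
  refine ⟨by simpa using key.1, fun i u v => ?_⟩
  rw [key.2]
  by_cases hu : u < n
  · congr 2
    refine propext ?_
    omega
  · have : E i u v = false := by
      rw [← Bool.not_eq_true]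
      exact fun h => hu (hE i u v h).1
    simp [this]

theorem exec_parse {e : Var → ℕ} (ho : e .o = 0) {n k : ℕ} (hn : n < N)
    (hk : k < N) (hE : ∀ i u v, E i u v = true → i < k ∧ u < n ∧ v < n) {s : ℕ → ℕ → Bool}
    {w : List (Option Bool)} :
    let m := exec N parse e (initMem Arr (List.replicate n (some true) ++ none ::
      (List.replicate k (some true) ++ none ::
        ((List.range k).flatMap fun i => graphCode n (s i) (E i)) ++ w)))
    m.inp = w ∧ Counts N m .item n ∧ Counts N m .agent k ∧ HasArcs N E m := by
  intro m
  simp only [m, parse, exec_seq]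
  set m₀ := initMem Arr (List.replicate n (some true) ++ none ::
      (List.replicate k (some true) ++ none ::
        ((List.range k).flatMap fun i => graphCode n (s i) (E i)) ++ w)) with hm₀
  obtain ⟨a₁, a₂⟩ := exec_unary (N := N) (g := .item) (m := m₀) (by decide) ho hn rfl rfl
    (fun _ => rfl)
  set m₁ := exec N (unary .item) e m₀ with hm₁
  set m₂ := exec N (.write .done .o .o .o false) e m₁ with hm₂
  have k₁ : m₁.arr .agent = m₀.arr .agent := exec_arr N _ (by decide) _ _
  have k₂ : m₂.arr .agent = m₁.arr .agent := exec_arr N _ (by decide) _ _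
  obtain ⟨b₁, b₂⟩ := exec_unary (N := N) (g := .agent) (m := m₂) (e := e)
    (w := ((List.range k).flatMap fun i => graphCode n (s i) (E i)) ++ w) (by decide) ho hk
    (by simp [hm₂, exec, write_apply, ho]) (by simpa [hm₂, exec, Mem.write] using a₁)
    (fun _ => by rw [k₂, k₁]; rfl)
  set m₃ := exec N (unary .agent) e m₂ with hm₃
  have k₃ : m₃.arr .item = m₂.arr .item := exec_arr N _ (by decide) _ _
  have k₄ : m₂.arr .item = m₁.arr .item := exec_arr N _ (by decide) _ _
  have k₅ : m₃.arr .arc = m₂.arr .arc := exec_arr N _ (by decide) _ _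
  have k₆ : m₂.arr .arc = m₁.arr .arc := exec_arr N _ (by decide) _ _
  have k₇ : m₁.arr .arc = m₀.arr .arc := exec_arr N _ (by decide) _ _
  have c := a₂.congr (k₃.trans k₄)
  have key := forAll_induction (by decide) ho hk.le
    (p := .seq (forAll .item .v (.read .skip .skip .skip))
      (forAll .item .a (forAll .item .b (.read .skip .skip (.write .arc .i .a .b true)))))
    (by decide) b₂ (x := .i)
    (fun t m' => m'.inp = ((List.range' t (k - t)).flatMap fun i => graphCode n (s i) (E i)) ++ w ∧
      ∀ i u v, m'.arr .arc i u v = (E i u v && decide (i < t)))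
    ⟨by simpa [List.range_eq_range'] using b₁, fun i u v => by rw [k₅, k₆, k₇]; simp [hm₀, initMem]⟩
    (by
      rintro t ht m' hk' ⟨h, h'⟩
      rw [range'_sub ht, List.flatMap_cons, List.append_assoc] at h
      have := exec_parseGraph (N := N) (E := E) (e := update e .i t) (m := m') (by simpa using ho)
        hn.le (c.congr (hk' .item (by decide))) (fun i u v h => (hE i u v h).2)
        (by simpa using h) (by simpa using h')
      simpa using this)
  refine ⟨by simpa using key.1, c.congr (exec_arr N _ (by decide) _ _),
    b₂.congr (exec_arr N _ (by decide) _ _), fun i _ u _ v _ => ?_⟩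
  rw [key.2]
  by_cases hi : i < k
  · simp [hi]
  · have : E i u v = false := by
      rw [← Bool.not_eq_true]
      exact fun h => hi (hE i u v h).1
    simp [this]

end MinSum


namespace MinSum

open Function Classical Cmd ArcAssignment

variable {N : ℕ} {E : ℕ → ℕ → ℕ → Bool}

/-! ### The computation of an optimal allocation -/

/-- Write down the current assignment. -/
def printProg : Prog :=
  forAll .agent .i (forAll .item .v (.test .cur .i .v .o (.emit true) (.emit false)))

theorem exec_printProg {e : Var → ℕ} {m : Mem Arr} (ho : e .o = 0) {n k : ℕ} (hn : n ≤ N)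
    (hk : k ≤ N) (h₁ : Counts N m .item n) (h₂ : Counts N m .agent k) {x : ℕ → Option ℕ}
    (hx : Shows N m .cur x) :
    (exec N printProg e m).out = m.out ++
      (List.range k).flatMap fun i => (List.range n).map fun v => decide (x v = some i) := by
  refine forAll_induction (by decide) ho hk (by decide) h₂
    (fun t m' => m'.out = m.out ++
      (List.range t).flatMap fun i => (List.range n).map fun v => decide (x v = some i))
    (by simp) ?_
  intro i hi m₁ hm₁ h
  have key := forAll_induction (x := .v) (e := update e .i i)
    (p := .test .cur .i .v .o (.emit true) (.emit false)) (by decide) (by simpa using ho) hn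
    (by decide) (h₁.congr (hm₁ .item (by decide)))
    (fun t m' => m'.out = m₁.out ++ (List.range t).map fun v => decide (x v = some i))
    (by simp) (by
      intro v hv m₂ hm₂ h
      have hc := hx i (by omega) v (by omega)
      rw [← hm₁ .cur (by decide), ← hm₂ .cur (by decide)] at hc
      rw [List.range_succ, List.map_append, ← List.append_assoc, ← h]
      by_cases hxv : x v = some i
      · simp [exec, ho, hc.mpr hxv, hxv]
      · simp [exec, ho, mt hc.mp hxv, hxv])
  rw [List.range_succ, List.flatMap_append, ← List.append_assoc, ← h]
  simpa using key

/-- Compute an optimal assignment. -/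
def searchProg : Prog := .seq parse (.seq optProg printProg)

/-- The input of the program. -/
def code (n k : ℕ) (s : ℕ → ℕ → Bool) (E : ℕ → ℕ → ℕ → Bool) (w : List (Option Bool)) :
    List (Option Bool) :=
  List.replicate n (some true) ++ none :: (List.replicate k (some true) ++ none ::
    ((List.range k).flatMap fun i => graphCode n (s i) (E i)) ++ w)

/-- The two separators make the numbers of items and agents strictly smaller than the length of the
input. -/
theorem length_code (n k : ℕ) (s : ℕ → ℕ → Bool) (E : ℕ → ℕ → ℕ → Bool) (w : List (Option Bool)) :
    n + k + 2 + w.length ≤ (code n k s E w).length := by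
  simp only [code, List.length_append, List.length_cons, List.length_replicate]
  omega

theorem exec_opt (hE : IsMatching N E) {e : Var → ℕ} (ho : e .o = 0) {n k : ℕ} (hn : n < N)
    (hk : k < N) (hlt : ∀ i u v, E i u v = true → i < k ∧ u < n ∧ v < n) {s : ℕ → ℕ → Bool}
    {w : List (Option Bool)} :
    let m := exec N optProg e (exec N parse e (initMem Arr (code n k s E w)))
    m.inp = w ∧ Counts N m .item n ∧ Counts N m .agent k ∧ HasArcs N E m ∧
      Shows N m .cur (opt N E) ∧ m.out = [] := by
  intro m
  obtain ⟨h₁, h₂, h₃, h₄⟩ := exec_parse (N := N) (s := s) (w := w) ho hn hk hlt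
  refine ⟨(exec_inp N _ (by decide) _ _).trans h₁, h₂.congr (exec_arr N _ (by decide) _ _),
    h₃.congr (exec_arr N _ (by decide) _ _), h₄.exec _ (by decide) _, ?_, ?_⟩
  · refine exec_optProg hE ho h₄ (fun i v => ?_) (fun v => ?_)
    · rw [exec_arr N parse (by decide)]
      rfl
    · rw [exec_arr N parse (by decide)]
      rfl
  · refine (exec_out N _ (by decide) _ _).trans ?_
    exact exec_out N _ (by decide) _ _

theorem exec_searchProg (hE : IsMatching N E) {e : Var → ℕ} (ho : e .o = 0) {n k : ℕ} (hn : n < N)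
    (hk : k < N) (hlt : ∀ i u v, E i u v = true → i < k ∧ u < n ∧ v < n) {s : ℕ → ℕ → Bool} :
    (exec N searchProg e (initMem Arr (code n k s E []))).out =
      (List.range k).flatMap fun i => (List.range n).map fun v => decide (opt N E v = some i) := by
  obtain ⟨-, h₂, h₃, -, h₅, h₆⟩ := exec_opt hE ho hn hk hlt (s := s) (w := [])
  rw [searchProg, exec_seq, exec_seq, exec_printProg ho hn.le hk.le h₂ h₃ h₅, h₆, List.nil_append]

/-! ### The decision problem -/

/-- The number with the binary digits of the array `digit`. -/
def val (n : ℕ) (m : Mem Arr) : ℕ := ∑ v ∈ Finset.range n, 2 ^ v * (m.arr .digit 0 v 0).toNat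

theorem val_lt (n : ℕ) (m : Mem Arr) : val n m < 2 ^ n := by
  induction n with
  | zero => simp [val]
  | succ n ih =>
    have : (m.arr .digit 0 n 0).toNat ≤ 1 := Bool.toNat_le _
    have := Nat.mul_le_mul_left (2 ^ n) this
    have heq : val (n + 1) m = val n m + 2 ^ n * (m.arr .digit 0 n 0).toNat :=
      Finset.sum_range_succ _ _
    rw [heq, pow_succ]
    omega

/-- Subtract one from the number in `digit`; if this is impossible, the result is negative. -/
def decProg : Prog :=
  .seq (.write .borrow .o .o .o true)
    (.seq (.loop .v (branch (.atom .borrow .o .o .o)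
      (.test .digit .o .v .o
        (.seq (.write .digit .o .v .o false) (.write .borrow .o .o .o false))
        (.write .digit .o .v .o true)) .skip))
      (branch (.atom .borrow .o .o .o) (.write .neg .o .o .o true) .skip))

/-- The number `d - c`, whose sign is `neg`, is what remains of `d`. -/
def Remains (N : ℕ) (d : ℤ) (m : Mem Arr) (c : ℕ) : Prop :=
  (m.arr .neg 0 0 0 = true ↔ d < c) ∧ ((c : ℤ) ≤ d → (val N m + c : ℤ) = d)

/-- The borrow runs through all N digits. If it survives, the number was 0 and the result is
negative. The sign, once set, is never cleared, and the digits are meaningless from then on. -/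
theorem exec_decProg {e : Var → ℕ} (ho : e .o = 0) {d : ℤ} {m : Mem Arr} {c : ℕ}
    (h : Remains N d m c) : Remains N d (exec N decProg e m) (c + 1) := by
  simp only [decProg, exec_seq]
  set m₁ := exec N (.write .borrow .o .o .o true) e m with hm₁
  have k₁ : m₁.arr .digit = m.arr .digit := exec_arr N _ (by decide) _ _
  have k₂ : m₁.arr .neg = m.arr .neg := exec_arr N _ (by decide) _ _
  have key := loop_induction (N := N) (x := .v) (e := e) (m := m₁)
    (p := branch (.atom .borrow .o .o .o)
      (.test .digit .o .v .o
        (.seq (.write .digit .o .v .o false) (.write .borrow .o .o .o false))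
        (.write .digit .o .v .o true)) .skip)
    -- The lowest t digits have been decreased by one, up to a borrow of 2 ^ t that is still to be
    -- taken from the higher ones.
    (fun t m' => (∀ v, t ≤ v → m'.arr .digit 0 v 0 = m.arr .digit 0 v 0) ∧
      val t m' + 1 = val t m + 2 ^ t * (m'.arr .borrow 0 0 0).toNat)
    ⟨fun v _ => by rw [k₁], by simp [val, hm₁, exec, write_apply, ho]⟩ (by
      rintro t - m' ⟨h₁, h₂⟩
      have hs : ∀ m : Mem Arr, val (t + 1) m = val t m + 2 ^ t * (m.arr .digit 0 t 0).toNat :=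
        fun m => Finset.sum_range_succ _ _
      have hc : ∀ m'' : Mem Arr, (∀ v, v ≠ t → m''.arr .digit 0 v 0 = m'.arr .digit 0 v 0) →
          (∀ v, t + 1 ≤ v → m''.arr .digit 0 v 0 = m.arr .digit 0 v 0) ∧ val t m'' = val t m' := by
        intro m'' h
        refine ⟨fun v hv => (h v (by omega)).trans (h₁ v (by omega)),
          Finset.sum_congr rfl fun v hv => ?_⟩
        rw [h v (Finset.mem_range.mp hv).ne]
      rw [exec_branch]
      have hb : (Cond.atom Arr.borrow Var.o .o .o).eval (update e .v t) m' =
          m'.arr .borrow 0 0 0 := by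
        simp [Cond.eval, ho]
      have ht := h₁ t le_rfl
      rw [hb]
      cases hbor : m'.arr .borrow 0 0 0
      · rw [if_neg (by simp)]
        obtain ⟨r₁, -⟩ := hc m' fun _ _ => rfl
        refine ⟨r₁, ?_⟩
        rw [exec, hs, hs, ht]
        rw [hbor] at h₂ ⊢
        simp only [Bool.toNat_false, mul_zero] at h₂ ⊢
        omega
      · rw [if_pos rfl]
        rw [hbor] at h₂
        simp only [Bool.toNat_true, mul_one] at h₂
        cases hdig : m'.arr .digit 0 t 0
        · have hx : exec N (.test .digit .o .v .o
              (.seq (.write .digit .o .v .o false) (.write .borrow .o .o .o false))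
              (.write .digit .o .v .o true)) (update e .v t) m' = m'.write .digit 0 t 0 true := by
            simp [exec, ho, hdig]
          rw [hx]
          obtain ⟨r₁, r₂⟩ := hc (m'.write .digit 0 t 0 true) fun v hv => by
            simp [write_apply, hv]
          refine ⟨r₁, ?_⟩
          rw [hs, hs, r₂, ← ht, hdig, write_same, write_apply, if_neg (by simp), hbor]
          simp only [Bool.toNat_true, Bool.toNat_false, mul_one, mul_zero, pow_succ]
          omega
        · have hx : exec N (.test .digit .o .v .o
              (.seq (.write .digit .o .v .o false) (.write .borrow .o .o .o false))
              (.write .digit .o .v .o true)) (update e .v t) m' =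
                (m'.write .digit 0 t 0 false).write .borrow 0 0 0 false := by
            simp [exec, ho, hdig]
          rw [hx]
          obtain ⟨r₁, r₂⟩ := hc ((m'.write .digit 0 t 0 false).write .borrow 0 0 0 false)
            fun v hv => by simp [write_apply, hv]
          refine ⟨r₁, ?_⟩
          rw [hs, hs, r₂, ← ht, hdig, write_same, write_apply, if_neg (by simp), write_same]
          simp only [Bool.toNat_true, Bool.toNat_false, mul_one, mul_zero]
          omega)
  set m₂ := exec N (.loop .v (branch (.atom .borrow .o .o .o)
      (.test .digit .o .v .o
        (.seq (.write .digit .o .v .o false) (.write .borrow .o .o .o false))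
        (.write .digit .o .v .o true)) .skip)) e m₁ with hm₂
  have k₃ : m₂.arr .neg = m₁.arr .neg := exec_arr N _ (by decide) _ _
  obtain ⟨-, hv⟩ := key
  have hlt := val_lt N m₂
  have hb : (Cond.atom Arr.borrow Var.o .o .o).eval e m₂ = m₂.arr .borrow 0 0 0 := by
    simp [Cond.eval, ho]
  obtain ⟨h₁, h₂⟩ := h
  rw [exec_branch, hb]
  cases hbor : m₂.arr .borrow 0 0 0
  · rw [hbor] at hv
    simp only [Bool.toNat_false, mul_zero] at hv
    rw [if_neg (by simp)]
    refine ⟨?_, fun hc => ?_⟩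
    · rw [exec, k₃, k₂, h₁]
      push_cast
      constructor
      · intro h; omega
      · intro h
        by_contra hcon
        have := h₂ (by omega)
        omega
    · have := h₂ (by push_cast at hc; omega)
      rw [exec]
      push_cast
      omega
  · rw [hbor] at hv
    simp only [Bool.toNat_true, mul_one] at hv
    rw [if_pos rfl]
    -- A surviving borrow means that the new value is the old one minus 1 plus 2 ^ N; as it is below
    -- 2 ^ N, the old value was 0.
    have hd : d < (c : ℤ) + 1 := by
      by_contra hcon
      have := h₂ (by omega)
      omega
    refine ⟨?_, fun hc => ?_⟩
    · push_cast
      simp [exec, write_apply, ho, hd]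
    · push_cast at hc
      omega

/-- Subtract the dissatisfaction caused by one arc. -/
def arcProg : Prog :=
  .test .arc .i .a .b
    (.test .cur .i .a .o .skip (.seq decProg (.test .cur .i .b .o .skip decProg))) .skip

/-- Subtract the total dissatisfaction. -/
def payProg : Prog := .loop .i (.loop .a (.loop .b arcProg))

/-- The state while the dissatisfaction is subtracted. -/
def Paying (N : ℕ) (E : ℕ → ℕ → ℕ → Bool) (x : ℕ → Option ℕ) (d : ℤ) (m : Mem Arr) (c : ℕ) : Prop :=
  HasArcs N E m ∧ Shows N m .cur x ∧ Remains N d m c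

theorem exec_arcProg {e : Var → ℕ} (ho : e .o = 0) (hi : e .i < N) (ha : e .a < N) (hb : e .b < N)
    {x : ℕ → Option ℕ} {d : ℤ} {m : Mem Arr} {c : ℕ} (h : Paying N E x d m c) :
    Paying N E x d (exec N arcProg e m)
      (c + if E (e .i) (e .a) (e .b) = true then arcCost x (e .i) (e .a) (e .b) else 0) := by
  refine ⟨h.1.exec _ (by decide) _, h.2.1.congr (exec_arr N _ (by decide) _ _), ?_⟩
  obtain ⟨h₁, h₂, h₃⟩ := h
  have hE := h₁ _ hi _ ha _ hb
  have hxa := h₂ _ hi _ ha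
  have hxb := h₂ _ hi _ hb
  have k : (exec N decProg e m).arr .cur = m.arr .cur := exec_arr N _ (by decide) _ _
  rw [arcProg, exec, hE]
  cases E (e .i) (e .a) (e .b)
  · simpa [exec] using h₃
  · rw [if_pos rfl, if_pos rfl, exec, exec, exec, exec, ho, k, arcCost]
    by_cases h₄ : x (e .a) = some (e .i)
    · rw [if_pos (hxa.mpr h₄), if_pos h₄]
      simpa [exec] using h₃
    · rw [if_neg (mt hxa.mp h₄), if_neg h₄]
      have h₅ := exec_decProg ho h₃
      by_cases h₆ : x (e .b) = some (e .i)
      · rw [if_pos (hxb.mpr h₆), if_pos h₆]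
        simpa [exec] using h₅
      · rw [if_neg (mt hxb.mp h₆), if_neg h₆]
        exact exec_decProg ho h₅

theorem foldRange_add (n : ℕ) (f : ℕ → ℕ) (c : ℕ) :
    foldRange n (fun i c => c + f i) c = c + ∑ i ∈ Finset.range n, f i := by
  induction n with
  | zero => simp [foldRange]
  | succ n ih => rw [foldRange_succ, ih, Finset.sum_range_succ, add_assoc]

/-- The triple sum is rewritten as nested folds with an accumulator, to match the three loops. -/
theorem exec_payProg {e : Var → ℕ} (ho : e .o = 0) {x : ℕ → Option ℕ} {d : ℤ} {m : Mem Arr}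
    (h : Paying N E x d m 0) : Paying N E x d (exec N payProg e m) (cost N E x) := by
  have hc : cost N E x = foldRange N (fun i c => c + ∑ u ∈ Finset.range N, ∑ v ∈ Finset.range N,
      if E i u v = true then arcCost x i u v else 0) 0 := by
    rw [foldRange_add, zero_add, cost]
  rw [hc]
  refine loop_simulation (Paying N E x d) _ ?_ h
  intro i hi m c h
  rw [← foldRange_add]
  refine loop_simulation (Paying N E x d) _ ?_ h
  intro a ha m c h
  rw [← foldRange_add]
  refine loop_simulation (Paying N E x d) _ ?_ h
  intro b hb m c h
  have := exec_arcProg (e := update (update (update e .i i) .a a) .b b) (m := m)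
    (by simpa using ho) (by simpa using hi) (by simpa using ha) (by simpa using hb) h
  simpa using this

/-- Read an integer. -/
def readProg : Prog :=
  .seq (.read .skip .skip .skip) (.seq (.read .skip .skip (.write .neg .o .o .o true))
    (.loop .v (.read .skip .skip (.write .digit .o .v .o true))))

/-- Once the input is exhausted, `read` executes its first branch, so the digits from there on keep
their initial value 0. -/
theorem exec_readDigits {e : Var → ℕ} (ho : e .o = 0) {m : Mem Arr} {l : List Bool}
    (hm : m.inp = l.map some) (hd : ∀ v, m.arr .digit 0 v 0 = false) :
    ∀ v < N, (exec N (.loop .v (.read .skip .skip (.write .digit .o .v .o true))) e m).arr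
      .digit 0 v 0 = l.getD v false := by
  have key := loop_induction (N := N) (x := .v) (e := e) (m := m)
    (p := .read .skip .skip (.write .digit .o .v .o true))
    (fun t m' => m'.inp = (l.drop t).map some ∧
      ∀ v, m'.arr .digit 0 v 0 = (decide (v < t) && l.getD v false))
    ⟨by simpa using hm, by simpa using hd⟩ (by
      rintro t - m' ⟨h₁, h₂⟩
      have hs : ∀ v, v ≠ t → decide (v < t + 1) = decide (v < t) := by
        intro v hv
        congr 1
        exact propext (by omega)
      by_cases ht : t < l.length
      · rw [List.drop_eq_getElem_cons ht, List.map_cons] at h₁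
        have hg : l.getD t false = l[t] := List.getD_eq_getElem _ _ ht
        cases hlt : l[t]
        · rw [hlt] at h₁ hg
          simp only [exec, h₁]
          refine ⟨trivial, fun v => ?_⟩
          rw [h₂]
          by_cases hv : v = t
          · subst hv; simp [hlt, ht]
          · rw [hs v hv]
        · rw [hlt] at h₁ hg
          simp only [exec, h₁]
          refine ⟨by simp [Mem.write], fun v => ?_⟩
          by_cases hv : v = t
          · subst hv
            rw [hg]
            simp [write_apply, ho]
          · rw [write_apply, if_neg (by simp [hv]), hs v hv]
            exact h₂ v
      · rw [List.drop_eq_nil_of_le (by omega), List.map_nil] at h₁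
        simp only [exec, h₁]
        refine ⟨by rw [List.drop_eq_nil_of_le (by omega)]; rfl, fun v => ?_⟩
        rw [h₂]
        by_cases hv : v = t
        · subst hv
          rw [List.getD_eq_default _ _ (by omega)]
          simp
        · rw [hs v hv])
  intro v hv
  rw [key.2 v]
  simp [hv]

/-- The encoding starts with the least significant bit, so removing the first digit halves the
number. -/
theorem sum_encodePosNum (p : PosNum) : ∀ n, (Computability.encodePosNum p).length ≤ n →
    ∑ v ∈ Finset.range n, 2 ^ v * ((Computability.encodePosNum p).getD v false).toNat =
      (p : ℕ) := by
  induction p with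
  | one =>
    intro n hn
    obtain ⟨n, rfl⟩ : ∃ k, n = k + 1 := ⟨n - 1, by simp [Computability.encodePosNum] at hn; omega⟩
    rw [Finset.sum_range_succ']
    simp [Computability.encodePosNum]
  | bit0 p ih =>
    intro n hn
    simp only [Computability.encodePosNum, List.length_cons] at hn
    obtain ⟨n, rfl⟩ : ∃ k, n = k + 1 := ⟨n - 1, by omega⟩
    rw [Finset.sum_range_succ']
    simp only [Computability.encodePosNum, List.getD_cons_succ, List.getD_cons_zero, pow_succ',
      mul_assoc, ← Finset.mul_sum]
    rw [ih n (by omega), PosNum.cast_bit0]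
    simp
    omega
  | bit1 p ih =>
    intro n hn
    simp only [Computability.encodePosNum, List.length_cons] at hn
    obtain ⟨n, rfl⟩ : ∃ k, n = k + 1 := ⟨n - 1, by omega⟩
    rw [Finset.sum_range_succ']
    simp only [Computability.encodePosNum, List.getD_cons_succ, List.getD_cons_zero, pow_succ',
      mul_assoc, ← Finset.mul_sum]
    rw [ih n (by omega), PosNum.cast_bit1]
    simp
    omega

theorem sum_encodeNat (d n : ℕ) (hn : (Computability.encodeNat d).length ≤ n) :
    ∑ v ∈ Finset.range n, 2 ^ v * ((Computability.encodeNat d).getD v false).toNat = d := by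
  have hd : ((d : Num) : ℕ) = d := Num.to_of_nat d
  unfold Computability.encodeNat at hn ⊢
  generalize (d : Num) = p at hn hd ⊢
  subst hd
  cases p with
  | zero => simp [Computability.encodeNum]
  | pos p => exact sum_encodePosNum p n hn

theorem exec_readProg {e : Var → ℕ} (ho : e .o = 0) {m : Mem Arr} {d : ℤ}
    (hm : m.inp = none :: (Dissatisfaction.encodeInt d).map some)
    (hN : (Dissatisfaction.encodeInt d).length ≤ N) (hn : m.arr .neg 0 0 0 = false)
    (hd : ∀ v, m.arr .digit 0 v 0 = false) : Remains N d (exec N readProg e m) 0 := by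
  simp only [readProg, exec_seq]
  set m₁ := exec N (.read .skip .skip .skip) e m with hm₁
  have i₁ : m₁.inp = (Dissatisfaction.encodeInt d).map some := by simp [hm₁, exec, hm]
  have k₁ : m₁.arr .neg = m.arr .neg := exec_arr N _ (by decide) _ _
  have k₂ : m₁.arr .digit = m.arr .digit := exec_arr N _ (by decide) _ _
  set m₂ := exec N (.read .skip .skip (.write .neg .o .o .o true)) e m₁ with hm₂
  have k₃ : m₂.arr .digit = m₁.arr .digit := exec_arr N _ (by decide) _ _
  have i₂ : m₂.inp = (Computability.encodeNat d.natAbs).map some ∧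
      (m₂.arr .neg 0 0 0 = true ↔ d < 0) := by
    rw [Dissatisfaction.encodeInt, List.map_cons] at i₁
    by_cases hd : d < 0
    · rw [decide_eq_true hd] at i₁
      simp [hm₂, exec, i₁, Mem.write, ho, hd]
    · rw [decide_eq_false hd] at i₁
      simp [hm₂, exec, i₁, k₁, hn, hd]
  have h := exec_readDigits (N := N) ho i₂.1 (fun v => by rw [k₃, k₂]; exact hd v)
  refine ⟨?_, fun h0 => ?_⟩
  · rw [exec_arr (a := Arr.neg) N (.loop Var.v (.read .skip .skip (.write .digit .o .v .o true)))
      (by decide)]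
    simpa using i₂.2
  · have hv : val N (exec N (.loop .v (.read .skip .skip (.write .digit .o .v .o true))) e m₂) =
        d.natAbs := by
      rw [← sum_encodeNat d.natAbs N (by
        simp only [Dissatisfaction.encodeInt, List.length_cons] at hN; omega)]
      refine Finset.sum_congr rfl fun v hv => ?_
      rw [h v (Finset.mem_range.mp hv)]
    rw [hv]
    push_cast at h0 ⊢
    rw [add_zero]
    exact abs_of_nonneg h0

/-- Decide whether the optimal assignment is good enough. -/
def decideProg : Prog :=
  .seq parse (.seq optProg (.seq readProg (.seq payProg
    (.test .neg .o .o .o (.emit false) (.emit true)))))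

theorem exec_decideProg (hE : IsMatching N E) {e : Var → ℕ} (ho : e .o = 0) {n k : ℕ} (hn : n < N)
    (hk : k < N) (hlt : ∀ i u v, E i u v = true → i < k ∧ u < n ∧ v < n) {s : ℕ → ℕ → Bool}
    {d : ℤ} (hN : (Dissatisfaction.encodeInt d).length ≤ N) :
    (exec N decideProg e (initMem Arr
      (code n k s E (none :: (Dissatisfaction.encodeInt d).map some)))).out =
      [decide ((cost N E (opt N E) : ℤ) ≤ d)] := by
  obtain ⟨h₁, -, -, h₄, h₅, h₆⟩ := exec_opt hE ho hn hk hlt (s := s)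
    (w := none :: (Dissatisfaction.encodeInt d).map some)
  simp only [decideProg, exec_seq]
  set m₀ := initMem Arr (code n k s E (none :: (Dissatisfaction.encodeInt d).map some))
  set m₁ := exec N parse e m₀
  set m₂ := exec N optProg e m₁
  have h₇ : Remains N d (exec N readProg e m₂) 0 := by
    refine exec_readProg ho h₁ hN ?_ fun v => ?_
    · rw [exec_arr N optProg (by decide), exec_arr N parse (by decide)]
      rfl
    · rw [exec_arr N optProg (by decide), exec_arr N parse (by decide)]
      rfl
  have h₈ := exec_payProg (x := opt N E) ho
    ⟨h₄.exec readProg (by decide) e, h₅.congr (exec_arr N _ (by decide) _ _), h₇⟩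
  have ho₁ : (exec N payProg e (exec N readProg e m₂)).out = [] := by
    rw [exec_out N payProg (by decide), exec_out N readProg (by decide), h₆]
  have h₉ := h₈.2.2.1
  rw [exec, ho]
  by_cases hd : d < cost N E (opt N E)
  · rw [if_pos (h₉.mpr hd), exec, ho₁, decide_eq_false (by omega)]
    rfl
  · rw [if_neg (mt h₉.mp hd), exec, ho₁, decide_eq_true (by omega)]
    rfl

end MinSum


/-! ### Domination in directed matchings. -/

namespace Dissatisfaction

open Classical Cmd ArcAssignment MinSum

theorem ofFn_eq_map_range {α : Type} {n : ℕ} (f : Fin n → α) (g : ℕ → α)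
    (h : ∀ i : Fin n, f i = g i) : List.ofFn f = (List.range n).map g := by
  rw [List.ofFn_eq_map, ← List.map_coe_finRange_eq_range, List.map_map]
  exact List.map_congr_left fun i _ => h i

theorem sum_range_eq_sum_fin {n N : ℕ} (hn : n ≤ N) (f : ℕ → ℕ) (hf : ∀ v, n ≤ v → f v = 0) :
    ∑ v ∈ Finset.range N, f v = ∑ v : Fin n, f v := by
  rw [← Finset.sum_range f]
  refine (Finset.sum_subset (Finset.range_mono hn) fun v _ hv => hf v ?_).symm
  simpa using hv

namespace PrefGraph

variable {n : ℕ} {G : PrefGraph n}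

theorem IsDirectedMatching.unique (hG : G.IsDirectedMatching) {v : Fin n} {e e' : Fin n × Fin n}
    (he : e ∈ G.arcs) (he' : e' ∈ G.arcs) (h : e.1 = v ∨ e.2 = v) (h' : e'.1 = v ∨ e'.2 = v) :
    e = e' := by
  have hv : v ∈ G.verts := by
    rcases h with rfl | rfl
    · exact (G.arcs_mem e he).1
    · exact (G.arcs_mem e he).2
  exact Finset.card_le_one.mp (hG.2 v hv).le e (by simp [he, h]) e' (by simp [he', h'])

theorem Acyclic.ne (hG : G.Acyclic) {u v : Fin n} (h : G.Arc u v) : u ≠ v := by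
  rintro rfl
  exact hG u (.single h)

theorem Acyclic.asymm (hG : G.Acyclic) {u v : Fin n} (h : G.Arc u v) : ¬ G.Arc v u :=
  fun h' => hG u (.tail (.single h) h')

/-- A nontrivial path would end with an arc entering `u`. This would be the arc leaving `u`, hence a
loop. -/
theorem IsDirectedMatching.eq_of_path_to_tail (hG : G.IsDirectedMatching) {u v w : Fin n}
    (h : G.Arc u v) (hw : Relation.ReflTransGen G.Arc w u) : w = u := by
  rcases Relation.ReflTransGen.cases_tail hw with h' | ⟨c, -, hc⟩
  · exact h'.symm
  · have := hG.unique h hc (v := u) (.inl rfl) (.inr rfl)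
    rw [Prod.mk.injEq] at this
    exact absurd this.1.symm (hG.1.ne hc)

theorem IsDirectedMatching.dominated_tail (hG : G.IsDirectedMatching) {u v : Fin n}
    (h : G.Arc u v) (w : Fin n) : G.DominatedBy u w ↔ w = u := by
  have hu := (G.arcs_mem _ h).1
  constructor
  · rintro ⟨-, -, rfl | hp⟩
    · rfl
    · exact hG.eq_of_path_to_tail h hp.2
  · rintro rfl
    exact ⟨hu, hu, .inl rfl⟩

theorem IsDirectedMatching.dominated_head (hG : G.IsDirectedMatching) {u v : Fin n}
    (h : G.Arc u v) (w : Fin n) : G.DominatedBy v w ↔ w = u ∨ w = v := by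
  obtain ⟨hu, hv⟩ := G.arcs_mem _ h
  constructor
  · rintro ⟨-, -, rfl | hp⟩
    · exact .inr rfl
    · left
      rcases Relation.ReflTransGen.cases_tail hp.2 with h' | ⟨c, hwc, hc⟩
      · exact absurd h'.symm hp.1
      · have := hG.unique h hc (v := v) (.inr rfl) (.inr rfl)
        rw [Prod.mk.injEq] at this
        rw [← this.1] at hwc
        exact hG.eq_of_path_to_tail h hwc
  · rintro (rfl | rfl)
    · exact ⟨hv, hu, .inr ⟨hG.1.ne h, .single h⟩⟩
    · exact ⟨hv, hv, .inl rfl⟩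

/-- Double counting of incidences: each vertex lies on exactly one arc, and each arc has two
distinct ends. -/
theorem IsDirectedMatching.sum_verts (hG : G.IsDirectedMatching) (f : Fin n → ℕ) :
    ∑ u ∈ G.verts, f u = ∑ e ∈ G.arcs, (f e.1 + f e.2) := by
  have h₁ : ∀ u ∈ G.verts, f u = ∑ e ∈ G.arcs, if e.1 = u ∨ e.2 = u then f u else 0 := by
    intro u hu
    rw [← Finset.sum_filter, Finset.sum_const, smul_eq_mul]
    have := hG.2 u hu
    unfold degree at this
    convert (one_mul (f u)).symm
  rw [Finset.sum_congr rfl h₁, Finset.sum_comm]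
  refine Finset.sum_congr rfl fun e he => ?_
  have hne : e.1 ≠ e.2 := hG.1.ne he
  obtain ⟨hu, hv⟩ := G.arcs_mem e he
  have h₂ : ∀ u ∈ G.verts, (if e.1 = u ∨ e.2 = u then f u else 0) =
      (if e.1 = u then f u else 0) + if e.2 = u then f u else 0 := by
    intro u _
    by_cases h : e.1 = u
    · have : e.2 ≠ u := fun h' => hne (h.trans h'.symm)
      simp [h, this]
    · simp [h]
  rw [Finset.sum_congr rfl h₂, Finset.sum_add_distrib, Finset.sum_ite_eq, Finset.sum_ite_eq,
    if_pos hu, if_pos hv]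

end PrefGraph

/-! ### Instances as functions on natural numbers. -/

namespace Instance

/-- The arcs of an instance. -/
noncomputable def arcFn (I : Instance) (i u v : ℕ) : Bool :=
  if h : i < I.numAgents ∧ u < I.numItems ∧ v < I.numItems then
    decide ((⟨u, h.2.1⟩, ⟨v, h.2.2⟩) ∈ (I.graph ⟨i, h.1⟩).arcs) else false

/-- The vertices of an instance. -/
noncomputable def vertFn (I : Instance) (i v : ℕ) : Bool :=
  if h : i < I.numAgents ∧ v < I.numItems then
    decide (⟨v, h.2⟩ ∈ (I.graph ⟨i, h.1⟩).verts) else false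

variable (I : Instance)

theorem arcFn_coe (i : Fin I.numAgents) (u v : Fin I.numItems) :
    I.arcFn i u v = decide ((u, v) ∈ (I.graph i).arcs) := by
  simp [arcFn]

theorem vertFn_coe (i : Fin I.numAgents) (v : Fin I.numItems) :
    I.vertFn i v = decide (v ∈ (I.graph i).verts) := by
  simp [vertFn]

theorem arcFn_lt (i u v : ℕ) (h : I.arcFn i u v = true) :
    i < I.numAgents ∧ u < I.numItems ∧ v < I.numItems := by
  by_contra hn
  simp [arcFn, hn] at h

theorem exists_of_arcFn {i u v : ℕ} (h : I.arcFn i u v = true) :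
    ∃ (i' : Fin I.numAgents) (u' v' : Fin I.numItems), i = i' ∧ u = u' ∧ v = v' ∧
      (I.graph i').Arc u' v' := by
  obtain ⟨hi, hu, hv⟩ := I.arcFn_lt i u v h
  refine ⟨⟨i, hi⟩, ⟨u, hu⟩, ⟨v, hv⟩, rfl, rfl, rfl, ?_⟩
  have := I.arcFn_coe ⟨i, hi⟩ ⟨u, hu⟩ ⟨v, hv⟩
  rw [this, decide_eq_true_eq] at h
  exact h

theorem isMatching (hI : ∀ i, (I.graph i).IsDirectedMatching) {N : ℕ} (hn : I.numItems ≤ N)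
    (hk : I.numAgents ≤ N) : IsMatching N I.arcFn where
  lt h := by
    have := I.arcFn_lt _ _ _ h
    omega
  unique {i v w w'} h h' := by
    have key : ∀ {i v w : ℕ}, Mate I.arcFn i v w → ∃ (i' : Fin I.numAgents)
        (v' w' : Fin I.numItems), i = i' ∧ v = v' ∧ w = w' ∧
          ((v', w') ∈ (I.graph i').arcs ∨ (w', v') ∈ (I.graph i').arcs) := by
      rintro i v w (h | h)
      · obtain ⟨i', v', w', h₁, h₂, h₃, h₄⟩ := I.exists_of_arcFn h
        exact ⟨i', v', w', h₁, h₂, h₃, .inl h₄⟩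
      · obtain ⟨i', w', v', h₁, h₂, h₃, h₄⟩ := I.exists_of_arcFn h
        exact ⟨i', v', w', h₁, h₃, h₂, .inr h₄⟩
    obtain ⟨i₁, v₁, w₁, rfl, rfl, rfl, ha⟩ := key h
    obtain ⟨i₂, v₂, w₂, hi, hv, rfl, hb⟩ := key h'
    obtain rfl := Fin.ext hi
    obtain rfl := Fin.ext hv
    rcases ha with ha | ha <;> rcases hb with hb | hb <;>
    · have := (hI i₁).unique ha hb (v := v₁) (by simp) (by simp)
      rw [Prod.mk.injEq] at this
      simp_all
  asymm h h' := by
    obtain ⟨i₁, u₁, v₁, rfl, rfl, rfl, ha⟩ := I.exists_of_arcFn h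
    rw [arcFn_coe, decide_eq_true_eq] at h'
    exact (I.acyclic i₁).asymm ha h'

theorem cost_eq {N : ℕ} (hn : I.numItems ≤ N) (hk : I.numAgents ≤ N) (y : ℕ → Option ℕ) :
    cost N I.arcFn y = ∑ i : Fin I.numAgents, ∑ e ∈ (I.graph i).arcs, arcCost y i e.1 e.2 := by
  have hz : ∀ i u v, ¬ (i < I.numAgents ∧ u < I.numItems ∧ v < I.numItems) →
      (if I.arcFn i u v = true then arcCost y i u v else 0) = 0 := by
    intro i u v h
    rw [if_neg fun h' => h (I.arcFn_lt i u v h')]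
  rw [cost, sum_range_eq_sum_fin hk _ fun i hi => Finset.sum_eq_zero fun u _ =>
    Finset.sum_eq_zero fun v _ => hz i u v (by omega)]
  refine Finset.sum_congr rfl fun i _ => ?_
  rw [sum_range_eq_sum_fin hn _ fun u hu => Finset.sum_eq_zero fun v _ => hz i u v (by omega)]
  have h₁ : ∀ u : Fin I.numItems, ∑ v ∈ Finset.range N,
      (if I.arcFn i u v = true then arcCost y i u v else 0) =
      ∑ v : Fin I.numItems, if (u, v) ∈ (I.graph i).arcs then arcCost y i u v else 0 := by
    intro u
    rw [sum_range_eq_sum_fin hn _ fun v hv => hz i u v (by omega)]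
    exact Finset.sum_congr rfl fun v _ => by simp [arcFn_coe]
  rw [Finset.sum_congr rfl fun u _ => h₁ u, ← Fintype.sum_prod_type
    (f := fun e : Fin I.numItems × Fin I.numItems =>
      if e ∈ (I.graph i).arcs then arcCost y i e.1 e.2 else 0)]
  simp

theorem encode_append (w : List (Option Bool)) :
    I.encode ++ w = code I.numItems I.numAgents I.vertFn I.arcFn w := by
  have hg : ∀ i : Fin I.numAgents, (I.graph i).encode.map some =
      graphCode I.numItems (I.vertFn i) (I.arcFn i) := by
    intro i
    rw [PrefGraph.encode, graphCode, List.map_append]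
    congr 1
    · rw [ofFn_eq_map_range _ (I.vertFn i) fun v => by rw [vertFn_coe], List.map_map]
      rfl
    · rw [ofFn_eq_map_range _ (fun u => (List.range I.numItems).map (I.arcFn i u)) fun u =>
        ofFn_eq_map_range _ _ fun v => by rw [arcFn_coe], List.map_flatten, List.map_map,
        List.flatMap]
      simp [Function.comp_def]
  rw [Instance.encode, code, ofFn_eq_map_range _
    (fun i => graphCode I.numItems (I.vertFn i) (I.arcFn i)) hg, ← List.flatMap]
  simp

end Instance

/-! ### Allocations as assignments, and the main results. -/

namespace Allocation

variable {I : Instance}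

/-- The allocation that is given by an assignment. -/
noncomputable def ofFun (I : Instance) (y : ℕ → Option ℕ) : Allocation I where
  items i := Finset.univ.filter fun v => y v = some (i : ℕ)
  disjoint i j hij := by
    rw [Finset.disjoint_left]
    intro v hi hj
    rw [Finset.mem_filter] at hi hj
    exact hij (Fin.ext (Option.some.inj (hi.2.symm.trans hj.2)))

/-- The assignment that is given by an allocation. -/
noncomputable def toFun (π : Allocation I) (v : ℕ) : Option ℕ :=
  if h : ∃ i : Fin I.numAgents, ∃ v' : Fin I.numItems, (v' : ℕ) = v ∧ v' ∈ π.items i then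
    some (h.choose : ℕ) else none

/-- The choice of an agent is harmless because the sets of an allocation are disjoint. -/
theorem toFun_eq (π : Allocation I) (i : Fin I.numAgents) (v : Fin I.numItems) :
    π.toFun v = some (i : ℕ) ↔ v ∈ π.items i := by
  have key : ∀ h : ∃ i : Fin I.numAgents, ∃ v' : Fin I.numItems, (v' : ℕ) = v ∧ v' ∈ π.items i,
      v ∈ π.items h.choose := by
    intro h
    obtain ⟨v', hv, hm⟩ := h.choose_spec
    rwa [Fin.ext hv] at hm
  constructor
  · intro h
    unfold toFun at h
    split at h
    · next hex =>
      have := key hex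
      rwa [Fin.ext (Option.some.inj h)] at this
    · exact absurd h (by simp)
  · intro h
    have hex : ∃ i : Fin I.numAgents, ∃ v' : Fin I.numItems, (v' : ℕ) = v ∧ v' ∈ π.items i :=
      ⟨i, v, rfl, h⟩
    rw [toFun, dif_pos hex]
    by_contra hne
    have : hex.choose ≠ i := fun h => hne (by rw [h])
    exact Finset.disjoint_left.mp (π.disjoint _ _ this) (key hex) h

/-- The sum over the vertices is turned into a sum over the arcs. A tail is dominated by itself
only, a head by either end, which gives the costs 0, 1 and 2. -/
theorem totalDissatisfaction_eq (hI : ∀ i, (I.graph i).IsDirectedMatching) {N : ℕ}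
    (hn : I.numItems ≤ N) (hk : I.numAgents ≤ N) (π : Allocation I) (y : ℕ → Option ℕ)
    (hy : ∀ (i : Fin I.numAgents) (v : Fin I.numItems), y v = some (i : ℕ) ↔ v ∈ π.items i) :
    totalDissatisfaction π = cost N I.arcFn y := by
  rw [I.cost_eq hn hk]
  refine Finset.sum_congr rfl fun i _ => ?_
  rw [dissatisfaction, Finset.card_filter, (hI i).sum_verts]
  refine Finset.sum_congr rfl fun e he => ?_
  have h₁ : (∃ v ∈ π.items i, (I.graph i).DominatedBy e.1 v) ↔ e.1 ∈ π.items i := by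
    simp [(hI i).dominated_tail (u := e.1) (v := e.2) he]
  have h₂ : (∃ v ∈ π.items i, (I.graph i).DominatedBy e.2 v) ↔
      e.1 ∈ π.items i ∨ e.2 ∈ π.items i := by
    simp [(hI i).dominated_head (u := e.1) (v := e.2) he, and_or_left, exists_or]
  simp only [h₁, h₂, arcCost, hy]
  by_cases ha : e.1 ∈ π.items i
  · simp [ha]
  · by_cases hb : e.2 ∈ π.items i
    · simp [ha, hb]
    · simp [ha, hb]

theorem mem_ofFun (y : ℕ → Option ℕ) (i : Fin I.numAgents) (v : Fin I.numItems) :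
    y v = some (i : ℕ) ↔ v ∈ (ofFun I y).items i := by
  simp [ofFun]

theorem ofFun_opt_le (hI : ∀ i, (I.graph i).IsDirectedMatching) {N : ℕ}
    (hn : I.numItems ≤ N) (hk : I.numAgents ≤ N) (π : Allocation I) :
    cost N I.arcFn (opt N I.arcFn) ≤ totalDissatisfaction π := by
  rw [totalDissatisfaction_eq hI hn hk π _ π.toFun_eq]
  exact opt_isOptimal (I.isMatching hI hn hk) _

theorem encode_ofFun (y : ℕ → Option ℕ) : (ofFun I y).encode = (List.range I.numAgents).flatMap
    fun i => (List.range I.numItems).map fun v => decide (y v = some i) := by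
  rw [Allocation.encode, List.flatMap, ofFn_eq_map_range _
    (fun i => (List.range I.numItems).map fun v => decide (y v = some i))]
  intro i
  refine ofFn_eq_map_range _ _ fun v => ?_
  rw [decide_eq_decide]
  exact (mem_ofFun y i v).symm

theorem length_encode (π : Allocation I) : π.encode.length = I.numAgents * I.numItems := by
  simp [Allocation.encode, List.length_flatten, List.map_ofFn, Function.comp_def]

end Allocation

theorem minSumDissatisfaction_iff {I : Instance} (hI : ∀ i, (I.graph i).IsDirectedMatching) {N : ℕ}
    (hn : I.numItems ≤ N) (hk : I.numAgents ≤ N) (d : ℤ) :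
    MinSumDissatisfaction I d ↔ (cost N I.arcFn (opt N I.arcFn) : ℤ) ≤ d := by
  constructor
  · rintro ⟨π, hπ⟩
    have := Allocation.ofFun_opt_le hI hn hk π
    omega
  · intro h
    refine ⟨Allocation.ofFun I (opt N I.arcFn), ?_⟩
    rwa [Allocation.totalDissatisfaction_eq hI hn hk _ _ (Allocation.mem_ofFun _)]

theorem encode_eq (I : MatchingInstance) : I.encode =
    code I.1.numItems I.1.numAgents I.1.vertFn I.1.arcFn [] := by
  rw [← Instance.encode_append, List.append_nil]
  rfl

theorem encodeInput_eq (p : MatchingInstance × ℤ) : encodeInput p =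
    code p.1.1.numItems p.1.1.numAgents p.1.1.vertFn p.1.1.arcFn
      (none :: (encodeInt p.2).map some) := by
  rw [← Instance.encode_append]
  rfl

/-- An optimal allocation. -/
noncomputable def optimalAllocation (I : MatchingInstance) : Allocation I.1 :=
  -- The bound on the loops is the length of the input, as in the program.
  Allocation.ofFun I.1 (opt I.encode.length I.1.arcFn)

theorem size_lt (I : MatchingInstance) :
    I.1.numItems < I.encode.length ∧ I.1.numAgents < I.encode.length := by
  have := length_code I.1.numItems I.1.numAgents I.1.vertFn I.1.arcFn []
  rw [encode_eq]
  omega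

theorem optimalAllocation_isOptimal (I : MatchingInstance) : (optimalAllocation I).IsOptimal := by
  intro π
  obtain ⟨hn, hk⟩ := size_lt I
  rw [optimalAllocation, Allocation.totalDissatisfaction_eq I.2 hn.le hk.le _ _
    (Allocation.mem_ofFun _)]
  exact Allocation.ofFun_opt_le I.2 hn.le hk.le π

/-- The output is a matrix with one row per agent and one column per item, so its length is at most
N². -/
theorem polyTimeComputable_optimalAllocation :
    PolyTimeComputable MatchingInstance.encode (fun s : List Bool => s)
      (fun I => (optimalAllocation I).encode) := by
  refine Cmd.polyTimeComputable searchProg (by decide) (fun I => (size_lt I).1.pos)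
    (Q := fun N => N * N) (IsPoly.id.mul .id) (fun I => ?_) fun I => ?_
  · obtain ⟨hn, hk⟩ := size_lt I
    rw [Allocation.length_encode]
    exact Nat.mul_le_mul hk.le hn.le
  · obtain ⟨hn, hk⟩ := size_lt I
    rw [optimalAllocation, Allocation.encode_ofFun,
      ← exec_searchProg (I.1.isMatching I.2 hn.le hk.le) rfl hn hk I.1.arcFn_lt
        (s := I.1.vertFn) (e := fun _ => 0), ← encode_eq]

theorem polyTimeDecidable_minSumDissatisfaction :
    PolyTimeDecidable encodeInput (fun p => MinSumDissatisfaction p.1.1 p.2) := by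
  have hsize : ∀ p : MatchingInstance × ℤ, p.1.1.numItems < (encodeInput p).length ∧
      p.1.1.numAgents < (encodeInput p).length ∧
      (encodeInt p.2).length ≤ (encodeInput p).length := by
    intro p
    have := length_code p.1.1.numItems p.1.1.numAgents p.1.1.vertFn p.1.1.arcFn
      (none :: (encodeInt p.2).map some)
    rw [encodeInput_eq]
    simp only [List.length_cons, List.length_map] at this
    omega
  refine ⟨fun p => decide (MinSumDissatisfaction p.1.1 p.2), fun p => decide_eq_true_iff, ?_⟩
  refine Cmd.polyTimeComputable decideProg (by decide) (fun p => (hsize p).1.pos)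
    (Q := fun _ => 1) (.const 1) (fun p => le_rfl) fun p => ?_
  obtain ⟨hn, hk, hd⟩ := hsize p
  have h := exec_decideProg (p.1.1.isMatching p.1.2 hn.le hk.le) (e := fun _ => 0) rfl hn hk
    p.1.1.arcFn_lt (s := p.1.1.vertFn) hd
  rw [← encodeInput_eq] at h
  rw [h]
  simp only [minSumDissatisfaction_iff p.1.2 hn.le hk.le]
  rfl

end Dissatisfaction

theorem mainTheorem6 :
    Dissatisfaction.PolyTimeDecidable Dissatisfaction.encodeInput
      (fun p => Dissatisfaction.MinSumDissatisfaction p.1.1 p.2) ∧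
    ∃ opt : (I : Dissatisfaction.MatchingInstance) → Dissatisfaction.Allocation I.1,
      (∀ I, (opt I).IsOptimal) ∧
      Dissatisfaction.PolyTimeComputable Dissatisfaction.MatchingInstance.encode
        (fun s : List Bool => s) (fun I => (opt I).encode) := by
  exact ⟨Dissatisfaction.polyTimeDecidable_minSumDissatisfaction,
    Dissatisfaction.optimalAllocation, Dissatisfaction.optimalAllocation_isOptimal,
    Dissatisfaction.polyTimeComputable_optimalAllocation⟩
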